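/- Let $E$ be a directed graph (arbitrary sets $E^0$ of vertices and $E^1_+$ of directed edges, with origin and terminus maps $o,t$; $E^1$ consists of the edges $e\in E^1_+$ and their formal reversals $\bar e$). For $v\in E^0$ put $\Delta_{1,E}(v)=\{e\in E^1_+ : o(e)=v\}$ and let $\Sigma(E)=\{v\in E^0 : 0<\#\Delta_{1,E}(v)<\infty\}$. Let $G(E)$ be the fundamental groupoid of $E$: the finite reduced undirected paths, under concatenation followed by cancellation. Let $\widetilde E$ be the universal cover, the directed forest with vertex set $G(E)$ and a directed edge from $p$ to $pe$ whenever $e\in E^1_+$ and $t(p)=o(e)$. For a vertex $p$ of $\widetilde E$ and a finite set $D$ of directed edges of $\widetilde E$ with origin $p$, let $V_{\widetilde E}(p;D)$ be the set of the vertices that can be reached from $p$ along a finite directed path whose first edge is not in $D$ (including $p$), and $V_{\widetilde E}(p)=V_{\widetilde E}(p;\emptyset)$. The finite disjoint unions of such sets form a Boolean ring $\mathcal A(\widetilde E)$; let $\widehat A$ be its Stone space, that is, the set of its ultrafilters. The vertices of $\widetilde E$ are points of $\widehat A$, as fixed ultrafilters, and $G(E)$ acts on $\widehat A$. For $S\subseteq\Sigma(E)$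 let $\partial(\widetilde E,\widetilde S)=\widehat A\setminus\{p : t(p)\in S\}$, and let $X(E,S)\subseteq\partial(\widetilde E,\widetilde S)$ be the set of points represented by (finite or infinite) directed paths in $E$, i.e. of the ultrafilters containing $V_{\widetilde E}(u)$ for some $u\in E^0$. The Toeplitz graph algebra $\mathcal{TO}(E,S)$ is the (full) $C^*$-algebra of the restriction to $X(E,S)$ of the transformation groupoid $G(E)*\partial(\widetilde E,\widetilde S)$, and $\mathcal O(E)=\mathcal{TO}(E,\Sigma(E))$. For a subgraph $F$ of $E$ and $S\subseteq \Sigma(E)$ let $$S_F=\{v\in F^0\cap S : \Delta_{1,E}(v)\subseteq F^1_+\}\subseteq\Sigma(F).$$ The inclusion of $F$ in $E$ induces a $*$-homomorphism $\mathcal{TO}(F,S_F)\to\mathcal{TO}(E,S)$: a function $f\in C_c$ on the first groupoid is sent to the function $(\alpha,x)\mapsto f(\alpha,x|_F)$ for $\alpha\in G(F)$, and $0$ for $\alpha\notin G(F)$, where $x|_F$ is the ultrafilter of $\mathcal A(\widetilde F)$ with $V_{\widetilde F}(p;D)\in x|_F\iff V_{\widetilde E}(p;D)\in x$. In the same way an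 inclusion $F\subseteq F'$ of subgraphs induces $\mathcal{TO}(F,S_F)\to\mathcal{TO}(F',S_{F'})$. **Theorem 2.35.** Let $E$ be a directed graph, and let $\mathcal W$ be any collection of subgraphs of $E$ that is directed by inclusion and satisfies $\bigcup_{F\in\mathcal W}F^0=E^0$ and $\bigcup_{F\in\mathcal W}F^1=E^1$. Then, for every $S\subseteq\Sigma(E)$, the algebras $\mathcal{TO}(F,S_F)$, $F\in\mathcal W$, with the $*$-homomorphisms induced by the inclusions, form a directed system of $C^*$-algebras whose inductive limit is $\mathcal{TO}(E,S)$, with the canonical $*$-homomorphisms $\mathcal{TO}(F,S_F)\to\mathcal{TO}(E,S)$ induced by the inclusions: $$\mathcal{TO}(E,S)=\varinjlim_{F\in\mathcal W}\mathcal{TO}(F,S_F).$$ In particular $\mathcal O(E)=\varinjlim_{F\in\mathcal W}\mathcal{TO}(F,\Sigma(E)_F)$. -/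

import Mathlib

open scoped CompactlySupported

/-! ### Directed graphs, their boundaries, and the fundamental groupoid -/

/-- A directed graph: a set `verts` of vertices and a set `edges` of directed edges, with origin and
terminus maps `o`, `t`.  The vertices and edges live in ambient types `α`, `β`, so that
subgraphs are again of this form.  The reversed edge of `e` is the formal symbol `(e, false)`,
and `e` itself is `(e, true)`, so that `β × Bool` plays the role of the set of all edges. -/
structure DirGraph (α β : Type*) where
  verts : Set α
  edges : Set β
  o : β → α
  t : β → α
  o_mem : ∀ e ∈ edges, o e ∈ verts
  t_mem : ∀ e ∈ edges, t e ∈ verts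

namespace DirGraph

variable {α β : Type*}

/-- `F` is a subgraph of `E` (the values of `o`, `t` matter only on the edges). -/
structure IsSubgraph (F E : DirGraph α β) : Prop where
  verts_subset : F.verts ⊆ E.verts
  edges_subset : F.edges ⊆ E.edges
  o_eq : ∀ e ∈ F.edges, F.o e = E.o e
  t_eq : ∀ e ∈ F.edges, F.t e = E.t e

/-- `Δ₁(v)`: the directed edges with origin `v`. -/
def out (E : DirGraph α β) (v : α) : Set β := {e | e ∈ E.edges ∧ E.o e = v}

/-- `Σ(E)`: the vertices that emit a finite nonzero number of directed edges. -/
def regular (E : DirGraph α β) : Set α := {u | u ∈ E.verts ∧ (E.out u).Nonempty ∧ (E.out u).Finite}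

/-- There is a directed edge from `u` to `v`. -/
def Step (E : DirGraph α β) (u v : α) : Prop := ∃ e ∈ E.edges, E.o e = u ∧ E.t e = v

/-- `V(v)`: the vertices that can be reached from `v` along a finite directed path. -/
def reach (E : DirGraph α β) (v : α) : Set α := {w | Relation.ReflTransGen E.Step v w}

/-- `V(v; D) = {v} ∪ ⋃ {V(t(e)) | e ∈ Δ₁(v) ∖ D}`. -/
def cyl (E : DirGraph α β) (v : α) (D : Set β) : Set α := {v} ∪ ⋃ e ∈ E.out v \ D, E.reach (E.t e)

/-- The collection `𝓔(T)` of the sets `V(v; D)`, `D ⊆ Δ₁(v)` finite, and the empty set. -/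
def cylinders (T : DirGraph α β) : Set (Set α) :=
  {B | (∃ v ∈ T.verts, ∃ D ⊆ T.out v, D.Finite ∧ B = T.cyl v D) ∨ B = ∅}

/-- The collection `𝓐(T)` of finite disjoint unions of elements of `𝓔(T)`; it is a Boolean ring
of sets when `T` is a directed tree or forest. -/
def ringA (T : DirGraph α β) : Set (Set α) :=
  {B | ∃ 𝒟 : Set (Set α), 𝒟.Finite ∧ 𝒟 ⊆ T.cylinders ∧ 𝒟.PairwiseDisjoint id ∧ B = ⋃₀ 𝒟}

/-- The spectrum of `A(T)`, that is, the Stone space of `𝓐(T)`: the set of `𝓐(T)`-ultrafilters. -/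
@[ext] structure Spec (T : DirGraph α β) where
  sets : Set (Set α)
  subset_ringA : sets ⊆ T.ringA
  nonempty : sets.Nonempty
  empty_notMem : ∅ ∉ sets
  directed : ∀ B ∈ sets, ∀ C ∈ sets, ∃ D ∈ sets, D ⊆ B ∩ C
  superset : ∀ B ∈ sets, ∀ C ∈ T.ringA, B ⊆ C → C ∈ sets
  maximal : ∀ B ∈ T.ringA, (∀ C ∈ sets, (B ∩ C).Nonempty) → B ∈ sets

/-- The topology with basis the sets `[B] = {x | B ∈ x}`, `B ∈ 𝓐(T)`. -/
instance (T : DirGraph α β) : TopologicalSpace (Spec T) :=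
  TopologicalSpace.generateFrom {U | ∃ B ∈ T.ringA, U = {x : Spec T | B ∈ x.sets}}

/-- `x` is the fixed ultrafilter `{B | v ∈ B}` of the vertex `v`. -/
def Spec.IsPrincipalAt {T : DirGraph α β} (x : Spec T) (v : α) : Prop :=
  ∀ B ∈ T.ringA, (B ∈ x.sets ↔ v ∈ B)

end DirGraph

/-- An arrow with range `r`, source `s` and label `w`, an element of the free group, which is
the same as a reduced word in the edges and the reversed edges. -/
@[ext] structure Arrow (α β : Type*) where
  r : α
  w : FreeGroup β
  s : α

namespace Arrow

variable {α β : Type*}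

instance : TopologicalSpace (Arrow α β) := ⊥

instance : DiscreteTopology (Arrow α β) := ⟨rfl⟩

/-- Concatenation followed by cancellation; meaningful if `a.s = b.r`. -/
def comp (a b : Arrow α β) : Arrow α β := ⟨a.r, a.w * b.w, b.s⟩

/-- The reversed path. -/
def inv (a : Arrow α β) : Arrow α β := ⟨a.s, a.w⁻¹, a.r⟩

/-- The path of length zero at `u`. -/
def unit (u : α) : Arrow α β := ⟨u, 1, u⟩

theorem comp_assoc (a b c : Arrow α β) : (a.comp b).comp c = a.comp (b.comp c) := by
  simp [comp, mul_assoc]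

theorem inv_inv (a : Arrow α β) : a.inv.inv = a := by simp [inv]

theorem inv_comp (a b : Arrow α β) : (a.comp b).inv = b.inv.comp a.inv := by simp [inv, comp]

theorem inv_comp_cancel (a b : Arrow α β) (h : b.r = a.s) : a.inv.comp (a.comp b) = b := by
  ext <;> simp [inv, comp, h]

theorem comp_inv_cancel (a b : Arrow α β) (h : b.r = a.r) : a.comp (a.inv.comp b) = b := by
  ext <;> simp [inv, comp, h]

theorem div_comp_cancel (a b : Arrow α β) (h : a.s = b.s) : (a.comp b.inv).comp b = a := by
  ext <;> simp [inv, comp, h]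

theorem comp_div_cancel (a b : Arrow α β) (h : a.s = b.r) : (a.comp b).comp b.inv = a := by
  ext <;> simp [inv, comp, h]

end Arrow

namespace DirGraph

variable {α β : Type*}

/-- `E.Walk u L v`: the word `L` is a sequence of consecutive edges of `E` from `u` to `v`, where
`(e, true)` is traversed from `o e` to `t e` and `(e, false)` from `t e` to `o e`. -/
def Walk (E : DirGraph α β) : α → List (β × Bool) → α → Prop
  | u, [], v => u = v ∧ u ∈ E.verts
  | u, (e, true) :: L, v => e ∈ E.edges ∧ E.o e = u ∧ E.Walk (E.t e) L v
  | u, (e, false) :: L, v => e ∈ E.edges ∧ E.t e = u ∧ E.Walk (E.o e) L v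

/-- The fundamental groupoid `G(E) = E^*`: the finite (reduced, undirected) paths in `E`, as
arrows from their terminus `s` to their origin `r`, under `Arrow.comp` and `Arrow.inv`. -/
def paths (E : DirGraph α β) : Set (Arrow α β) :=
  {a | ∃ L, FreeGroup.IsReduced L ∧ FreeGroup.mk L = a.w ∧ E.Walk a.r L a.s}

theorem Walk.append {E : DirGraph α β} {L M : List (β × Bool)} {w : α} :
    ∀ {u : α}, E.Walk u (L ++ M) w ↔ ∃ v, E.Walk u L v ∧ E.Walk v M w := by
  induction L with
  | nil =>
    intro u
    constructor
    · intro h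
      refine ⟨u, ⟨rfl, ?_⟩, h⟩
      cases M with
      | nil => exact h.2
      | cons x M =>
        obtain ⟨e, b⟩ := x
        cases b
        · exact h.2.1 ▸ E.t_mem _ h.1
        · exact h.2.1 ▸ E.o_mem _ h.1
    · rintro ⟨v, ⟨rfl, _⟩, h⟩
      exact h
  | cons x L ih =>
    intro u
    obtain ⟨e, b⟩ := x
    cases b <;>
      simp only [List.cons_append, Walk, ih] <;>
      constructor
    · rintro ⟨h1, h2, v, h3, h4⟩; exact ⟨v, ⟨h1, h2, h3⟩, h4⟩
    · rintro ⟨v, ⟨h1, h2, h3⟩, h4⟩; exact ⟨h1, h2, v, h3, h4⟩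
    · rintro ⟨h1, h2, v, h3, h4⟩; exact ⟨v, ⟨h1, h2, h3⟩, h4⟩
    · rintro ⟨v, ⟨h1, h2, h3⟩, h4⟩; exact ⟨h1, h2, v, h3, h4⟩

theorem Walk.right_mem {E : DirGraph α β} {L : List (β × Bool)} {v : α} :
    ∀ {u : α}, E.Walk u L v → v ∈ E.verts := by
  induction L with
  | nil => rintro u ⟨rfl, h⟩; exact h
  | cons x L ih =>
    obtain ⟨e, b⟩ := x
    cases b
    · rintro u ⟨_, _, h⟩; exact ih h
    · rintro u ⟨_, _, h⟩; exact ih h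

theorem Walk.invRev {E : DirGraph α β} {L : List (β × Bool)} {v : α} :
    ∀ {u : α}, E.Walk u L v → E.Walk v (FreeGroup.invRev L) u := by
  induction L with
  | nil => rintro u ⟨rfl, h⟩; exact ⟨rfl, h⟩
  | cons x L ih =>
    obtain ⟨e, b⟩ := x
    cases b
    · rintro u ⟨h1, h2, h3⟩
      have := ih h3
      simp only [FreeGroup.invRev, List.map_cons, List.reverse_cons] at this ⊢
      exact Walk.append.2 ⟨_, this, h1, rfl, h2, h2 ▸ E.t_mem _ h1⟩
    · rintro u ⟨h1, h2, h3⟩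
      have := ih h3
      simp only [FreeGroup.invRev, List.map_cons, List.reverse_cons] at this ⊢
      exact Walk.append.2 ⟨_, this, h1, rfl, h2, h2 ▸ E.o_mem _ h1⟩

theorem Walk.step {E : DirGraph α β} {L M : List (β × Bool)} {u v : α}
    (h : FreeGroup.Red.Step L M) (hL : E.Walk u L v) : E.Walk u M v := by
  cases h with
  | @not L₁ L₂ e b =>
    obtain ⟨w, h1, h2⟩ := Walk.append.1 hL
    refine Walk.append.2 ⟨w, h1, ?_⟩
    cases b
    · obtain ⟨_, h3, _, _, h4⟩ := h2
      exact h3 ▸ h4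
    · obtain ⟨_, h3, _, _, h4⟩ := h2
      exact h3 ▸ h4

theorem mem_paths_of_walk {E : DirGraph α β} {a : Arrow α β} {L : List (β × Bool)}
    (h : FreeGroup.mk L = a.w) (hL : E.Walk a.r L a.s) : a ∈ E.paths := by
  classical
  refine ⟨FreeGroup.reduce L, ?_, ?_, ?_⟩
  · exact FreeGroup.isReduced_iff_reduce_eq.2 FreeGroup.reduce.idem
  · rw [FreeGroup.reduce.self, h]
  · have hr : FreeGroup.Red L (FreeGroup.reduce L) := FreeGroup.reduce.red
    generalize FreeGroup.reduce L = M at hr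
    induction hr with
    | refl => exact hL
    | tail _ h ih => exact ih.step h

theorem comp_mem {E : DirGraph α β} {a b : Arrow α β} (ha : a ∈ E.paths) (hb : b ∈ E.paths)
    (h : a.s = b.r) : a.comp b ∈ E.paths := by
  obtain ⟨L, _, hL, hL'⟩ := ha
  obtain ⟨M, _, hM, hM'⟩ := hb
  refine mem_paths_of_walk (L := L ++ M) ?_ (Walk.append.2 ⟨a.s, hL', h ▸ hM'⟩)
  rw [← FreeGroup.mul_mk, hL, hM]
  rfl

theorem inv_mem {E : DirGraph α β} {a : Arrow α β} (ha : a ∈ E.paths) : a.inv ∈ E.paths := by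
  obtain ⟨L, _, hL, hL'⟩ := ha
  refine mem_paths_of_walk (L := FreeGroup.invRev L) ?_ hL'.invRev
  rw [← FreeGroup.inv_mk, hL]
  rfl

theorem s_mem {E : DirGraph α β} {a : Arrow α β} (ha : a ∈ E.paths) : a.s ∈ E.verts := by
  obtain ⟨L, _, hL, hL'⟩ := ha
  exact hL'.right_mem

theorem r_mem {E : DirGraph α β} {a : Arrow α β} (ha : a ∈ E.paths) : a.r ∈ E.verts :=
  s_mem (inv_mem ha)

theorem unit_mem {E : DirGraph α β} {u : α} (hu : u ∈ E.verts) : Arrow.unit u ∈ E.paths :=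
  mem_paths_of_walk (L := []) rfl ⟨rfl, hu⟩

/-- The universal cover `Ẽ`: its vertices are the paths of `E`, and there is a directed edge
`(p, q)` whenever `p⁻¹q` is defined and is a directed edge of `E`. -/
def cover (E : DirGraph α β) : DirGraph (Arrow α β) (Arrow α β × Arrow α β) where
  verts := E.paths
  edges := {d | d.1 ∈ E.paths ∧ d.2 ∈ E.paths ∧ d.1.r = d.2.r ∧
    ∃ e ∈ E.edges, d.1.inv.comp d.2 = ⟨E.o e, FreeGroup.of e, E.t e⟩}
  o := Prod.fst
  t := Prod.snd
  o_mem := fun _ h => h.1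
  t_mem := fun _ h => h.2.1

end DirGraph

namespace DirGraph

variable {α β : Type*} {E : DirGraph α β}

/-! ### The action of the fundamental groupoid on the boundary of the universal cover -/

/-- `a⁻¹ B`: the vertices `q` of `Ẽ` for which `a q` is defined and belongs to `B`. -/
def transl (E : DirGraph α β) (a : Arrow α β) (B : Set (Arrow α β)) : Set (Arrow α β) :=
  {q | q ∈ E.paths ∧ q.r = a.s ∧ a.comp q ∈ B}

theorem cover_step_comp {a p q : Arrow α β} (ha : a ∈ E.paths) (hp : p.r = a.s)
    (h : E.cover.Step p q) : E.cover.Step (a.comp p) (a.comp q) := by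
  obtain ⟨⟨x, y⟩, ⟨hx, hy, hxy, he⟩, rfl, rfl⟩ := h
  simp only [cover] at *
  refine ⟨(a.comp x, a.comp y), ⟨comp_mem ha hx hp.symm, comp_mem ha hy (hxy ▸ hp.symm), rfl, ?_⟩,
    rfl, rfl⟩
  simp only [Arrow.inv_comp, Arrow.comp_assoc]
  rw [Arrow.inv_comp_cancel _ _ (hxy ▸ hp)]
  exact he

theorem cover_step_r {p q : Arrow α β} (h : E.cover.Step p q) : q.r = p.r := by
  obtain ⟨⟨x, y⟩, ⟨hx, hy, hxy, he⟩, rfl, rfl⟩ := h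
  exact hxy.symm

theorem cover_step_mem {p q : Arrow α β} (h : E.cover.Step p q) : q ∈ E.paths := by
  obtain ⟨⟨x, y⟩, ⟨hx, hy, hxy, he⟩, rfl, rfl⟩ := h
  exact hy

theorem cover_reach_r {p q : Arrow α β} (h : q ∈ E.cover.reach p) : q.r = p.r := by
  induction h with
  | refl => rfl
  | tail _ h ih => exact (cover_step_r h).trans ih

theorem cover_reach_mem {p q : Arrow α β} (hp : p ∈ E.paths) (h : q ∈ E.cover.reach p) :
    q ∈ E.paths := by
  cases h with
  | refl => exact hp
  | tail _ h => exact cover_step_mem h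

theorem cover_reach_comp {a p q : Arrow α β} (ha : a ∈ E.paths) (hp : p.r = a.s)
    (h : q ∈ E.cover.reach p) : a.comp q ∈ E.cover.reach (a.comp p) := by
  induction h with
  | refl => exact Relation.ReflTransGen.refl
  | tail h1 h ih => exact ih.tail (cover_step_comp ha ((cover_reach_r h1).trans hp) h)

/-- The action of an arrow on the edges of `Ẽ`. -/
def edgeComp (a : Arrow α β) (d : Arrow α β × Arrow α β) : Arrow α β × Arrow α β :=
  (a.comp d.1, a.comp d.2)

theorem edgeComp_mem_out {a p : Arrow α β} (ha : a ∈ E.paths) (hp : p.r = a.s)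
    {d : Arrow α β × Arrow α β} (hd : d ∈ E.cover.out p) :
    edgeComp a d ∈ E.cover.out (a.comp p) := by
  obtain ⟨⟨hx, hy, hxy, he⟩, rfl⟩ := hd
  simp only [cover] at hp
  refine ⟨⟨comp_mem ha hx hp.symm, comp_mem ha hy (hxy ▸ hp.symm), rfl, ?_⟩, rfl⟩
  simp only [Arrow.inv_comp, Arrow.comp_assoc, edgeComp]
  rw [Arrow.inv_comp_cancel _ _ (hxy ▸ hp)]
  exact he

theorem edgeComp_inv {a p : Arrow α β} (hp : p.r = a.s)
    {d : Arrow α β × Arrow α β} (hd : d ∈ E.cover.out p) :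
    edgeComp a.inv (edgeComp a d) = d := by
  obtain ⟨⟨hx, hy, hxy, he⟩, rfl⟩ := hd
  exact Prod.ext (Arrow.inv_comp_cancel _ _ hp) (Arrow.inv_comp_cancel _ _ (hxy ▸ hp))

theorem cover_cyl_r {p q : Arrow α β} {D : Set (Arrow α β × Arrow α β)}
    (h : q ∈ E.cover.cyl p D) : q.r = p.r := by
  rcases h with h | h
  · rw [h]
  · simp only [Set.mem_iUnion] at h
    obtain ⟨d, hd, h⟩ := h
    obtain ⟨⟨hx, hy, hxy, he⟩, rfl⟩ := hd.1
    exact (cover_reach_r h).trans hxy.symm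

theorem cover_cyl_mem {p q : Arrow α β} {D : Set (Arrow α β × Arrow α β)} (hp : p ∈ E.paths)
    (h : q ∈ E.cover.cyl p D) : q ∈ E.paths := by
  rcases h with h | h
  · rw [h]; exact hp
  · simp only [Set.mem_iUnion] at h
    obtain ⟨d, hd, h⟩ := h
    obtain ⟨⟨hx, hy, hxy, he⟩, rfl⟩ := hd.1
    exact cover_reach_mem hy h

theorem cover_cyl_comp {a p q : Arrow α β} {D : Set (Arrow α β × Arrow α β)} (ha : a ∈ E.paths)
    (hp : p.r = a.s) (hD : D ⊆ E.cover.out p) (h : q ∈ E.cover.cyl p D) :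
    a.comp q ∈ E.cover.cyl (a.comp p) (edgeComp a '' D) := by
  rcases h with h | h
  · left; rw [h]; rfl
  · right
    simp only [Set.mem_iUnion] at h ⊢
    obtain ⟨d, hd, h⟩ := h
    refine ⟨edgeComp a d, ⟨edgeComp_mem_out ha hp hd.1, ?_⟩, cover_reach_comp ha ?_ h⟩
    · rintro ⟨d', hd', h'⟩
      have := congrArg (edgeComp a.inv) h'
      rw [edgeComp_inv hp (hD hd'), edgeComp_inv hp hd.1] at this
      exact hd.2 (this ▸ hd')
    · obtain ⟨⟨hx, hy, hxy, he⟩, rfl⟩ := hd.1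
      exact hxy ▸ hp

theorem mem_paths_of_ringA {B : Set (Arrow α β)} (hB : B ∈ E.cover.ringA) {q : Arrow α β}
    (hq : q ∈ B) : q ∈ E.paths := by
  obtain ⟨𝒟, _, h𝒟, _, rfl⟩ := hB
  obtain ⟨C, hC, hq⟩ := hq
  rcases h𝒟 hC with ⟨v, hv, D, _, _, rfl⟩ | rfl
  · exact cover_cyl_mem hv hq
  · exact hq.elim

theorem transl_cylinders {a : Arrow α β} (ha : a ∈ E.paths) {B : Set (Arrow α β)}
    (hB : B ∈ E.cover.cylinders) : E.transl a B ∈ E.cover.cylinders := by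
  rcases hB with ⟨p, hp, D, hD, hDf, rfl⟩ | rfl
  · change p ∈ E.paths at hp
    by_cases h : p.r = a.r
    · have h' : p.r = a.inv.s := h
      have ha' := inv_mem ha
      refine Or.inl ⟨a.inv.comp p, comp_mem ha' hp h.symm, edgeComp a.inv '' D, ?_, hDf.image _, ?_⟩
      · rintro _ ⟨d, hd, rfl⟩
        exact edgeComp_mem_out ha' h' (hD hd)
      · have hD' : edgeComp a.inv '' D ⊆ E.cover.out (a.inv.comp p) := by
          rintro _ ⟨d, hd, rfl⟩
          exact edgeComp_mem_out ha' h' (hD hd)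
        have hDD : edgeComp a '' (edgeComp a.inv '' D) = D := by
          rw [Set.image_image]
          refine (Set.image_congr fun d hd => ?_).trans (Set.image_id _)
          have := edgeComp_inv h' (hD hd)
          rwa [Arrow.inv_inv] at this
        ext q
        constructor
        · rintro ⟨hq, hqr, hq'⟩
          have := cover_cyl_comp ha' h' hD hq'
          rwa [Arrow.inv_comp_cancel _ _ hqr] at this
        · intro hq
          have hqr : q.r = a.s := cover_cyl_r hq
          refine ⟨cover_cyl_mem (comp_mem ha' hp h.symm) hq, hqr, ?_⟩
          have := cover_cyl_comp ha rfl hD' hq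
          rwa [hDD, Arrow.comp_inv_cancel _ _ h] at this
    · right
      ext q
      simp only [Set.mem_empty_iff_false, iff_false]
      rintro ⟨_, _, hq'⟩
      exact h (cover_cyl_r hq').symm
  · right
    ext q
    simp [transl]

theorem transl_ringA {a : Arrow α β} (ha : a ∈ E.paths) {B : Set (Arrow α β)}
    (hB : B ∈ E.cover.ringA) : E.transl a B ∈ E.cover.ringA := by
  obtain ⟨𝒟, hf, h𝒟, hd, rfl⟩ := hB
  refine ⟨E.transl a '' 𝒟, hf.image _, ?_, ?_, ?_⟩
  · rintro _ ⟨C, hC, rfl⟩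
    exact transl_cylinders ha (h𝒟 hC)
  · rintro _ ⟨C, hC, rfl⟩ _ ⟨C', hC', rfl⟩ hne
    have hne' : C ≠ C' := fun h => hne (h ▸ rfl)
    refine Set.disjoint_left.2 fun q hq hq' => ?_
    exact Set.disjoint_left.1 (hd hC hC' hne') hq.2.2 hq'.2.2
  · ext q
    simp only [transl, Set.mem_ofPred_eq, Set.mem_sUnion, Set.mem_image]
    constructor
    · rintro ⟨h1, h2, C, hC, h⟩
      exact ⟨_, ⟨C, hC, rfl⟩, h1, h2, h⟩
    · rintro ⟨_, ⟨C, hC, rfl⟩, h1, h2, h⟩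
      exact ⟨h1, h2, C, hC, h⟩

theorem transl_comp {a b : Arrow α β} (hb : b ∈ E.paths) (h : a.s = b.r) (B : Set (Arrow α β)) :
    E.transl (a.comp b) B = E.transl b (E.transl a B) := by
  ext q
  simp only [transl, Set.mem_ofPred_eq, Arrow.comp_assoc]
  constructor
  · rintro ⟨h1, h2, h3⟩
    exact ⟨h1, h2, comp_mem hb h1 h2.symm, h.symm, h3⟩
  · rintro ⟨h1, h2, _, _, h3⟩
    exact ⟨h1, h2, h3⟩

theorem transl_transl_inv {a : Arrow α β} (ha : a ∈ E.paths) {B : Set (Arrow α β)}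
    (hB : B ∈ E.cover.ringA) : E.transl a (E.transl a.inv B) = {q | q ∈ B ∧ q.r = a.s} := by
  ext q
  constructor
  · rintro ⟨h1, h2, h3, h4, h5⟩
    rw [Arrow.inv_comp_cancel _ _ h2] at h5
    exact ⟨h5, h2⟩
  · rintro ⟨h1, h2⟩
    have hq := mem_paths_of_ringA hB h1
    refine ⟨hq, h2, comp_mem ha hq h2.symm, rfl, ?_⟩
    rwa [Arrow.inv_comp_cancel _ _ h2]

namespace Spec

/-- `λ(x) = v`: the point `x` of the spectrum belongs to the tree `λ⁻¹(v)` of the bundle `Ẽ`. -/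
def Over (x : Spec E.cover) (v : α) : Prop := ∃ B ∈ x.sets, ∀ q ∈ B, q.r = v

/-- `y = a · x`: `λ(x) = s(a)`, and `y = {a B | B ∈ x}` as ultrafilters. -/
structure Acts (a : Arrow α β) (x y : Spec E.cover) : Prop where
  mem : a ∈ E.paths
  isOver : x.Over a.s
  iff : ∀ B ∈ E.cover.ringA, (B ∈ y.sets ↔ E.transl a B ∈ x.sets)

theorem ext_of_ringA {T : DirGraph α β} {x y : Spec T}
    (h : ∀ B ∈ T.ringA, (B ∈ x.sets ↔ B ∈ y.sets)) : x = y := by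
  apply Spec.ext
  ext B
  exact ⟨fun hB => (h B (x.subset_ringA hB)).1 hB, fun hB => (h B (y.subset_ringA hB)).2 hB⟩

theorem Acts.unique {a : Arrow α β} {x y z : Spec E.cover} (h : Acts a x y) (h' : Acts a x z) :
    y = z :=
  ext_of_ringA fun B hB => (h.iff B hB).trans (h'.iff B hB).symm

theorem exists_disjoint {T : DirGraph α β} {x : Spec T} {B : Set α} (hB : B ∈ T.ringA)
    (h : B ∉ x.sets) : ∃ C ∈ x.sets, Disjoint B C := by
  by_contra! hc
  exact h (x.maximal B hB fun C hC => Set.not_disjoint_iff_nonempty_inter.1 (hc C hC))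

theorem not_disjoint {T : DirGraph α β} (x : Spec T) {B C : Set α} (hB : B ∈ x.sets)
    (hC : C ∈ x.sets) : ¬ Disjoint B C := by
  intro h
  obtain ⟨D, hD, hDD⟩ := x.directed B hB C hC
  rw [h.inter_eq] at hDD
  exact x.empty_notMem (Set.subset_empty_iff.1 hDD ▸ hD)

theorem isOpen_mem {T : DirGraph α β} {B : Set α} (hB : B ∈ T.ringA) :
    IsOpen {x : Spec T | B ∈ x.sets} :=
  TopologicalSpace.isOpen_generateFrom_of_mem ⟨B, hB, rfl⟩

instance {T : DirGraph α β} : T2Space (Spec T) := by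
  refine ⟨fun x y hxy => ?_⟩
  have key : ∀ x y : Spec T, ∀ B ∈ x.sets, B ∉ y.sets →
      ∃ U V : Set (Spec T), IsOpen U ∧ IsOpen V ∧ x ∈ U ∧ y ∈ V ∧ Disjoint U V := by
    intro x y B hB hB'
    obtain ⟨C, hC, hd⟩ := exists_disjoint (x.subset_ringA hB) hB'
    exact ⟨_, _, isOpen_mem (x.subset_ringA hB), isOpen_mem (y.subset_ringA hC), hB, hC,
      Set.disjoint_left.2 fun z hz hz' => z.not_disjoint hz hz' hd⟩
  by_contra! hc
  apply hxy
  apply Spec.ext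
  ext B
  constructor
  · intro hB
    by_contra hB'
    obtain ⟨U, V, h1, h2, h3, h4, h5⟩ := key x y B hB hB'
    exact hc U V h1 h2 h3 h4 h5
  · intro hB
    by_contra hB'
    obtain ⟨U, V, h1, h2, h3, h4, h5⟩ := key y x B hB hB'
    exact hc V U h2 h1 h4 h3 h5.symm

theorem Over.restrict {x : Spec E.cover} {v : α} (hx : x.Over v) {B : Set (Arrow α β)}
    (hB : B ∈ x.sets) : ∃ C ∈ x.sets, C ⊆ B ∧ ∀ q ∈ C, q.r = v := by
  obtain ⟨B', hB', h⟩ := hx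
  obtain ⟨C, hC, hCC⟩ := x.directed B hB B' hB'
  exact ⟨C, hC, fun q hq => (hCC hq).1, fun q hq => h q (hCC hq).2⟩

theorem transl_transl_inv_mem {x : Spec E.cover} {a : Arrow α β} (ha : a ∈ E.paths)
    (hx : x.Over a.s) {B : Set (Arrow α β)} (hB : B ∈ E.cover.ringA) :
    E.transl a (E.transl a.inv B) ∈ x.sets ↔ B ∈ x.sets := by
  have hr := transl_ringA ha (transl_ringA (inv_mem ha) hB)
  constructor
  · intro h
    refine x.superset _ h _ hB ?_
    rw [transl_transl_inv ha hB]
    exact fun q hq => hq.1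
  · intro h
    obtain ⟨C, hC, h1, h2⟩ := hx.restrict h
    refine x.superset _ hC _ hr ?_
    rw [transl_transl_inv ha hB]
    exact fun q hq => ⟨h1 hq, h2 q hq⟩

theorem Acts.over_r {a : Arrow α β} {x y : Spec E.cover} (h : Acts a x y) : y.Over a.r := by
  obtain ⟨C, hC, hCs⟩ := h.isOver
  have hC' := x.subset_ringA hC
  have hm := transl_ringA (inv_mem h.mem) hC'
  refine ⟨E.transl a.inv C, (h.iff _ hm).2 ?_, fun q hq => hq.2.1⟩
  exact (transl_transl_inv_mem h.mem h.isOver hC').2 hC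

theorem Acts.symm {a : Arrow α β} {x y : Spec E.cover} (h : Acts a x y) : Acts a.inv y x where
  mem := inv_mem h.mem
  isOver := h.over_r
  iff := fun B hB => by
    rw [h.iff _ (transl_ringA (inv_mem h.mem) hB), transl_transl_inv_mem h.mem h.isOver hB]

theorem Over.unique {x : Spec E.cover} {u v : α} (hu : x.Over u) (hv : x.Over v) : u = v := by
  obtain ⟨B, hB, h⟩ := hu
  obtain ⟨C, hC, h'⟩ := hv
  obtain ⟨q, hq, hq'⟩ := Set.not_disjoint_iff.1 (x.not_disjoint hB hC)
  exact (h q hq).symm.trans (h' q hq')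

theorem Acts.comp {a b : Arrow α β} {x y z : Spec E.cover} (h : Acts a y z) (h' : Acts b x y) :
    Acts (a.comp b) x z where
  mem := comp_mem h.mem h'.mem (h.isOver.unique h'.over_r)
  isOver := h'.isOver
  iff := fun B hB => by
    rw [h.iff B hB, h'.iff _ (transl_ringA h.mem hB),
      transl_comp h'.mem (h.isOver.unique h'.over_r)]

theorem exists_acts {a : Arrow α β} (ha : a ∈ E.paths) {x : Spec E.cover} (hx : x.Over a.s) :
    ∃ y, Acts a x y := by
  have key : ∀ C ∈ x.sets, (∀ q ∈ C, q.r = a.s) → E.transl a.inv C ∈ E.cover.ringA ∧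
      E.transl a (E.transl a.inv C) ∈ x.sets := fun C hC _ =>
    ⟨transl_ringA (inv_mem ha) (x.subset_ringA hC),
      (transl_transl_inv_mem ha hx (x.subset_ringA hC)).2 hC⟩
  refine ⟨⟨{B | B ∈ E.cover.ringA ∧ E.transl a B ∈ x.sets}, fun B hB => hB.1, ?_, ?_, ?_, ?_, ?_⟩,
    ha, hx, fun B hB => ⟨fun h => h.2, fun h => ⟨hB, h⟩⟩⟩
  · obtain ⟨C, hC, h⟩ := hx
    exact ⟨_, key C hC h⟩
  · rintro ⟨_, h⟩
    apply x.empty_notMem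
    convert h
    ext q
    simp [transl]
  · rintro B ⟨hB, hB'⟩ C ⟨hC, hC'⟩
    obtain ⟨D, hD, hDD⟩ := x.directed _ hB' _ hC'
    obtain ⟨D', hD', h1, h2⟩ := hx.restrict hD
    refine ⟨_, key D' hD' h2, ?_⟩
    rintro q ⟨hq, hqr, hq'⟩
    have := hDD (h1 hq')
    have e : a.comp (a.inv.comp q) = q := Arrow.comp_inv_cancel _ _ hqr
    exact ⟨e ▸ this.1.2.2, e ▸ this.2.2.2⟩
  · rintro B ⟨hB, hB'⟩ C hC hBC
    exact ⟨hC, x.superset _ hB' _ (transl_ringA ha hC) fun q hq => ⟨hq.1, hq.2.1, hBC hq.2.2⟩⟩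
  · intro B hB h
    refine ⟨hB, x.maximal _ (transl_ringA ha hB) fun C hC => ?_⟩
    obtain ⟨C', hC', h1, h2⟩ := hx.restrict hC
    obtain ⟨q, hq, hq1, hq2, hq3⟩ := h _ (key C' hC' h2)
    refine ⟨a.inv.comp q, ⟨comp_mem (inv_mem ha) hq1 hq2.symm, rfl, ?_⟩, h1 hq3⟩
    rwa [Arrow.comp_inv_cancel _ _ hq2]

theorem Acts.isPrincipalAt {a p : Arrow α β} {x y : Spec E.cover} (h : Acts a x y)
    (hp : p ∈ E.paths) (hpr : p.r = a.s) (hx : x.IsPrincipalAt p) :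
    y.IsPrincipalAt (a.comp p) := fun B hB => by
  rw [h.iff B hB, hx _ (transl_ringA h.mem hB)]
  exact ⟨fun h => h.2.2, fun h => ⟨hp, hpr, h⟩⟩

end Spec

end DirGraph

namespace DirGraph

variable {α β : Type*}

/-! ### The Toeplitz graph groupoid -/

/-- `∂(Ẽ, S̃)`: the complement in the spectrum of `A(Ẽ)` of the set `S̃` of vertices `p` of `Ẽ`
with `t(p) ∈ S`, where a vertex is identified with its fixed ultrafilter. -/
def boundary (E : DirGraph α β) (S : Set α) : Set (Spec E.cover) :=
  {x | ¬ ∃ p ∈ E.paths, p.s ∈ S ∧ x.IsPrincipalAt p}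

/-- The transversal `X(E, S)`: the points of `∂(Ẽ, S̃)` that are represented by directed paths
in `E`.  The path of `E` that represents a point `x` is the geodesic of `Ẽ` from the vertex
`u = λ(x)` to `x`, and it is directed if and only if `x` belongs to the support of `V(u)`. -/
def transversal (E : DirGraph α β) (S : Set α) : Set (Spec E.cover) :=
  {x | x ∈ E.boundary S ∧ ∃ u ∈ E.verts, E.cover.reach (Arrow.unit u) ∈ x.sets}

/-- The Toeplitz graph groupoid: the restriction to `X(E, S)` of the transformation groupoid
`G(E) * ∂(Ẽ, S̃)`.  Its elements are the pairs `(a, x)` with `s(a) = λ(x)` and `x`, `a x` in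
`X(E, S)`; the range `y = a x` is recorded for convenience. -/
structure TG (E : DirGraph α β) (S : Set α) where
  arrow : Arrow α β
  src : Spec E.cover
  rng : Spec E.cover
  src_mem : src ∈ E.transversal S
  rng_mem : rng ∈ E.transversal S
  acts : Spec.Acts arrow src rng

namespace TG

variable {E : DirGraph α β} {S : Set α}

theorem eq_of {γ δ : TG E S} (h1 : γ.arrow = δ.arrow) (h2 : γ.src = δ.src) : γ = δ := by
  obtain ⟨a, x, y, _, _, h⟩ := γ
  obtain ⟨b, x', y', _, _, h'⟩ := δ
  obtain rfl : a = b := h1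
  obtain rfl : x = x' := h2
  obtain rfl := h.unique h'
  rfl

/-- The product `(a, b x)(b, x) = (ab, x)`. -/
def comp (γ δ : TG E S) (h : γ.src = δ.rng) : TG E S where
  arrow := γ.arrow.comp δ.arrow
  src := δ.src
  rng := γ.rng
  src_mem := δ.src_mem
  rng_mem := γ.rng_mem
  acts := Spec.Acts.comp γ.acts (h ▸ δ.acts)

/-- The inverse `(a, x)⁻¹ = (a⁻¹, a x)`. -/
def inv (γ : TG E S) : TG E S where
  arrow := γ.arrow.inv
  src := γ.rng
  rng := γ.src
  src_mem := γ.rng_mem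
  rng_mem := γ.src_mem
  acts := γ.acts.symm

/-- The element `γ δ⁻¹`, for `s(γ) = s(δ)`. -/
def div (γ δ : TG E S) (h : δ.src = γ.src) : TG E S := γ.comp δ.inv h.symm

theorem arrow_s_eq {γ δ : TG E S} (h : γ.src = δ.rng) : γ.arrow.s = δ.arrow.r :=
  γ.acts.isOver.unique (h ▸ δ.acts.over_r)

theorem inv_inv (γ : TG E S) : γ.inv.inv = γ := eq_of (Arrow.inv_inv _) rfl

theorem div_comp (γ δ : TG E S) (h : δ.src = γ.src) : (γ.div δ h).comp δ rfl = γ :=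
  eq_of (Arrow.div_comp_cancel _ _ (arrow_s_eq (δ := δ.inv) h.symm)) h

theorem comp_div (γ δ : TG E S) (h : γ.src = δ.rng) : (γ.comp δ h).div δ rfl = γ :=
  eq_of (Arrow.comp_div_cancel _ _ (arrow_s_eq h)) h.symm

theorem div_div (γ δ ε : TG E S) (h : ε.src = γ.src) (h' : δ.src = ε.rng) :
    (γ.div ε h).div δ h' = γ.div (δ.comp ε h') h := by
  apply eq_of
  · simp only [div, comp, inv, Arrow.inv_comp, Arrow.comp_assoc]
  · rfl

theorem inv_div (γ δ : TG E S) (h : δ.src = γ.src) : (γ.div δ h).inv = δ.div γ h.symm := by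
  apply eq_of
  · simp only [div, comp, inv, Arrow.inv_comp, Arrow.inv_inv]
  · rfl

/-- The relative product topology of `G × X(E, S)`, where `G` is discrete. -/
instance : TopologicalSpace (TG E S) :=
  TopologicalSpace.induced (fun γ => (γ.arrow, γ.src)) inferInstance

theorem continuous_pair : Continuous fun γ : TG E S => (γ.arrow, γ.src) :=
  continuous_induced_dom

theorem continuous_arrow : Continuous (arrow : TG E S → Arrow α β) :=
  continuous_fst.comp continuous_pair

theorem continuous_src : Continuous (src : TG E S → Spec E.cover) :=
  continuous_snd.comp continuous_pair

theorem continuous_of {Y : Type*} [TopologicalSpace Y] {g : Y → TG E S}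
    (h1 : Continuous fun y => (g y).arrow) (h2 : Continuous fun y => (g y).src) :
    Continuous g :=
  continuous_induced_rng.2 (h1.prodMk h2)

instance : T2Space (TG E S) :=
  T2Space.of_injective_continuous
    (fun _ _ h => eq_of (congrArg Prod.fst h) (congrArg Prod.snd h)) continuous_pair

theorem isOpen_arrow (a : Arrow α β) : IsOpen {γ : TG E S | γ.arrow = a} :=
  (isOpen_discrete {a}).preimage continuous_arrow

theorem isClosed_arrow (a : Arrow α β) : IsClosed {γ : TG E S | γ.arrow = a} :=
  (isClosed_discrete {a}).preimage continuous_arrow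

theorem continuous_rng : Continuous (rng : TG E S → Spec E.cover) := by
  refine continuous_generateFrom_iff.2 ?_
  rintro _ ⟨B, hB, rfl⟩
  refine isOpen_iff_forall_mem_open.2 fun γ hγ => ?_
  refine ⟨{δ | δ.arrow = γ.arrow} ∩ src ⁻¹' {x | E.transl γ.arrow B ∈ x.sets}, ?_,
    (isOpen_arrow _).inter ((Spec.isOpen_mem (transl_ringA γ.acts.mem hB)).preimage
      continuous_src), rfl, (γ.acts.iff B hB).1 hγ⟩
  rintro δ ⟨h1, h2⟩
  refine (δ.acts.iff B hB).2 ?_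
  rw [h1]
  exact h2

theorem continuous_inv : Continuous (inv : TG E S → TG E S) :=
  continuous_of ((continuous_of_discreteTopology (f := Arrow.inv)).comp continuous_arrow)
    continuous_rng

theorem continuous_comp {Y : Type*} [TopologicalSpace Y] {f g : Y → TG E S} (hf : Continuous f)
    (hg : Continuous g) (h : ∀ y, (f y).src = (g y).rng) :
    Continuous fun y => (f y).comp (g y) (h y) := by
  refine continuous_of ?_ (show Continuous fun y => (g y).src from continuous_src.comp hg)
  exact (continuous_of_discreteTopology
    (f := fun p : Arrow α β × Arrow α β => p.1.comp p.2)).comp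
      ((continuous_arrow.comp hf).prodMk (continuous_arrow.comp hg))

theorem continuous_div {Y : Type*} [TopologicalSpace Y] {f g : Y → TG E S} (hf : Continuous f)
    (hg : Continuous g) (h : ∀ y, (g y).src = (f y).src) :
    Continuous fun y => (f y).div (g y) (h y) :=
  continuous_comp hf (continuous_inv.comp hg) _

theorem rng_mem_transversal {a : Arrow α β} {x y : Spec E.cover} (h : Spec.Acts a x y)
    (hx : x ∈ E.transversal S) (hy : E.cover.reach (Arrow.unit a.r) ∈ y.sets) :
    y ∈ E.transversal S := by
  refine ⟨?_, a.r, r_mem h.mem, hy⟩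
  rintro ⟨p, hp, hpS, hpp⟩
  have hpr : p.r = a.r := by
    refine (cover_reach_r (E := E) (p := Arrow.unit a.r) ?_)
    exact (hpp _ (y.subset_ringA hy)).1 hy
  exact hx.1 ⟨a.inv.comp p, comp_mem (inv_mem h.mem) hp hpr.symm, hpS,
    h.symm.isPrincipalAt hp hpr hpp⟩

theorem ringA_of_reach {p : Arrow α β} (hp : p ∈ E.paths) :
    E.cover.reach p ∈ E.cover.ringA := by
  refine ⟨{E.cover.reach p}, Set.finite_singleton _, ?_, Set.pairwiseDisjoint_singleton _ _,
    by simp⟩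
  rintro _ rfl
  refine Or.inl ⟨p, hp, ∅, Set.empty_subset _, Set.finite_empty, ?_⟩
  ext q
  simp only [reach, cyl, Set.mem_ofPred_eq, Set.mem_union, Set.mem_singleton_iff, Set.mem_iUnion,
    Set.sdiff_empty]
  rw [Relation.ReflTransGen.cases_head_iff]
  constructor
  · rintro (h | ⟨c, ⟨e, he, h1, h2⟩, h⟩)
    · exact Or.inl h.symm
    · exact Or.inr ⟨e, ⟨he, h1⟩, h2 ▸ h⟩
  · rintro (h | ⟨e, ⟨he, h1⟩, h⟩)
    · exact Or.inl h.symm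
    · exact Or.inr ⟨_, ⟨e, he, h1, rfl⟩, h⟩

theorem reach_mem (x : Spec E.cover) (hx : x ∈ E.transversal S) {v : α} (hv : x.Over v) :
    E.cover.reach (Arrow.unit v) ∈ x.sets := by
  obtain ⟨_, u, hu, h⟩ := hx
  have : x.Over u := ⟨_, h, fun q hq => cover_reach_r hq⟩
  exact hv.unique this ▸ h

/-- The set of points at which the arrow `b` acts is open. -/
theorem isOpen_domain (b : Arrow α β) :
    IsOpen {γ : TG E S | ∃ δ : TG E S, δ.arrow = b ∧ δ.src = γ.src} := by
  refine isOpen_iff_forall_mem_open.2 ?_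
  rintro γ ⟨δ, rfl, hδ⟩
  obtain ⟨B, hB, hBs⟩ := δ.acts.isOver
  have hr := ringA_of_reach (unit_mem (r_mem δ.acts.mem))
  have hR := (δ.acts.iff _ hr).1 (reach_mem _ δ.rng_mem δ.acts.over_r)
  refine ⟨src ⁻¹' {x | B ∈ x.sets} ∩
    src ⁻¹' {x | E.transl δ.arrow (E.cover.reach (Arrow.unit δ.arrow.r)) ∈ x.sets}, ?_,
    ((Spec.isOpen_mem (δ.src.subset_ringA hB)).preimage continuous_src).inter
      ((Spec.isOpen_mem (δ.src.subset_ringA hR)).preimage continuous_src), ?_, ?_⟩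
  · rintro ε ⟨h1, h2⟩
    obtain ⟨y, hy⟩ := Spec.exists_acts δ.acts.mem (x := ε.src) ⟨B, h1, hBs⟩
    exact ⟨⟨δ.arrow, ε.src, y, ε.src_mem,
      rng_mem_transversal hy ε.src_mem ((hy.iff _ hr).2 h2), hy⟩, rfl, rfl⟩
  · rw [hδ] at hB; exact hB
  · rw [hδ] at hR; exact hR

end TG

/-! ### The convolution algebra -/

/-- The compactly supported continuous functions on the groupoid `TG E S`, with convolution as
multiplication. -/
def Conv (E : DirGraph α β) (S : Set α) : Type _ := C_c(TG E S, ℂ)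

namespace Conv

variable {E : DirGraph α β} {S : Set α}

instance : FunLike (Conv E S) (TG E S) ℂ := inferInstanceAs (FunLike C_c(TG E S, ℂ) _ _)

noncomputable instance : AddCommGroup (Conv E S) := inferInstanceAs (AddCommGroup C_c(TG E S, ℂ))

noncomputable instance : Module ℂ (Conv E S) := inferInstanceAs (Module ℂ C_c(TG E S, ℂ))

@[ext] theorem ext {f g : Conv E S} (h : ∀ γ, f γ = g γ) : f = g := DFunLike.ext _ _ h

@[simp] theorem zero_apply (γ : TG E S) : (0 : Conv E S) γ = 0 := rfl

@[simp] theorem add_apply (f g : Conv E S) (γ : TG E S) : (f + g) γ = f γ + g γ := rfl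

@[simp] theorem smul_apply (c : ℂ) (f : Conv E S) (γ : TG E S) : (c • f) γ = c * f γ := rfl

theorem continuous (f : Conv E S) : Continuous f := f.toContinuousMap.continuous

theorem hasCompactSupport (f : Conv E S) : HasCompactSupport f :=
  CompactlySupportedContinuousMap.hasCompactSupport' f

/-- A summand of the convolution product. -/
noncomputable def term (f g : TG E S → ℂ) (γ δ : TG E S) : ℂ :=
  open Classical in if h : δ.src = γ.src then f (γ.div δ h) * g δ else 0

/-- The convolution product `(f * g)(γ) = ∑ f(γδ⁻¹) g(δ)`, over all `δ` with `s(δ) = s(γ)`. -/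
noncomputable def convFun (f g : TG E S → ℂ) (γ : TG E S) : ℂ := ∑ᶠ δ, term f g γ δ

theorem term_of_ne {f g : TG E S → ℂ} {γ δ : TG E S} (h : δ.src ≠ γ.src) :
    term f g γ δ = 0 := dif_neg h

theorem term_of_eq {f g : TG E S → ℂ} {γ δ : TG E S} (h : δ.src = γ.src) :
    term f g γ δ = f (γ.div δ h) * g δ := dif_pos h

theorem finite_arrows (f : Conv E S) : (TG.arrow '' (tsupport f)).Finite :=
  (f.hasCompactSupport.isCompact.image TG.continuous_arrow).finite_of_discrete

theorem finite_fiber (f : Conv E S) (x : Spec E.cover) :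
    {δ : TG E S | δ.src = x ∧ f δ ≠ 0}.Finite := by
  refine Set.Finite.of_finite_image (f := TG.arrow) (f.finite_arrows.subset ?_) ?_
  · rintro _ ⟨δ, hδ, rfl⟩
    exact ⟨δ, subset_tsupport _ hδ.2, rfl⟩
  · intro δ hδ ε hε h
    exact TG.eq_of h (hδ.1.trans hε.1.symm)

theorem finite_term (f : TG E S → ℂ) (g : Conv E S) (γ : TG E S) :
    (Function.support (term f g γ)).Finite := by
  refine (g.finite_fiber γ.src).subset fun δ hδ => ?_
  by_cases h : δ.src = γ.src
  · refine ⟨h, fun h0 => hδ ?_⟩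
    rw [term_of_eq h, h0, mul_zero]
  · exact absurd (term_of_ne h) hδ

theorem continuous_convFun (f g : Conv E S) : Continuous (convFun f g) := by
  classical
  set T := g.finite_arrows.toFinset with hT
  let u : Arrow α β → TG E S → TG E S → ℂ := fun b γ δ => if δ.arrow = b then term f g γ δ else 0
  have hu : ∀ b γ, (Function.support (u b γ)).Finite := fun b γ =>
    (finite_term f g γ).subset fun δ hδ h => hδ (by simp [u, h])
  have hsum : convFun f g = fun γ => ∑ b ∈ T, ∑ᶠ δ, u b γ δ := by
    funext γ
    rw [← finsum_sum_comm _ _ fun b _ => hu b γ]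
    refine finsum_congr fun δ => ?_
    simp only [Finset.sum_ite_eq]
    split_ifs with h
    · rfl
    · by_cases h' : δ.src = γ.src
      · rw [term_of_eq h']
        have : g δ = 0 := by
          by_contra h0
          exact h (by simpa [hT] using ⟨δ, subset_tsupport _ h0, rfl⟩)
        rw [this, mul_zero]
      · exact term_of_ne h'
  rw [hsum]
  refine continuous_finsetSum _ fun b _ => ?_
  have hval : ∀ γ δ : TG E S, δ.arrow = b → ∀ h : δ.src = γ.src,
      ∑ᶠ δ, u b γ δ = f (γ.div δ h) * g δ := by
    intro γ δ hb h
    rw [finsum_eq_single _ δ]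
    · simp only [u, hb, if_true, term_of_eq h]
    · intro ε hε
      by_cases h1 : ε.arrow = b
      · have : ε.src ≠ γ.src := fun h2 => hε (TG.eq_of (h1.trans hb.symm) (h2.trans h.symm))
        simp [u, term_of_ne this]
      · simp [u, h1]
  refine continuous_iff_continuousAt.2 fun γ₀ => ?_
  set O := {γ : TG E S | ∃ δ : TG E S, δ.arrow = b ∧ δ.src = γ.src} with hO
  have hOo : IsOpen O := TG.isOpen_domain b
  by_cases h0 : γ₀ ∈ O
  · refine ContinuousOn.continuousAt (s := O) ?_ (hOo.mem_nhds h0)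
    rw [continuousOn_iff_continuous_domRestrict]
    choose σ hσ1 hσ2 using fun γ : O => γ.2
    have hσ : Continuous σ := by
      refine TG.continuous_of ?_ ?_
      · simp only [hσ1]; exact continuous_const
      · simp only [hσ2]; exact TG.continuous_src.comp continuous_subtype_val
    have : O.domRestrict (fun γ => ∑ᶠ δ, u b γ δ) =
        fun γ : O => f ((γ : TG E S).div (σ γ) (hσ2 γ)) * g (σ γ) := by
      funext γ
      exact hval _ _ (hσ1 γ) (hσ2 γ)
    rw [this]
    exact (f.continuous.comp (TG.continuous_div continuous_subtype_val hσ hσ2)).mul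
      (g.continuous.comp hσ)
  · set K := TG.src '' (tsupport g ∩ {δ | δ.arrow = b}) with hK
    have hKc : IsClosed K :=
      ((g.hasCompactSupport.isCompact.inter_right (TG.isClosed_arrow b)).image
        TG.continuous_src).isClosed
    have hmem : γ₀ ∈ TG.src ⁻¹' Kᶜ := by
      rintro ⟨δ, ⟨_, hδ⟩, hs⟩
      exact h0 ⟨δ, hδ, hs⟩
    have hn := (hKc.isOpen_compl.preimage TG.continuous_src).mem_nhds hmem
    refine continuousAt_const (y := (0 : ℂ)) |>.congr ?_
    filter_upwards [hn] with γ hγ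
    refine (finsum_eq_zero_of_forall_eq_zero fun δ => ?_).symm
    by_cases h1 : δ.arrow = b
    · by_cases h2 : δ.src = γ.src
      · have : g δ = 0 := by
          by_contra h3
          exact hγ ⟨δ, ⟨subset_tsupport _ h3, h1⟩, h2⟩
        simp [u, term_of_eq h2, this]
      · simp [u, term_of_ne h2]
    · simp [u, h1]

theorem exists_of_convFun_ne_zero {f g : TG E S → ℂ} {γ : TG E S} (h : convFun f g γ ≠ 0) :
    ∃ (δ : TG E S) (hδ : δ.src = γ.src), f (γ.div δ hδ) ≠ 0 ∧ g δ ≠ 0 := by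
  by_contra! hc
  refine h (finsum_eq_zero_of_forall_eq_zero fun δ => ?_)
  by_cases hδ : δ.src = γ.src
  · rw [term_of_eq hδ]
    by_cases h0 : f (γ.div δ hδ) = 0
    · rw [h0, zero_mul]
    · rw [hc δ hδ h0, mul_zero]
  · exact term_of_ne hδ

theorem hasCompactSupport_convFun (f g : Conv E S) : HasCompactSupport (convFun f g) := by
  let P : Set (TG E S × TG E S) := {p | p.1.src = p.2.rng}
  have hP : IsClosed P := isClosed_eq (TG.continuous_src.comp continuous_fst)
    (TG.continuous_rng.comp continuous_snd)
  let m : P → TG E S := fun p => p.1.1.comp p.1.2 p.2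
  have hm : Continuous m := TG.continuous_comp (continuous_fst.comp continuous_subtype_val)
    (continuous_snd.comp continuous_subtype_val) _
  have hK : IsCompact ((↑) ⁻¹' (tsupport f ×ˢ tsupport g) : Set P) :=
    hP.isClosedEmbedding_subtypeVal.isCompact_preimage
      (f.hasCompactSupport.isCompact.prod g.hasCompactSupport.isCompact)
  refine HasCompactSupport.intro (hK.image hm) fun γ hγ => ?_
  by_contra h
  obtain ⟨δ, hδ, h1, h2⟩ := exists_of_convFun_ne_zero h
  exact hγ ⟨⟨(γ.div δ hδ, δ), rfl⟩, ⟨subset_tsupport _ h1, subset_tsupport _ h2⟩,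
    TG.div_comp γ δ hδ⟩

/-- The homeomorphism `γ ↦ γ⁻¹`. -/
def invHomeo : TG E S ≃ₜ TG E S where
  toFun := TG.inv
  invFun := TG.inv
  left_inv := TG.inv_inv
  right_inv := TG.inv_inv
  continuous_toFun := TG.continuous_inv
  continuous_invFun := TG.continuous_inv

noncomputable instance : Mul (Conv E S) where
  mul f g := (⟨⟨convFun f g, continuous_convFun f g⟩, hasCompactSupport_convFun f g⟩ :
    C_c(TG E S, ℂ))

/-- The involution `f^*(γ) = conj f(γ⁻¹)`. -/
noncomputable instance : Star (Conv E S) where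
  star f := (⟨⟨fun γ => star (f γ.inv), f.continuous.comp TG.continuous_inv |>.star⟩,
    (f.hasCompactSupport.comp_homeomorph invHomeo).comp_left (star_zero ℂ)⟩ : C_c(TG E S, ℂ))

theorem mul_apply (f g : Conv E S) (γ : TG E S) : (f * g) γ = ∑ᶠ δ, term f g γ δ := rfl

theorem star_apply (f : Conv E S) (γ : TG E S) : (star f) γ = star (f γ.inv) := rfl

theorem mul_assoc' (f g h : Conv E S) : f * g * h = f * (g * h) := by
  classical
  ext γ
  set A := (h.finite_fiber γ.src).toFinset with hA
  have hA' : ∀ k : TG E S → ℂ, ∀ γ', γ'.src = γ.src →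
      ∑ᶠ ε, term k h γ' ε = ∑ ε ∈ A, term k h γ' ε := by
    intro k γ' h'
    refine finsum_eq_sum_of_support_subset _ fun ε hε => ?_
    have hs : ε.src = γ'.src := by
      by_contra hne
      exact hε (term_of_ne hne)
    simp only [hA, Set.Finite.coe_toFinset]
    refine ⟨hs.trans h', fun h0 => hε ?_⟩
    rw [term_of_eq hs, h0, mul_zero]
  have hAs : ∀ ε ∈ A, ε.src = γ.src := by
    intro ε hε
    simp only [hA, Set.Finite.mem_toFinset] at hε
    exact hε.1
  let q : TG E S → TG E S → ℂ := fun ε η =>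
    if hη : η.src = γ.src then f (γ.div η hη) * term g h η ε else 0
  have hq : ∀ ε ∈ A, (Function.support (q ε)).Finite := by
    intro ε hε
    have : (Function.support (q ε)) ⊆
        {η | ∃ δ : TG E S, ∃ hδ : δ.src = ε.rng, g δ ≠ 0 ∧ δ.comp ε hδ = η} := by
      intro η hη
      by_cases h1 : η.src = γ.src
      · have h2 : ε.src = η.src := (hAs ε hε).trans h1.symm
        refine ⟨η.div ε h2, rfl, ?_, TG.div_comp _ _ _⟩
        intro h0
        apply hη
        simp only [q, h1, dite_true, term_of_eq h2, h0, zero_mul, mul_zero]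
      · exact absurd (dif_neg h1) hη
    refine Set.Finite.subset ?_ this
    refine Set.Finite.subset (((g.finite_fiber ε.rng).image
      (fun δ => if hδ : δ.src = ε.rng then δ.comp ε hδ else δ))) ?_
    rintro η ⟨δ, hδ, h0, rfl⟩
    exact ⟨δ, ⟨hδ, h0⟩, dif_pos hδ⟩
  calc (f * g * h) γ = ∑ ε ∈ A, term (f * g) h γ ε := hA' _ γ rfl
    _ = ∑ ε ∈ A, ∑ᶠ η, q ε η := by
      refine Finset.sum_congr rfl fun ε hε => ?_
      have hs := hAs ε hε
      rw [term_of_eq hs, mul_apply, finsum_mul' _ _ (finite_term _ _ _)]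
      let i : {δ : TG E S // δ.src = ε.rng} → {η : TG E S // η.src = γ.src} :=
        fun δ => ⟨δ.1.comp ε δ.2, hs⟩
      have hi : Function.Bijective i := by
        constructor
        · rintro ⟨δ, hδ⟩ ⟨δ', hδ'⟩ hh
          have h1 : δ.comp ε hδ = δ'.comp ε hδ' := congrArg Subtype.val hh
          have h2 : (δ.comp ε hδ).div ε rfl = (δ'.comp ε hδ').div ε rfl := by
            simp only [h1]
          rw [TG.comp_div, TG.comp_div] at h2
          exact Subtype.ext h2
        · rintro ⟨η, hη⟩
          exact ⟨⟨η.div ε (hs.trans hη.symm), rfl⟩, Subtype.ext (TG.div_comp η ε (hs.trans hη.symm))⟩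
      have e1 : ∑ᶠ δ, term f g (γ.div ε hs) δ * h ε =
          ∑ᶠ δ : {δ : TG E S // δ.src = ε.rng}, term f g (γ.div ε hs) δ * h ε := by
        rw [finsum_subtype_eq_finsum_cond (f := fun δ => term f g (γ.div ε hs) δ * h ε)
          (fun δ => δ.src = ε.rng)]
        refine finsum_congr fun δ => ?_
        by_cases hδ : δ.src = ε.rng
        · simp [hδ]
        · have : term f g (γ.div ε hs) δ = 0 := term_of_ne hδ
          simp [hδ, this]
      have e2 : ∑ᶠ η, q ε η = ∑ᶠ η : {η : TG E S // η.src = γ.src}, q ε η := by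
        rw [finsum_subtype_eq_finsum_cond (f := q ε) (fun η => η.src = γ.src)]
        refine finsum_congr fun η => ?_
        by_cases hη : η.src = γ.src
        · simp [hη]
        · simp [q, hη]
      rw [e1, e2]
      refine finsum_eq_of_bijective i hi ?_
      rintro ⟨δ, hδ⟩
      have hε' : ε.src = (δ.comp ε hδ).src := rfl
      simp only [i, q, term_of_eq (f := f) (γ := γ.div ε hs) hδ]
      rw [dif_pos (show (δ.comp ε hδ).src = γ.src from hs), term_of_eq hε', TG.comp_div,
        TG.div_div, mul_assoc]
    _ = ∑ᶠ η, ∑ ε ∈ A, q ε η := (finsum_sum_comm _ _ hq).symm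
    _ = (f * (g * h)) γ := by
      rw [mul_apply]
      refine finsum_congr fun η => ?_
      by_cases hη : η.src = γ.src
      · rw [term_of_eq hη, mul_apply, hA' _ _ hη, Finset.mul_sum]
        exact Finset.sum_congr rfl fun ε _ => dif_pos hη
      · rw [term_of_ne hη]
        exact Finset.sum_eq_zero fun ε _ => dif_neg hη

theorem mul_add' (f g h : Conv E S) : f * (g + h) = f * g + f * h := by
  ext γ
  rw [add_apply, mul_apply, mul_apply, mul_apply,
    ← finsum_add_distrib (finite_term _ _ _) (finite_term _ _ _)]
  refine finsum_congr fun δ => ?_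
  by_cases hδ : δ.src = γ.src
  · simp only [term_of_eq hδ, add_apply, mul_add]
  · simp only [term_of_ne hδ, add_zero]

theorem add_mul' (f g h : Conv E S) : (f + g) * h = f * h + g * h := by
  ext γ
  rw [add_apply, mul_apply, mul_apply, mul_apply,
    ← finsum_add_distrib (finite_term _ _ _) (finite_term _ _ _)]
  refine finsum_congr fun δ => ?_
  by_cases hδ : δ.src = γ.src
  · simp only [term_of_eq hδ, add_apply, add_mul]
  · simp only [term_of_ne hδ, add_zero]

theorem smul_mul' (c : ℂ) (f g : Conv E S) : (c • f) * g = c • (f * g) := by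
  ext γ
  rw [smul_apply, mul_apply, mul_apply, mul_finsum' _ _ (finite_term _ _ _)]
  refine finsum_congr fun δ => ?_
  by_cases hδ : δ.src = γ.src
  · simp only [term_of_eq hδ, smul_apply, mul_assoc]
  · simp only [term_of_ne hδ, mul_zero]

theorem mul_smul' (c : ℂ) (f g : Conv E S) : f * (c • g) = c • (f * g) := by
  ext γ
  rw [smul_apply, mul_apply, mul_apply, mul_finsum' _ _ (finite_term _ _ _)]
  refine finsum_congr fun δ => ?_
  by_cases hδ : δ.src = γ.src
  · simp only [term_of_eq hδ, smul_apply, mul_left_comm]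
  · simp only [term_of_ne hδ, mul_zero]

noncomputable instance : NonUnitalRing (Conv E S) :=
  { (inferInstance : AddCommGroup (Conv E S)), (inferInstance : Mul (Conv E S)) with
    left_distrib := mul_add'
    right_distrib := add_mul'
    zero_mul := fun f => by simpa using smul_mul' 0 0 f
    mul_zero := fun f => by simpa using mul_smul' 0 f 0
    mul_assoc := mul_assoc' }

instance : IsScalarTower ℂ (Conv E S) (Conv E S) := ⟨smul_mul'⟩

instance : SMulCommClass ℂ (Conv E S) (Conv E S) := ⟨fun c f g => (mul_smul' c f g).symm⟩

theorem star_conv (f g : Conv E S) : star (f * g) = star g * star f := by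
  ext γ
  have hs : star (∑ᶠ δ, term f g γ.inv δ) = ∑ᶠ δ, star (term f g γ.inv δ) :=
    (starAddEquiv (R := ℂ)).toAddMonoidHom.map_finsum (finite_term _ _ _)
  rw [star_apply, mul_apply, mul_apply, hs]
  let i : {δ : TG E S // δ.src = γ.rng} → {η : TG E S // η.src = γ.src} :=
    fun δ => ⟨δ.1.comp γ δ.2, rfl⟩
  have hi : Function.Bijective i := by
    constructor
    · rintro ⟨δ, hδ⟩ ⟨δ', hδ'⟩ hh
      have h1 : δ.comp γ hδ = δ'.comp γ hδ' := congrArg Subtype.val hh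
      have h2 : (δ.comp γ hδ).div γ rfl = (δ'.comp γ hδ').div γ rfl := by
        simp only [h1]
      rw [TG.comp_div, TG.comp_div] at h2
      exact Subtype.ext h2
    · rintro ⟨η, hη⟩
      exact ⟨⟨η.div γ hη.symm, rfl⟩, Subtype.ext (TG.div_comp η γ hη.symm)⟩
  have e1 : ∑ᶠ δ, star (term f g γ.inv δ) =
      ∑ᶠ δ : {δ : TG E S // δ.src = γ.rng}, star (term f g γ.inv δ) := by
    rw [finsum_subtype_eq_finsum_cond (f := fun δ => star (term f g γ.inv δ))
      (fun δ => δ.src = γ.rng)]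
    refine finsum_congr fun δ => ?_
    by_cases hδ : δ.src = γ.rng
    · simp [hδ]
    · have : term f g γ.inv δ = 0 := term_of_ne hδ
      simp [hδ, this]
  have e2 : ∑ᶠ η, term (⇑(star g)) (⇑(star f)) γ η =
      ∑ᶠ η : {η : TG E S // η.src = γ.src}, term (⇑(star g)) (⇑(star f)) γ η := by
    rw [finsum_subtype_eq_finsum_cond (f := term (⇑(star g)) (⇑(star f)) γ) (fun η => η.src = γ.src)]
    refine finsum_congr fun η => ?_
    by_cases hη : η.src = γ.src
    · simp [hη]
    · simp [term_of_ne hη, hη]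
  rw [e1, e2]
  refine finsum_eq_of_bijective i hi ?_
  rintro ⟨δ, hδ⟩
  have h1 : (δ.comp γ hδ).src = γ.src := rfl
  rw [term_of_eq (γ := γ.inv) hδ, term_of_eq h1, star_apply, star_apply, TG.inv_div, TG.comp_div,
    star_mul']
  have h2 : γ.inv.div δ hδ = (δ.comp γ hδ).inv := by
    apply TG.eq_of
    · simp only [TG.div, TG.comp, TG.inv, Arrow.inv_comp]
    · rfl
  rw [h2, mul_comm]

noncomputable instance : StarRing (Conv E S) where
  star_involutive f := by
    ext γ
    rw [star_apply, star_apply, TG.inv_inv, star_star]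
  star_mul := star_conv
  star_add f g := by
    ext γ
    simp only [star_apply, add_apply, star_add]

instance : StarModule ℂ (Conv E S) where
  star_smul c f := by
    ext γ
    simp only [star_apply, smul_apply]
    exact star_mul' c _

end Conv

end DirGraph

/-! ### The enveloping C*-algebra of a *-algebra -/

section Enveloping

open UniformSpace

variable {A : Type*} [NonUnitalRing A] [StarRing A] [Module ℂ A]

/-- The C*-seminorms on a *-algebra that are dominated by a given function `N`.  These are the
functions `a ↦ ‖π a‖`, for the *-representations `π` with `‖π a‖ ≤ N a` for all `a`. -/
structure IsCStarSeminorm (N : A → ℝ) (p : Seminorm ℂ A) : Prop where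
  mul_le : ∀ a b, p (a * b) ≤ p a * p b
  star_mul_self : ∀ a, p (star a * a) = p a ^ 2
  le : ∀ a, p a ≤ N a

/-- The supremum of the C*-seminorms dominated by `N` (a finite supremum, as it is at most `N a`). -/
noncomputable def maxNorm (N : A → ℝ) (a : A) : ℝ := ⨆ p : {p // IsCStarSeminorm N p}, p.1 a

theorem bddAbove_maxNorm (N : A → ℝ) (a : A) :
    BddAbove (Set.range fun p : {p // IsCStarSeminorm N p} => p.1 a) :=
  ⟨N a, by rintro _ ⟨p, rfl⟩; exact p.2.le a⟩

theorem le_maxNorm {N : A → ℝ} {p : Seminorm ℂ A} (hp : IsCStarSeminorm N p) (a : A) :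
    p a ≤ maxNorm N a := le_ciSup (bddAbove_maxNorm N a) ⟨p, hp⟩

theorem maxNorm_nonneg (N : A → ℝ) (a : A) : 0 ≤ maxNorm N a :=
  Real.iSup_nonneg fun p => apply_nonneg p.1 a

theorem maxNorm_le {N : A → ℝ} {a : A} {c : ℝ} (hc : 0 ≤ c)
    (h : ∀ p : Seminorm ℂ A, IsCStarSeminorm N p → p a ≤ c) : maxNorm N a ≤ c :=
  Real.iSup_le (fun p => h p.1 p.2) hc

theorem maxNorm_mul_le (N : A → ℝ) (a b : A) : maxNorm N (a * b) ≤ maxNorm N a * maxNorm N b :=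
  maxNorm_le (mul_nonneg (maxNorm_nonneg N a) (maxNorm_nonneg N b)) fun p hp =>
    (hp.mul_le a b).trans
      (mul_le_mul (le_maxNorm hp a) (le_maxNorm hp b) (apply_nonneg p b) (maxNorm_nonneg N a))

theorem maxNorm_star_mul_self (N : A → ℝ) (a : A) :
    maxNorm N (star a * a) = maxNorm N a * maxNorm N a := by
  apply le_antisymm
  · refine maxNorm_le (mul_self_nonneg _) fun p hp => ?_
    rw [hp.star_mul_self, sq]
    exact mul_self_le_mul_self (apply_nonneg p a) (le_maxNorm hp a)
  · have h : maxNorm N a ≤ Real.sqrt (maxNorm N (star a * a)) :=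
      maxNorm_le (Real.sqrt_nonneg _) fun p hp => Real.le_sqrt_of_sq_le
        ((hp.star_mul_self a).symm.le.trans (le_maxNorm hp _))
    calc maxNorm N a * maxNorm N a ≤ Real.sqrt (maxNorm N (star a * a)) *
          Real.sqrt (maxNorm N (star a * a)) := mul_self_le_mul_self (maxNorm_nonneg N a) h
      _ = maxNorm N (star a * a) := Real.mul_self_sqrt (maxNorm_nonneg N _)

/-- The seminorm `maxNorm N`. -/
noncomputable def maxSeminorm (N : A → ℝ) : Seminorm ℂ A :=
  Seminorm.of (maxNorm N)
    (fun a b => maxNorm_le (add_nonneg (maxNorm_nonneg N a) (maxNorm_nonneg N b)) fun p hp =>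
      (map_add_le_add p a b).trans (add_le_add (le_maxNorm hp a) (le_maxNorm hp b)))
    (fun c a => by
      simp only [maxNorm, map_smul_eq_mul]
      exact (Real.mul_iSup_of_nonneg (norm_nonneg c) _).symm)

/-- A copy of `A`, to carry the seminorm `maxSeminorm N`. -/
def PreEnveloping (_ : A → ℝ) : Type _ := A

namespace PreEnveloping

variable [IsScalarTower ℂ A A] [SMulCommClass ℂ A A] [StarModule ℂ A] (N : A → ℝ)

noncomputable instance : NonUnitalRing (PreEnveloping N) := inferInstanceAs (NonUnitalRing A)
instance : StarRing (PreEnveloping N) := inferInstanceAs (StarRing A)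
instance : Module ℂ (PreEnveloping N) := inferInstanceAs (Module ℂ A)
instance : IsScalarTower ℂ (PreEnveloping N) (PreEnveloping N) :=
  inferInstanceAs (IsScalarTower ℂ A A)
instance : SMulCommClass ℂ (PreEnveloping N) (PreEnveloping N) :=
  inferInstanceAs (SMulCommClass ℂ A A)
instance : StarModule ℂ (PreEnveloping N) := inferInstanceAs (StarModule ℂ A)

noncomputable instance : SeminormedAddCommGroup (PreEnveloping N) :=
  AddGroupSeminorm.toSeminormedAddCommGroup (maxSeminorm N).toAddGroupSeminorm

theorem norm_def (a : PreEnveloping N) : ‖a‖ = maxNorm (A := A) N a := rfl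

noncomputable instance : NonUnitalSeminormedRing (PreEnveloping N) :=
  { (inferInstance : SeminormedAddCommGroup (PreEnveloping N)),
    (inferInstance : NonUnitalRing (PreEnveloping N)) with
    norm_mul_le := maxNorm_mul_le N }

noncomputable instance : NormedSpace ℂ (PreEnveloping N) where
  norm_smul_le c a := (map_smul_eq_mul (maxSeminorm (A := A) N) c a).le

theorem norm_star_mul_self (a : PreEnveloping N) : ‖star a * a‖ = ‖a‖ * ‖a‖ :=
  maxNorm_star_mul_self (A := A) N a

theorem norm_star_le (a : PreEnveloping N) : ‖star a‖ ≤ ‖a‖ := by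
  have h := norm_star_mul_self N (star a)
  rw [star_star] at h
  have h' := h ▸ norm_mul_le a (star a)
  rcases (norm_nonneg (star a)).eq_or_lt with h0 | h0
  · rw [← h0]; exact norm_nonneg a
  · exact le_of_mul_le_mul_right h' h0

theorem norm_star (a : PreEnveloping N) : ‖star a‖ = ‖a‖ :=
  le_antisymm (norm_star_le N a) (by simpa using norm_star_le N (star a))

theorem uniformContinuous_star : UniformContinuous (star : PreEnveloping N → PreEnveloping N) :=
  (AddMonoidHomClass.isometry_of_norm (starAddEquiv : PreEnveloping N ≃+ PreEnveloping N)
    (norm_star N)).uniformContinuous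

end PreEnveloping

/-- The enveloping C*-algebra of `A` with respect to the *-representations dominated by `N`: the
Hausdorff completion of `A` in the seminorm `maxSeminorm N`. -/
abbrev Enveloping (N : A → ℝ) : Type _ := Completion (PreEnveloping N)

namespace Enveloping

variable [IsScalarTower ℂ A A] [SMulCommClass ℂ A A] [StarModule ℂ A] {N : A → ℝ}

/-- The product is the continuous extension of the product of `A`. -/
noncomputable instance : Mul (Enveloping N) :=
  ⟨Function.curry <| (Completion.isDenseInducing_coe.prodMap Completion.isDenseInducing_coe).extend
    ((↑) ∘ Function.uncurry ((· * ·) : PreEnveloping N → PreEnveloping N → PreEnveloping N))⟩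

/-- The involution is the continuous extension of the involution of `A`. -/
noncomputable instance : Star (Enveloping N) :=
  ⟨Completion.map (star : PreEnveloping N → PreEnveloping N)⟩

theorem coe_mul (a b : PreEnveloping N) : ((a * b : PreEnveloping N) : Enveloping N) = a * b :=
  ((Completion.isDenseInducing_coe.prodMap Completion.isDenseInducing_coe).extend_eq
    ((Completion.continuous_coe _).comp (continuous_mul (M := PreEnveloping N))) (a, b)).symm

theorem coe_star (a : PreEnveloping N) : ((star a : PreEnveloping N) : Enveloping N) = star ↑a :=
  (Completion.map_coe (PreEnveloping.uniformContinuous_star N) a).symm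

instance : ContinuousMul (Enveloping N) where
  continuous_mul := by
    let m := (AddMonoidHom.mul : PreEnveloping N →+ PreEnveloping N →+ PreEnveloping N).compr₂
      Completion.toCompl
    have : Continuous fun p : PreEnveloping N × PreEnveloping N => m p.1 p.2 :=
      (Completion.continuous_coe _).comp continuous_mul
    have di : IsDenseInducing (Completion.toCompl : PreEnveloping N → _) :=
      Completion.isDenseInducing_coe
    exact (di.extend_Z_bilin di this :)

instance : ContinuousStar (Enveloping N) where
  continuous_star := Completion.continuous_map

noncomputable instance : NonUnitalRing (Enveloping N) :=
  { (inferInstance : AddCommGroup (Enveloping N)), (inferInstance : Mul (Enveloping N)) with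
    zero_mul := fun a => Completion.induction_on a
      (isClosed_eq (by fun_prop) continuous_const) fun a => by
        rw [← Completion.coe_zero, ← coe_mul, zero_mul]
    mul_zero := fun a => Completion.induction_on a
      (isClosed_eq (by fun_prop) continuous_const) fun a => by
        rw [← Completion.coe_zero, ← coe_mul, mul_zero]
    mul_assoc := fun a b c => Completion.induction_on₃ a b c
      (isClosed_eq (by fun_prop) (by fun_prop)) fun a b c => by
        simp only [← coe_mul, mul_assoc]
    left_distrib := fun a b c => Completion.induction_on₃ a b c
      (isClosed_eq (by fun_prop) (by fun_prop)) fun a b c => by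
        simp only [← coe_mul, ← Completion.coe_add, mul_add]
    right_distrib := fun a b c => Completion.induction_on₃ a b c
      (isClosed_eq (by fun_prop) (by fun_prop)) fun a b c => by
        simp only [← coe_mul, ← Completion.coe_add, add_mul] }

noncomputable instance : StarRing (Enveloping N) where
  star_involutive a := Completion.induction_on a
    (isClosed_eq (by fun_prop) continuous_id) fun a => by
      rw [← coe_star, ← coe_star, star_star]
  star_mul a b := Completion.induction_on₂ a b
    (isClosed_eq (by fun_prop) (by fun_prop)) fun a b => by
      simp only [← coe_mul, ← coe_star, star_mul]
  star_add a b := Completion.induction_on₂ a b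
    (isClosed_eq (by fun_prop) (by fun_prop)) fun a b => by
      simp only [← Completion.coe_add, ← coe_star, star_add]

noncomputable instance : NonUnitalNormedRing (Enveloping N) where
  __ : NormedAddCommGroup (Enveloping N) := inferInstance
  __ : NonUnitalRing (Enveloping N) := inferInstance
  norm_mul_le a b := Completion.induction_on₂ a b
    (isClosed_le (by fun_prop) (by fun_prop)) fun a b => by
      rw [← coe_mul, Completion.norm_coe, Completion.norm_coe, Completion.norm_coe]
      exact norm_mul_le a b

instance : CStarRing (Enveloping N) where
  norm_mul_self_le a := Completion.induction_on a
    (isClosed_le (by fun_prop) (by fun_prop)) fun a => by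
      rw [← coe_star, ← coe_mul, Completion.norm_coe, Completion.norm_coe]
      exact (PreEnveloping.norm_star_mul_self N a).ge

theorem continuous_smul' (c : ℂ) : Continuous fun a : Enveloping N => c • a :=
  continuous_const_smul c

theorem coe_smul' (c : ℂ) (a : PreEnveloping N) :
    ((c • a : PreEnveloping N) : Enveloping N) = c • (a : Enveloping N) :=
  Completion.coe_smul c a

instance : IsScalarTower ℂ (Enveloping N) (Enveloping N) where
  smul_assoc c a b := Completion.induction_on₂ a b
    (isClosed_eq (((continuous_smul' c).comp continuous_fst).mul continuous_snd)
      ((continuous_smul' c).comp (continuous_fst.mul continuous_snd))) fun a b => by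
      change (c • (a : Enveloping N)) * (b : Enveloping N) = c • ((a : Enveloping N) * b)
      rw [← coe_smul', ← coe_mul, ← coe_mul, ← coe_smul', smul_mul_assoc]

instance : SMulCommClass ℂ (Enveloping N) (Enveloping N) where
  smul_comm c a b := Completion.induction_on₂ a b
    (isClosed_eq ((continuous_smul' c).comp (continuous_fst.mul continuous_snd))
      (continuous_fst.mul ((continuous_smul' c).comp continuous_snd))) fun a b => by
      change c • ((a : Enveloping N) * b) = (a : Enveloping N) * (c • (b : Enveloping N))
      rw [← coe_smul', ← coe_mul, ← coe_mul, ← coe_smul', mul_smul_comm]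

instance : StarModule ℂ (Enveloping N) where
  star_smul c a := Completion.induction_on a
    (isClosed_eq (continuous_star.comp (continuous_smul' c))
      ((continuous_smul' (star c)).comp continuous_star)) fun a => by
      rw [← coe_smul', ← coe_star, ← coe_star, ← coe_smul', star_smul]

noncomputable instance : NonUnitalCStarAlgebra (Enveloping N) where

/-- The canonical map from `A` to its enveloping C*-algebra. -/
noncomputable def of (N : A → ℝ) : A →⋆ₙₐ[ℂ] Enveloping N where
  toFun a := ((show PreEnveloping N from a : PreEnveloping N) : Enveloping N)
  map_smul' c a := Completion.coe_smul (X := PreEnveloping N) c a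
  map_zero' := rfl
  map_add' a b := Completion.coe_add (α := PreEnveloping N) a b
  map_mul' a b := coe_mul (N := N) a b
  map_star' a := coe_star (N := N) a

theorem norm_of (N : A → ℝ) (a : A) : ‖of N a‖ = maxNorm N a :=
  Completion.norm_coe (E := PreEnveloping N) a

theorem denseRange_of (N : A → ℝ) : DenseRange (of N) :=
  Completion.denseRange_coe (α := PreEnveloping N)

end Enveloping

end Enveloping

namespace DirGraph

variable {α β : Type*}

/-! ### Toeplitz graph algebras and their connecting maps -/

/-- The `I`-norm of a function `f` on the groupoid: the larger one of `sup_x ∑_{s(γ) = x} |f(γ)|` and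
`sup_x ∑_{r(γ) = x} |f(γ)|`. -/
noncomputable def iNorm {E : DirGraph α β} {S : Set α} (f : Conv E S) : ℝ :=
  max (⨆ x : Spec E.cover, ∑ᶠ (γ : TG E S) (_ : γ.src = x), ‖f γ‖)
    (⨆ x : Spec E.cover, ∑ᶠ (γ : TG E S) (_ : γ.rng = x), ‖f γ‖)

/-- The Toeplitz graph algebra `TO(E, S)`, the (full) C*-algebra of the groupoid `TG E S`: the
completion of the convolution algebra in the supremum of the norms given by its *-representations
(as usual, those that are bounded by the `I`-norm). -/
abbrev TO (E : DirGraph α β) (S : Set α) : Type _ := Enveloping (iNorm : Conv E S → ℝ)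

/-- The graph algebra `O(E)`. -/
abbrev graphAlgebra (E : DirGraph α β) : Type _ := TO E E.regular

/-- The image of a function in the Toeplitz graph algebra. -/
noncomputable def TO.of {E : DirGraph α β} {S : Set α} : Conv E S →⋆ₙₐ[ℂ] TO E S :=
  Enveloping.of iNorm

/-- `S_F`, for a subgraph `F` of `E`: the vertices of `F` that belong to `S` and emit no edge of `E`
outside of `F`. -/
def restrictSet (F E : DirGraph α β) (S : Set α) : Set α :=
  {v | v ∈ F.verts ∧ v ∈ S ∧ E.out v ⊆ F.edges}

/-- `y` is the restriction of the ultrafilter `x` along the map `𝓐(F̃) → 𝓐(Ẽ)` given by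
`V_F̃(p; D) ↦ V_Ẽ(p; D)`, for a subgraph `F` of `E`. -/
def Restricts {F E : DirGraph α β} (x : Spec E.cover) (y : Spec F.cover) : Prop :=
  ∀ p ∈ F.paths, ∀ D ⊆ F.cover.out p, D.Finite →
    (F.cover.cyl p D ∈ y.sets ↔ E.cover.cyl p D ∈ x.sets)

/-- `g` is the pull-back of `f` along the partially defined map `(a, x) ↦ (a, y)`, where `a` is a path
in `F` and `y` is the restriction of `x`, extended by zero. -/
def IsPullback {F E : DirGraph α β} {R S : Set α} (f : Conv F R) (g : Conv E S) : Prop :=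
  ∀ γ : TG E S,
    (∀ η : TG F R, η.arrow = γ.arrow → Restricts γ.src η.src → g γ = f η) ∧
    ((∀ η : TG F R, η.arrow = γ.arrow → ¬ Restricts γ.src η.src) → g γ = 0)

/-- `φ` is the *-homomorphism induced by the inclusion of the subgraph `F` in `E`. -/
def IsInclusionMap {F E : DirGraph α β} {R S : Set α} (φ : TO F R →⋆ₙₐ[ℂ] TO E S) : Prop :=
  ∀ f : Conv F R, ∃ g : Conv E S, IsPullback f g ∧ φ (TO.of f) = TO.of g

end DirGraph

universe w

/-- `L`, with the maps `ι i`, is the inductive limit, in the category of C*-algebras and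
*-homomorphisms, of the system of the C*-algebras `A i` and the maps `κ i j`, over the index set `I`
with the preorder `r`. -/
structure IsInductiveLimit {I : Type*} (r : I → I → Prop) (A : I → Type*)
    [∀ i, NonUnitalCStarAlgebra (A i)] (κ : ∀ i j, r i j → (A i →⋆ₙₐ[ℂ] A j))
    (L : Type*) [NonUnitalCStarAlgebra L] (ι : ∀ i, A i →⋆ₙₐ[ℂ] L) : Prop where
  map_refl : ∀ i (h : r i i) (a : A i), κ i i h a = a
  map_trans : ∀ i j k (hij : r i j) (hjk : r j k) (hik : r i k) (a : A i),
    κ j k hjk (κ i j hij a) = κ i k hik a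
  compatible : ∀ i j (h : r i j) (a : A i), ι j (κ i j h a) = ι i a
  universal : ∀ (B : Type w) [NonUnitalCStarAlgebra B] (φ : ∀ i, A i →⋆ₙₐ[ℂ] B),
    (∀ i j (h : r i j) (a : A i), φ j (κ i j h a) = φ i a) →
      ∃! ψ : L →⋆ₙₐ[ℂ] B, ∀ i (a : A i), ψ (ι i a) = φ i a

/-!
The universal cover of a subgraph `F` of `E` is a subforest of that of `E`, and both whether `q` can be
reached from `p` and along which edges is read off from the reduced word of `p⁻¹ q`
(`mem_cover_reach_iff`).  Hence `V_F(p; D)` is the trace of `V_E(p; D)` on the vertices of the cover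
of `F`, and the Boolean ring of the cover of `F` is isomorphic to the subring `ringIn F E` of the Boolean
ring of the cover of `E` that is generated by the `V_E(p; D)` with `p` and `D` in the cover of `F`
(`ringA_cover_eq`, `subset_of_inter_paths_subset`).  So an ultrafilter `x` for `E` that contains some
`V_E(p)` with `p` in the cover of `F` has a restriction `x|_F`.

If `R = S_F`, restriction maps the points of the boundary over `F` onto the points of the boundary of `F`:
a vertex that is removed from the spectrum of `F` emits only edges of `F`, finitely many of them, so it
is isolated in the spectrum of `E` and removed from it as well.  Conversely every point lifts, by
compactness, because every `V_E(p; D)` with `p` and `D` in the cover of `F` contains a boundary point in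
its support, unless it is `{p}` for a vertex `p` that is removed from the spectrum of `F`
(`exists_mem_boundary_of_cyl_mem`, `exists_lift`).  The pull-back of functions along restriction is therefore a
*-homomorphism `Conv.pull` of convolution algebras, and, as the fibre of `TG F R` over `x|_F` is the
part with arrow in `F.paths` of the fibre of `TG E S` over `x`, it is isometric for the `I`-norm
(`Conv.iNorm_pull`).

The functions pulled back from the members of the directed family are dense for the `I`-norm.  For a
finite set `T` of arrows the part of the groupoid with arrow in `T` is compact, the functions on it
that come from the family form a *-algebra that separates points, and on functions supported
in it the `I`-norm is at most `#T` times the supremum norm (`Conv.exists_iNorm_sub_pull_lt`).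

Given compatible maps of the algebras `TO(F, S_F)` to a C*-algebra, the induced maps on the convolution
algebras are contractive for the `I`-norm.  By the isometry they define a contraction on a dense
*-subalgebra of the convolution algebra of `E`, which extends to the convolution algebra
(`Conv.exists_extension`) and then to `TO(E, S)` (`Enveloping.exists_extension`).  Density also gives
uniqueness.
-/

/-! ### Directed paths in the universal cover -/

namespace FreeGroup

variable {β : Type*}

/-- The element of the free group given by a word without inverse letters. -/
def pos (w : List β) : FreeGroup β := mk (w.map (·, true))

theorem isReduced_map_pair (b : Bool) (w : List β) : IsReduced (w.map (·, b)) := by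
  induction w with
  | nil => exact IsReduced.nil
  | cons x w ih =>
    cases w with
    | nil => exact IsReduced.singleton
    | cons y w => exact isReduced_cons_cons.2 ⟨fun _ => rfl, ih⟩

theorem IsReduced.eq_of_mk_eq {L M : List (β × Bool)} (hL : IsReduced L) (hM : IsReduced M)
    (h : mk L = mk M) : L = M := by
  classical
  rw [← hL.reduce_eq, ← hM.reduce_eq, reduce.sound h]

theorem pos_nil : pos ([] : List β) = 1 := rfl

theorem pos_append (v w : List β) : pos (v ++ w) = pos v * pos w := by
  simp [pos]

theorem pos_cons (e : β) (w : List β) : pos (e :: w) = of e * pos w := by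
  rw [← List.singleton_append, pos_append]
  rfl

theorem pos_injective : Function.Injective (pos : List β → FreeGroup β) := by
  intro v w h
  have h' := (isReduced_map_pair true v).eq_of_mk_eq (isReduced_map_pair true w) h
  exact List.map_injective_iff.2 (fun _ _ h => congrArg Prod.fst h) h'

theorem pos_inv (w : List β) : (pos w)⁻¹ = mk (w.map (·, false)).reverse := by
  simp [pos, invRev, Function.comp_def]

/-- Two positive words become a reduced quotient `b * b'⁻¹` after removal of their longest common
suffix `k`. -/
theorem exists_common_suffix (a : List β) : ∀ a' : List β, ∃ b b' k, a = b ++ k ∧ a' = b' ++ k ∧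
    IsReduced (b.map (·, true) ++ (b'.map (·, false)).reverse) := by
  have hneg : ∀ w : List β, IsReduced (w.map (·, false)).reverse := fun w => by
    rw [← List.map_reverse]; exact isReduced_map_pair _ _
  induction a using List.reverseRecOn with
  | nil => intro a'; exact ⟨[], a', [], rfl, by simp, by simpa using hneg a'⟩
  | append_singleton c x ih =>
    intro a'
    rcases List.eq_nil_or_concat' a' with rfl | ⟨c', y, rfl⟩
    · exact ⟨c ++ [x], [], [], by simp, rfl, by simpa using isReduced_map_pair true (c ++ [x])⟩
    · by_cases hxy : x = y
      · obtain ⟨b, b', k, rfl, rfl, h⟩ := ih c'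
        exact ⟨b, b', k ++ [x], by simp, by simp [hxy], h⟩
      · refine ⟨c ++ [x], c' ++ [y], [], by simp, by simp, ?_⟩
        refine List.isChain_append.2 ⟨isReduced_map_pair _ _, hneg _, ?_⟩
        rintro ⟨u, s⟩ hu ⟨v, t⟩ hv huv
        simp at hu hv
        exact absurd (hu.1.trans (huv.trans hv.1.symm)) hxy

end FreeGroup

namespace DirGraph

open FreeGroup

variable {α β : Type*} {E F : DirGraph α β}

theorem walk_of_mem_paths {a : Arrow α β} (ha : a ∈ E.paths) {L : List (β × Bool)}
    (hL : IsReduced L) (h : FreeGroup.mk L = a.w) : E.Walk a.r L a.s := by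
  obtain ⟨M, hM, hM', hw⟩ := ha
  rwa [hL.eq_of_mk_eq hM (h.trans hM'.symm)]

theorem Walk.mono (h : F.IsSubgraph E) {L : List (β × Bool)} {v : α} :
    ∀ {u : α}, F.Walk u L v → E.Walk u L v := by
  induction L with
  | nil => rintro u ⟨rfl, hu⟩; exact ⟨rfl, h.verts_subset hu⟩
  | cons x L ih =>
    obtain ⟨e, b⟩ := x
    cases b
    · rintro u ⟨h1, h2, h3⟩
      exact ⟨h.edges_subset h1, h.t_eq e h1 ▸ h2, h.o_eq e h1 ▸ ih h3⟩
    · rintro u ⟨h1, h2, h3⟩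
      exact ⟨h.edges_subset h1, h.o_eq e h1 ▸ h2, h.t_eq e h1 ▸ ih h3⟩

theorem IsSubgraph.paths_subset (h : F.IsSubgraph E) : F.paths ⊆ E.paths := by
  rintro a ⟨L, hL, hL', hw⟩
  exact ⟨L, hL, hL', hw.mono h⟩

theorem IsSubgraph.refl (E : DirGraph α β) : E.IsSubgraph E :=
  ⟨subset_rfl, subset_rfl, fun _ _ => rfl, fun _ _ => rfl⟩

theorem edge_mem_paths {e : β} (he : e ∈ E.edges) :
    (⟨E.o e, of e, E.t e⟩ : Arrow α β) ∈ E.paths :=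
  mem_paths_of_walk (L := [(e, true)]) rfl ⟨he, rfl, rfl, E.t_mem e he⟩

theorem cover_step_iff {p q : Arrow α β} : E.cover.Step p q ↔
    p ∈ E.paths ∧ ∃ e ∈ E.edges, E.o e = p.s ∧ q = ⟨p.r, p.w * of e, E.t e⟩ := by
  constructor
  · rintro ⟨⟨x, y⟩, ⟨hx, hy, hxy, e, he, h⟩, rfl, rfl⟩
    refine ⟨hx, e, he, (congrArg Arrow.r h).symm, ?_⟩
    ext
    · exact hxy.symm
    · have : x.w⁻¹ * y.w = of e := congrArg Arrow.w h
      simp only [cover, ← this, mul_inv_cancel_left]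
    · exact (congrArg Arrow.s h : y.s = E.t e)
  · rintro ⟨hp, e, he, ho, rfl⟩
    refine ⟨(p, ⟨p.r, p.w * of e, E.t e⟩), ⟨hp, ?_, rfl, e, he, ?_⟩, rfl, rfl⟩
    · exact comp_mem hp (edge_mem_paths he) ho.symm
    · simp [Arrow.comp, Arrow.inv, ho]

theorem mem_cover_out {p : Arrow α β} {d : Arrow α β × Arrow α β} :
    d ∈ E.cover.out p ↔ d.1 = p ∧ E.cover.Step p d.2 := by
  constructor
  · rintro ⟨hd, rfl⟩
    exact ⟨rfl, d, hd, rfl, rfl⟩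
  · rintro ⟨rfl, d', hd', h1, h2⟩
    have : d' = d := Prod.ext h1 h2
    exact ⟨this ▸ hd', rfl⟩

theorem eq_of_w_eq {p q : Arrow α β} (hp : p ∈ E.paths) (hq : q ∈ E.paths) (hr : q.r = p.r)
    (hw : q.w = p.w) : q = p := by
  have h : p.inv.comp q ∈ E.paths := comp_mem (inv_mem hp) hq hr.symm
  have := walk_of_mem_paths h IsReduced.nil (by simp [Arrow.comp, Arrow.inv, hw, FreeGroup.one_eq_mk])
  exact Arrow.ext hr hw this.1.symm

/-- A vertex of the cover is reached from `p` along a directed path exactly if it arises from `p` by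
multiplication with a positive word; the graph enters only through the condition that both
are vertices of its cover. -/
theorem mem_cover_reach_iff {p q : Arrow α β} (hp : p ∈ E.paths) : q ∈ E.cover.reach p ↔
    q ∈ E.paths ∧ q.r = p.r ∧ ∃ w, q.w = p.w * pos w := by
  constructor
  · intro h
    refine ⟨cover_reach_mem hp h, cover_reach_r h, ?_⟩
    induction h with
    | refl => exact ⟨[], by simp [pos_nil]⟩
    | tail _ h ih =>
      obtain ⟨w, hw⟩ := ih
      obtain ⟨_, e, _, _, rfl⟩ := cover_step_iff.1 h
      exact ⟨w ++ [e], by simp [hw, pos_append, pos_cons, pos_nil, mul_assoc]⟩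
  · rintro ⟨hq, hr, w, hw⟩
    have h : p.inv.comp q ∈ E.paths := comp_mem (inv_mem hp) hq hr.symm
    have hwalk := walk_of_mem_paths h (isReduced_map_pair true w)
      (by simp only [Arrow.comp, Arrow.inv, hw, inv_mul_cancel_left]; rfl)
    clear h
    change E.Walk p.s _ q.s at hwalk
    induction w generalizing p with
    | nil => rw [eq_of_w_eq hp hq hr (by simpa [pos_nil] using hw)]; exact Relation.ReflTransGen.refl
    | cons e w ih =>
      obtain ⟨he, ho, hwalk⟩ := hwalk
      have hs : E.cover.Step p ⟨p.r, p.w * of e, E.t e⟩ := cover_step_iff.2 ⟨hp, e, he, ho, rfl⟩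
      refine Relation.ReflTransGen.head hs (ih (cover_step_mem hs) hr ?_ hwalk)
      simp [hw, pos_cons, mul_assoc]

theorem cover_reach_trans {p q m : Arrow α β} (h : q ∈ E.cover.reach p) (h' : m ∈ E.cover.reach q) :
    m ∈ E.cover.reach p := Relation.ReflTransGen.trans h h'

theorem self_mem_reach (p : Arrow α β) : p ∈ E.cover.reach p := Relation.ReflTransGen.refl

theorem cover_step_mem_left {p q : Arrow α β} (h : E.cover.Step p q) : p ∈ E.paths :=
  (cover_step_iff.1 h).1

theorem cover_step_reach {p q : Arrow α β} (h : E.cover.Step p q) : q ∈ E.cover.reach p :=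
  Relation.ReflTransGen.single h

theorem cover_reach_antisymm {p q : Arrow α β} (hp : p ∈ E.paths) (h : q ∈ E.cover.reach p)
    (h' : p ∈ E.cover.reach q) : q = p := by
  obtain ⟨hq, hr, w, hw⟩ := (mem_cover_reach_iff hp).1 h
  obtain ⟨_, _, w', hw'⟩ := (mem_cover_reach_iff hq).1 h'
  have h1 : pos (w ++ w') = pos [] := by
    rw [pos_append, pos_nil]
    rw [hw, mul_assoc] at hw'
    exact left_eq_mul.1 hw'
  have h2 := List.append_eq_nil_iff.1 (pos_injective h1)
  refine eq_of_w_eq hp hq hr ?_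
  rw [hw, h2.1, pos_nil, mul_one]

theorem cover_step_not_reach {p q : Arrow α β} (h : E.cover.Step p q) : p ∉ E.cover.reach q := by
  intro h'
  have := cover_reach_antisymm (cover_step_mem_left h) (cover_step_reach h) h'
  obtain ⟨_, e, _, _, rfl⟩ := cover_step_iff.1 h
  have := congrArg Arrow.w this
  simp at this

/-- The first edge of a directed path in the cover is determined by the end points of the path. -/
theorem cover_step_unique {p q q' m : Arrow α β} (h : E.cover.Step p q) (h' : E.cover.Step p q')
    (hm : m ∈ E.cover.reach q) (hm' : m ∈ E.cover.reach q') : q = q' := by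
  obtain ⟨_, _, w, hw⟩ := (mem_cover_reach_iff (cover_step_mem h)).1 hm
  obtain ⟨_, _, w', hw'⟩ := (mem_cover_reach_iff (cover_step_mem h')).1 hm'
  obtain ⟨_, e, _, _, rfl⟩ := cover_step_iff.1 h
  obtain ⟨_, e', _, _, rfl⟩ := cover_step_iff.1 h'
  have h1 : pos (e :: w) = pos (e' :: w') := by
    rw [pos_cons, pos_cons]
    rw [hw] at hw'
    simpa [mul_assoc] using hw'
  have := (List.cons.inj (pos_injective h1)).1
  subst this
  rfl

theorem cover_reach_cases {p m : Arrow α β} (h : m ∈ E.cover.reach p) :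
    m = p ∨ ∃ q, E.cover.Step p q ∧ m ∈ E.cover.reach q := by
  rcases Relation.ReflTransGen.cases_head h with h | ⟨c, h1, h2⟩
  · exact Or.inl h.symm
  · exact Or.inr ⟨c, h1, h2⟩

/-- Two vertices of the cover of a subgraph `F` with a common descendant in the cover of `E` have
a least common descendant, and it lies in the cover of `F`: the geodesic between the two
vertices runs forwards and then backwards, and turns there. -/
theorem exists_join (h : F.IsSubgraph E) {p p' m : Arrow α β} (hp : p ∈ F.paths)
    (hp' : p' ∈ F.paths) (hm : m ∈ E.cover.reach p) (hm' : m ∈ E.cover.reach p') :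
    ∃ q ∈ F.paths, E.cover.reach p ∩ E.cover.reach p' = E.cover.reach q := by
  have hpE := h.paths_subset hp
  have hpE' := h.paths_subset hp'
  -- Removal of the common suffix `k` of the words from `p` and from `p'` to `m` leaves the reduced
  -- word of the geodesic from `p` to `p'`, with turning point `p * pos b`.
  have key : ∀ m ∈ E.cover.reach p, m ∈ E.cover.reach p' → ∃ b b' k : List β,
      IsReduced (b.map (·, true) ++ (b'.map (·, false)).reverse) ∧
      FreeGroup.mk (b.map (·, true) ++ (b'.map (·, false)).reverse) = (p.inv.comp p').w ∧
      m ∈ E.paths ∧ m.r = p.r ∧ m.r = p'.r ∧ m.w = p.w * pos b * pos k ∧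
      p.w * pos b = p'.w * pos b' := by
    intro m hm hm'
    obtain ⟨hmp, hr, a, ha⟩ := (mem_cover_reach_iff hpE).1 hm
    obtain ⟨_, hr', a', ha'⟩ := (mem_cover_reach_iff hpE').1 hm'
    obtain ⟨b, b', k, rfl, rfl, hred⟩ := exists_common_suffix a a'
    rw [pos_append, ← mul_assoc] at ha ha'
    have hb : p.w * pos b = p'.w * pos b' := mul_right_cancel (ha.symm.trans ha')
    refine ⟨b, b', k, hred, ?_, hmp, hr, hr', ha, hb⟩
    rw [← mul_mk, ← pos_inv]
    change pos b * (pos b')⁻¹ = p.w⁻¹ * p'.w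
    rw [mul_inv_eq_iff_eq_mul, mul_assoc, ← hb, inv_mul_cancel_left]
  obtain ⟨b, b', k, hred, hmk, hmp, hr, hr', hw, hb⟩ := key m hm hm'
  have hwalk := walk_of_mem_paths (comp_mem (inv_mem hp) hp' (hr.symm.trans hr')) hred hmk
  obtain ⟨v, hv, hv'⟩ := Walk.append.1 hwalk
  have hq : (⟨p.r, p.w * pos b, v⟩ : Arrow α β) ∈ F.paths :=
    comp_mem (b := ⟨p.s, pos b, v⟩) hp (mem_paths_of_walk rfl hv) rfl
  have hqE := h.paths_subset hq
  refine ⟨_, hq, Set.Subset.antisymm ?_ ?_⟩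
  · rintro m ⟨hm, hm'⟩
    obtain ⟨c, c', k, hred', hmk', hmp, hr, hr', hw, hb⟩ := key m hm hm'
    -- The reduced word is unique, and `b` consists of its positive letters, so `b` does not depend on `m`.
    have hbc := hred.eq_of_mk_eq hred' (hmk.trans hmk'.symm)
    have : b = c := by
      have h1 : ∀ b b' : List β, ((b.map (·, true) ++ (b'.map (·, false)).reverse).filter
          (fun x : β × Bool => x.2)).map Prod.fst = b := by
        intro b b'
        simp [List.filter_append, List.filter_map, Function.comp_def]
      rw [← h1 b b', hbc, h1]
    subst this
    exact (mem_cover_reach_iff hqE).2 ⟨hmp, hr, k, hw⟩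
  · refine fun m hm => ⟨cover_reach_trans ?_ hm, cover_reach_trans ?_ hm⟩
    · exact (mem_cover_reach_iff hpE).2 ⟨hqE, rfl, b, rfl⟩
    · exact (mem_cover_reach_iff hpE').2 ⟨hqE, hr.symm.trans hr', b', hb⟩

end DirGraph

/-! ### The Boolean ring of the universal cover and its subrings -/

namespace DirGraph

open FreeGroup MeasureTheory

variable {α β : Type*} {E F : DirGraph α β}

theorem cover_step_mono (h : F.IsSubgraph E) {p q : Arrow α β} (hpq : F.cover.Step p q) :
    E.cover.Step p q := by
  obtain ⟨hp, e, he, ho, rfl⟩ := cover_step_iff.1 hpq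
  exact cover_step_iff.2 ⟨h.paths_subset hp, e, h.edges_subset he, (h.o_eq e he) ▸ ho,
    by rw [h.t_eq e he]⟩

theorem cover_step_of_mem (h : F.IsSubgraph E) {p q : Arrow α β} (hpq : E.cover.Step p q)
    (hp : p ∈ F.paths) (hq : q ∈ F.paths) : F.cover.Step p q := by
  obtain ⟨_, e, he, ho, rfl⟩ := cover_step_iff.1 hpq
  have hw := walk_of_mem_paths (comp_mem (inv_mem hp) hq rfl) (L := [(e, true)])
    IsReduced.singleton (by simp [Arrow.comp, Arrow.inv]; rfl)
  exact cover_step_iff.2 ⟨hp, e, hw.1, hw.2.1, by rw [← h.t_eq e hw.1]⟩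

theorem cover_reach_inter_paths (h : F.IsSubgraph E) {p : Arrow α β} (hp : p ∈ F.paths) :
    E.cover.reach p ∩ F.paths = F.cover.reach p := by
  ext q
  rw [Set.mem_inter_iff, mem_cover_reach_iff hp, mem_cover_reach_iff (h.paths_subset hp)]
  exact ⟨fun ⟨⟨_, h1⟩, h2⟩ => ⟨h2, h1⟩, fun ⟨h1, h2⟩ => ⟨⟨h.paths_subset h1, h2⟩, h1⟩⟩

theorem cover_out_mono (h : F.IsSubgraph E) (p : Arrow α β) : F.cover.out p ⊆ E.cover.out p :=
  fun _ hd => mem_cover_out.2 ⟨(mem_cover_out.1 hd).1, cover_step_mono h (mem_cover_out.1 hd).2⟩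

theorem step_of_mem_cover_out {p : Arrow α β} {d : Arrow α β × Arrow α β}
    (hd : d ∈ E.cover.out p) : E.cover.Step p d.2 := (mem_cover_out.1 hd).2

theorem mem_paths_of_mem_cover_out {p : Arrow α β} {d : Arrow α β × Arrow α β}
    (hd : d ∈ E.cover.out p) : d.2 ∈ E.paths := cover_step_mem (step_of_mem_cover_out hd)

theorem cover_cyl_eq {p : Arrow α β} {D : Set (Arrow α β × Arrow α β)} (hD : D ⊆ E.cover.out p) :
    E.cover.cyl p D = E.cover.reach p \ ⋃ d ∈ D, E.cover.reach d.2 := by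
  ext m
  simp only [cyl, Set.mem_union, Set.mem_singleton_iff, Set.mem_iUnion, Set.mem_sdiff, exists_prop,
    not_exists, not_and]
  constructor
  · rintro (rfl | ⟨d, ⟨hd, hdD⟩, hm⟩)
    · exact ⟨self_mem_reach _, fun d hd => cover_step_not_reach (step_of_mem_cover_out (hD hd))⟩
    · refine ⟨cover_reach_trans (cover_step_reach (step_of_mem_cover_out hd)) hm, ?_⟩
      intro d' hd' hm'
      have := cover_step_unique (step_of_mem_cover_out hd) (step_of_mem_cover_out (hD hd')) hm hm'
      refine hdD ?_
      rwa [Prod.ext ((mem_cover_out.1 hd).1.trans (mem_cover_out.1 (hD hd')).1.symm) this]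
  · rintro ⟨hm, hmD⟩
    rcases cover_reach_cases hm with rfl | ⟨q, hq, hm⟩
    · exact Or.inl rfl
    · exact Or.inr ⟨(p, q), ⟨mem_cover_out.2 ⟨rfl, hq⟩, fun hd => hmD _ hd hm⟩, hm⟩

theorem cover_cyl_subset_reach {p : Arrow α β} {D : Set (Arrow α β × Arrow α β)}
    (hD : D ⊆ E.cover.out p) : E.cover.cyl p D ⊆ E.cover.reach p := by
  rw [cover_cyl_eq hD]
  exact Set.sdiff_subset

theorem cover_cyl_empty (p : Arrow α β) : E.cover.cyl p ∅ = E.cover.reach p := by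
  rw [cover_cyl_eq (Set.empty_subset _)]
  simp

theorem self_mem_cyl (p : Arrow α β) (D : Set (Arrow α β × Arrow α β)) : p ∈ E.cover.cyl p D :=
  Or.inl rfl

theorem cover_cyl_inter_paths (h : F.IsSubgraph E) {p : Arrow α β} (hp : p ∈ F.paths)
    {D : Set (Arrow α β × Arrow α β)} (hD : D ⊆ F.cover.out p) :
    E.cover.cyl p D ∩ F.paths = F.cover.cyl p D := by
  rw [cover_cyl_eq hD, cover_cyl_eq (hD.trans (cover_out_mono h p)), ← cover_reach_inter_paths h hp]
  ext m
  simp only [Set.mem_inter_iff, Set.mem_sdiff, Set.mem_iUnion, exists_prop, not_exists, not_and]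
  constructor
  · rintro ⟨⟨h1, h2⟩, h3⟩
    refine ⟨⟨h1, h3⟩, fun d hd hm => h2 d hd ?_⟩
    rw [← cover_reach_inter_paths h (mem_paths_of_mem_cover_out (hD hd))] at hm
    exact hm.1
  · rintro ⟨⟨h1, h3⟩, h2⟩
    refine ⟨⟨h1, fun d hd hm => h2 d hd ?_⟩, h3⟩
    rw [← cover_reach_inter_paths h (mem_paths_of_mem_cover_out (hD hd))]
    exact ⟨hm, h3⟩

/-- Below a vertex `q ≠ p` of `V(p)`, the set `V(p; D)` contains everything or nothing. -/
theorem reach_inter_cyl {p q : Arrow α β} {D : Set (Arrow α β × Arrow α β)}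
    (hD : D ⊆ E.cover.out p) (hq : q ∈ E.cover.reach p) (hne : q ≠ p) :
    E.cover.reach q ⊆ E.cover.cyl p D ∨ Disjoint (E.cover.reach q) (E.cover.cyl p D) := by
  by_cases hc : q ∈ E.cover.cyl p D
  · left
    rcases hc with hc | hc
    · exact absurd hc hne
    · simp only [Set.mem_iUnion] at hc
      obtain ⟨d, hd, hc⟩ := hc
      intro m hm
      right
      simp only [Set.mem_iUnion]
      exact ⟨d, hd, cover_reach_trans hc hm⟩
  · right
    rw [cover_cyl_eq hD] at hc ⊢
    have : ∃ d ∈ D, q ∈ E.cover.reach d.2 := by simpa [hq] using hc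
    obtain ⟨d, hd, hqd⟩ := this
    refine Set.disjoint_left.2 fun m hm hm' => hm'.2 ?_
    simp only [Set.mem_iUnion]
    exact ⟨d, hd, cover_reach_trans hqd hm⟩

/-- The sets `V(p; D)` of the cover of `E` with `p` and `D` in the cover of the subgraph `F`, and
the empty set. -/
def cylindersIn (F E : DirGraph α β) : Set (Set (Arrow α β)) :=
  {B | (∃ p ∈ F.paths, ∃ D ⊆ F.cover.out p, D.Finite ∧ B = E.cover.cyl p D) ∨ B = ∅}

theorem cyl_mem_cylindersIn {p : Arrow α β} (hp : p ∈ F.paths) {D : Set (Arrow α β × Arrow α β)}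
    (hD : D ⊆ F.cover.out p) (hf : D.Finite) : E.cover.cyl p D ∈ cylindersIn F E :=
  Or.inl ⟨p, hp, D, hD, hf, rfl⟩

theorem reach_mem_cylindersIn {p : Arrow α β} (hp : p ∈ F.paths) :
    E.cover.reach p ∈ cylindersIn F E := by
  rw [← cover_cyl_empty]
  exact cyl_mem_cylindersIn hp (Set.empty_subset _) Set.finite_empty

/-- The intersection of `V(q)` with a set `V(p; D)`, for `q` in `V(p)`, is of the form `V(q; D')`. -/
theorem exists_reach_inter_cyl_eq {p q : Arrow α β} {D : Set (Arrow α β × Arrow α β)}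
    (h : F.IsSubgraph E) (hD : D ⊆ F.cover.out p) (hf : D.Finite) (hq : q ∈ E.cover.reach p)
    (hne : (E.cover.reach q ∩ E.cover.cyl p D).Nonempty) :
    ∃ D' ⊆ F.cover.out q, D'.Finite ∧
      E.cover.reach q ∩ E.cover.cyl p D = E.cover.cyl q D' := by
  have hDE := hD.trans (cover_out_mono h p)
  by_cases hqp : q = p
  · subst hqp
    exact ⟨D, hD, hf, Set.inter_eq_right.2 (cover_cyl_subset_reach hDE)⟩
  · refine ⟨∅, Set.empty_subset _, Set.finite_empty, ?_⟩
    rw [cover_cyl_empty]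
    rcases reach_inter_cyl hDE hq hqp with h1 | h1
    · exact Set.inter_eq_left.2 h1
    · exact absurd h1 (Set.not_disjoint_iff_nonempty_inter.2 hne)

theorem cyl_inter_cyl {p : Arrow α β} {D D' : Set (Arrow α β × Arrow α β)}
    (hD : D ⊆ E.cover.out p) (hD' : D' ⊆ E.cover.out p) :
    E.cover.cyl p D ∩ E.cover.cyl p D' = E.cover.cyl p (D ∪ D') := by
  rw [cover_cyl_eq hD, cover_cyl_eq hD', cover_cyl_eq (Set.union_subset hD hD'),
    Set.biUnion_union, Set.sdiff_inter_sdiff]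

theorem exists_cyl_inter_eq (h : F.IsSubgraph E) {p p' : Arrow α β} (hp : p ∈ F.paths)
    (hp' : p' ∈ F.paths) {D D' : Set (Arrow α β × Arrow α β)} (hD : D ⊆ F.cover.out p)
    (hD' : D' ⊆ F.cover.out p') (hf : D.Finite) (hf' : D'.Finite)
    (hne : (E.cover.cyl p D ∩ E.cover.cyl p' D').Nonempty) :
    ∃ q ∈ F.paths, ∃ D'' ⊆ F.cover.out q, D''.Finite ∧
      E.cover.cyl p D ∩ E.cover.cyl p' D' = E.cover.cyl q D'' ∧ q ∈ E.cover.reach p := by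
  obtain ⟨m, hm, hm'⟩ := hne
  have hs := cover_cyl_subset_reach (hD.trans (cover_out_mono h p))
  have hs' := cover_cyl_subset_reach (hD'.trans (cover_out_mono h p'))
  obtain ⟨q, hq, hqe⟩ := exists_join h hp hp' (hs hm) (hs' hm')
  have hqq : q ∈ E.cover.reach p ∩ E.cover.reach p' := hqe ▸ self_mem_reach q
  have hmq : m ∈ E.cover.reach q := hqe ▸ ⟨hs hm, hs' hm'⟩
  obtain ⟨A, hA, hAf, hAe⟩ := exists_reach_inter_cyl_eq h hD hf hqq.1 ⟨m, hmq, hm⟩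
  obtain ⟨A', hA', hAf', hAe'⟩ := exists_reach_inter_cyl_eq h hD' hf' hqq.2 ⟨m, hmq, hm'⟩
  refine ⟨q, hq, A ∪ A', Set.union_subset hA hA', hAf.union hAf', ?_, hqq.1⟩
  rw [← cyl_inter_cyl (hA.trans (cover_out_mono h q)) (hA'.trans (cover_out_mono h q)), ← hAe, ← hAe',
    ← Set.inter_inter_distrib_left]
  refine (Set.inter_eq_right.2 ?_).symm
  rw [← hqe]
  exact Set.inter_subset_inter hs hs'

/-- `B` is a disjoint union of finitely many members of `C`. -/
def IsFiniteDisjointUnion {X : Type*} (C : Set (Set X)) (B : Set X) : Prop :=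
  ∃ I : Finset (Set X), ↑I ⊆ C ∧ (I : Set (Set X)).PairwiseDisjoint id ∧ B = ⋃₀ I

namespace IsFiniteDisjointUnion

variable {X : Type*} {C : Set (Set X)}

theorem of_mem {B : Set X} (hB : B ∈ C) : IsFiniteDisjointUnion C B :=
  ⟨{B}, by simpa using hB, by simp, by simp⟩

theorem empty : IsFiniteDisjointUnion C ∅ := ⟨∅, by simp, by simp, by simp⟩

theorem union {A B : Set X} (hA : IsFiniteDisjointUnion C A) (hB : IsFiniteDisjointUnion C B)
    (h : Disjoint A B) : IsFiniteDisjointUnion C (A ∪ B) := by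
  classical
  obtain ⟨I, hI, hId, rfl⟩ := hA
  obtain ⟨J, hJ, hJd, rfl⟩ := hB
  refine ⟨I ∪ J, by simpa using ⟨hI, hJ⟩, ?_, by simp [Set.sUnion_union]⟩
  rw [Finset.coe_union, Set.pairwiseDisjoint_union]
  refine ⟨hId, hJd, fun s hs t ht _ => ?_⟩
  exact h.mono (Set.subset_sUnion_of_mem hs) (Set.subset_sUnion_of_mem ht)

theorem biUnion {ι : Type*} {s : Set ι} (hs : s.Finite) {f : ι → Set X} (hf : ∀ i ∈ s, f i ∈ C)
    (hd : s.PairwiseDisjoint f) : IsFiniteDisjointUnion C (⋃ i ∈ s, f i) := by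
  classical
  refine ⟨(hs.image f).toFinset, ?_, ?_, ?_⟩
  · rw [Set.Finite.coe_toFinset]
    rintro _ ⟨i, hi, rfl⟩
    exact hf i hi
  · rw [Set.Finite.coe_toFinset]
    rintro _ ⟨i, hi, rfl⟩ _ ⟨j, hj, rfl⟩ hne
    exact hd hi hj fun h => hne (h ▸ rfl)
  · rw [Set.Finite.coe_toFinset, Set.sUnion_image]

end IsFiniteDisjointUnion

theorem pairwiseDisjoint_reach {p : Arrow α β} {D : Set (Arrow α β × Arrow α β)}
    (hD : D ⊆ E.cover.out p) : D.PairwiseDisjoint fun d => E.cover.reach d.2 := by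
  intro d hd d' hd' hne
  refine Set.disjoint_left.2 fun m hm hm' => hne ?_
  have h := mem_cover_out.1 (hD hd)
  have h' := mem_cover_out.1 (hD hd')
  exact Prod.ext (h.1.trans h'.1.symm) (cover_step_unique h.2 h'.2 hm hm')

theorem isFiniteDisjointUnion_cyl_sdiff_cyl (h : F.IsSubgraph E) {p : Arrow α β}
    {D D' : Set (Arrow α β × Arrow α β)} (hD : D ⊆ F.cover.out p)
    (hD' : D' ⊆ F.cover.out p) (hf' : D'.Finite) :
    IsFiniteDisjointUnion (cylindersIn F E) (E.cover.cyl p D \ E.cover.cyl p D') := by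
  have hDE := hD.trans (cover_out_mono h p)
  have hDE' := hD'.trans (cover_out_mono h p)
  have : E.cover.cyl p D \ E.cover.cyl p D' = ⋃ d ∈ D' \ D, E.cover.reach d.2 := by
    rw [cover_cyl_eq hDE, cover_cyl_eq hDE']
    ext m
    simp only [Set.mem_sdiff, Set.mem_iUnion, exists_prop, not_exists, not_and, not_forall, not_not]
    constructor
    · rintro ⟨⟨h1, h2⟩, h3⟩
      obtain ⟨d, hd, hm⟩ := h3 h1
      exact ⟨d, ⟨hd, fun h => h2 d h hm⟩, hm⟩
    · rintro ⟨d, ⟨hd, hdD⟩, hm⟩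
      have h1 := step_of_mem_cover_out (hDE' hd)
      refine ⟨⟨cover_reach_trans (cover_step_reach h1) hm, fun d' hd' hm' => hdD ?_⟩,
        fun _ => ⟨d, hd, hm⟩⟩
      have h' := mem_cover_out.1 (hDE hd')
      rwa [Prod.ext ((mem_cover_out.1 (hDE' hd)).1.trans h'.1.symm)
        (cover_step_unique h1 h'.2 hm hm')]
  rw [this]
  exact .biUnion (hf'.subset Set.sdiff_subset)
    (fun d hd => reach_mem_cylindersIn (mem_paths_of_mem_cover_out (hD' hd.1)))
    (pairwiseDisjoint_reach (Set.sdiff_subset.trans hDE'))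

/-- Removal of the set `V(q)` from `V(p; D)` leaves at most one cylinder for each vertex on the
directed path from `p` to `q`, other than `q`. -/
theorem isFiniteDisjointUnion_cyl_sdiff_reach (h : F.IsSubgraph E) {p q : Arrow α β}
    (hp : p ∈ F.paths) (hq : q ∈ F.cover.reach p) {D : Set (Arrow α β × Arrow α β)}
    (hD : D ⊆ F.cover.out p) (hf : D.Finite) :
    IsFiniteDisjointUnion (cylindersIn F E) (E.cover.cyl p D \ E.cover.reach q) := by
  induction hq using Relation.ReflTransGen.head_induction_on generalizing D with
  | refl =>
    rw [← cover_cyl_empty q]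
    exact isFiniteDisjointUnion_cyl_sdiff_cyl h hD (Set.empty_subset _) Set.finite_empty
  | @head p p₁ hs hq ih =>
    have hp₁ := cover_step_mem hs
    have hsE := cover_step_mono h hs
    have hDE := hD.trans (cover_out_mono h p)
    have hD₁ : insert (p, p₁) D ⊆ F.cover.out p :=
      Set.insert_subset (mem_cover_out.2 ⟨rfl, hs⟩) hD
    have hqE : q ∈ E.cover.reach p₁ := by
      have hq' : q ∈ F.cover.reach p₁ := hq
      rw [← cover_reach_inter_paths h hp₁] at hq'
      exact hq'.1
    have e1 := cover_cyl_eq (hD₁.trans (cover_out_mono h p))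
    rw [Set.biUnion_insert] at e1
    -- If the first edge on the way to `q` belongs to `D`, then `V(q)` is disjoint from `V(p; D)`;
    -- otherwise `V(p; D)` is the union of `V(p; D ∪ {(p, p₁)})` and `V(p₁)`.
    by_cases hd : (p, p₁) ∈ D
    · have : E.cover.cyl p D \ E.cover.reach q = E.cover.cyl p D := by
        refine sdiff_eq_left.2 (Set.disjoint_left.2 fun m hm hm' => ?_)
        rw [cover_cyl_eq hDE] at hm
        exact hm.2 (Set.mem_biUnion hd (cover_reach_trans hqE hm'))
      rw [this]
      exact .of_mem (cyl_mem_cylindersIn hp hD hf)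
    · have : E.cover.cyl p D \ E.cover.reach q =
          E.cover.cyl p (insert (p, p₁) D) ∪ (E.cover.cyl p₁ ∅ \ E.cover.reach q) := by
        rw [e1, cover_cyl_eq hDE, cover_cyl_empty]
        ext m
        simp only [Set.mem_sdiff, Set.mem_union, Set.mem_iUnion, exists_prop, not_or, not_exists,
          not_and]
        constructor
        · rintro ⟨⟨h1, h2⟩, h3⟩
          by_cases hm : m ∈ E.cover.reach p₁
          · exact Or.inr ⟨hm, h3⟩
          · exact Or.inl ⟨h1, hm, h2⟩
        · rintro (⟨h1, h2, h3⟩ | ⟨h1, h2⟩)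
          · exact ⟨⟨h1, h3⟩, fun hm => h2 (cover_reach_trans hqE hm)⟩
          · refine ⟨⟨cover_reach_trans (cover_step_reach hsE) h1, fun d hdD hm => hd ?_⟩, h2⟩
            have h' := mem_cover_out.1 (hDE hdD)
            rwa [← cover_step_unique h'.2 hsE hm h1, ← h'.1]
      rw [this]
      refine .union (.of_mem (cyl_mem_cylindersIn hp hD₁ (hf.insert _)))
        (ih hp₁ (Set.empty_subset _) Set.finite_empty) ?_
      rw [e1, cover_cyl_empty]
      exact Set.disjoint_left.2 fun m hm hm' => hm.2 (Or.inl hm'.1)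

theorem isSetSemiring_cylindersIn (h : F.IsSubgraph E) : IsSetSemiring (cylindersIn F E) where
  empty_mem := Or.inr rfl
  inter_mem := by
    rintro _ (⟨p, hp, D, hD, hf, rfl⟩ | rfl) _ (⟨p', hp', D', hD', hf', rfl⟩ | rfl)
    · rcases Set.eq_empty_or_nonempty (E.cover.cyl p D ∩ E.cover.cyl p' D') with h0 | h0
      · exact Or.inr h0
      · obtain ⟨q, hq, A, hA, hAf, he, _⟩ := exists_cyl_inter_eq h hp hp' hD hD' hf hf' h0
        rw [he]
        exact cyl_mem_cylindersIn hq hA hAf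
    all_goals exact Or.inr (by simp)
  sdiff_eq_sUnion' := by
    change ∀ s ∈ _, ∀ t ∈ _, IsFiniteDisjointUnion _ _
    rintro _ (⟨p, hp, D, hD, hf, rfl⟩ | rfl) B hB
    · rcases Set.eq_empty_or_nonempty (E.cover.cyl p D ∩ B) with h0 | h0
      · rw [sdiff_eq_left.2 (Set.disjoint_iff_inter_eq_empty.2 h0)]
        exact .of_mem (cyl_mem_cylindersIn hp hD hf)
      · rcases hB with ⟨p', hp', D', hD', hf', rfl⟩ | rfl
        · obtain ⟨q, hq, A, hA, hAf, he, hqp⟩ := exists_cyl_inter_eq h hp hp' hD hD' hf hf' h0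
          have hAE := hA.trans (cover_out_mono h q)
          rw [← Set.sdiff_inter_self_eq_sdiff, Set.inter_comm, he]
          by_cases hqp' : q = p
          · subst hqp'
            exact isFiniteDisjointUnion_cyl_sdiff_cyl h hD hA hAf
          -- For `q ≠ p` the set `V(q)` lies in `V(p; D)`; the part outside of `V(q)` and the part
          -- inside are treated separately.
          · have hsub : E.cover.reach q ⊆ E.cover.cyl p D := by
              refine (reach_inter_cyl (hD.trans (cover_out_mono h p)) hqp hqp').resolve_right ?_
              refine Set.not_disjoint_iff.2 ⟨q, self_mem_reach q, ?_⟩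
              exact (he.symm ▸ self_mem_cyl q A : q ∈ E.cover.cyl p D ∩ _).1
            have : E.cover.cyl p D \ E.cover.cyl q A = (E.cover.cyl p D \ E.cover.reach q) ∪
                (E.cover.cyl q ∅ \ E.cover.cyl q A) := by
              rw [cover_cyl_empty]
              have := cover_cyl_subset_reach hAE
              ext m
              constructor
              · rintro ⟨h1, h2⟩
                by_cases hm : m ∈ E.cover.reach q
                · exact Or.inr ⟨hm, h2⟩
                · exact Or.inl ⟨h1, hm⟩
              · rintro (⟨h1, h2⟩ | ⟨h1, h2⟩)
                · exact ⟨h1, fun hm => h2 (this hm)⟩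
                · exact ⟨hsub h1, h2⟩
            rw [this]
            refine .union (isFiniteDisjointUnion_cyl_sdiff_reach h hp ?_ hD hf)
              (isFiniteDisjointUnion_cyl_sdiff_cyl h (Set.empty_subset _) hA hAf) ?_
            · rw [← cover_reach_inter_paths h hp]
              exact ⟨hqp, hq⟩
            · rw [cover_cyl_empty]
              exact Set.disjoint_left.2 fun m hm hm' => hm.2 hm'.1
        · simp at h0
    · rw [Set.empty_sdiff]
      exact .empty

/-- The ring of sets generated by `cylindersIn F E`, the image of `𝓐(F̃)` in `𝓐(Ẽ)` under the map
`V_F̃(p; D) ↦ V_Ẽ(p; D)`. -/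
def ringIn (F E : DirGraph α β) : Set (Set (Arrow α β)) := supClosure (cylindersIn F E)

theorem isSetRing_ringIn (h : F.IsSubgraph E) : IsSetRing (ringIn F E) :=
  (isSetSemiring_cylindersIn h).isSetRing_supClosure

theorem mem_ringIn_of_mem_cylindersIn {B : Set (Arrow α β)} (hB : B ∈ cylindersIn F E) :
    B ∈ ringIn F E := subset_supClosure hB

theorem ringA_cover_eq : E.cover.ringA = ringIn E E := by
  ext B
  rw [ringIn, (isSetSemiring_cylindersIn (IsSubgraph.refl E)).mem_supClosure_iff]
  constructor
  · rintro ⟨𝒟, hf, h𝒟, hd, rfl⟩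
    have : ↑hf.toFinset ⊆ cylindersIn E E := by
      rw [Set.Finite.coe_toFinset]
      exact h𝒟
    refine ⟨.ofErase hf.toFinset ?_ ?_, ?_⟩
    · rw [Finset.supIndep_iff_pairwiseDisjoint]
      simpa using hd
    · rw [Finset.sup_id_set_eq_sUnion]
      simp
    · refine (Finset.coe_subset.2 ?_).trans this
      exact Finset.erase_subset _ _
  · rintro ⟨P, hP⟩
    refine ⟨P.parts, P.parts.finite_toSet, hP, P.disjoint, ?_⟩
    rw [← Finset.sup_id_set_eq_sUnion, P.sup_parts]

theorem isSetRing_ringA : IsSetRing E.cover.ringA := ringA_cover_eq ▸ isSetRing_ringIn (.refl E)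

theorem ringIn_induction {P : Set (Arrow α β) → Prop} (empty : P ∅)
    (cyl : ∀ p ∈ F.paths, ∀ D ⊆ F.cover.out p, D.Finite → P (E.cover.cyl p D))
    (union : ∀ A ∈ ringIn F E, ∀ B ∈ ringIn F E, P A → P B → P (A ∪ B)) {B : Set (Arrow α β)}
    (hB : B ∈ ringIn F E) : P B := by
  have : supClosure (cylindersIn F E) ⊆ {B | B ∈ ringIn F E ∧ P B} := by
    refine supClosure_min ?_ ?_
    · intro B hB
      refine ⟨subset_supClosure hB, ?_⟩
      rcases hB with ⟨p, hp, D, hD, hf, rfl⟩ | rfl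
      · exact cyl p hp D hD hf
      · exact empty
    · exact fun A hA B hB => ⟨supClosed_supClosure hA.1 hB.1, union A hA.1 B hB.1 hA.2 hB.2⟩
  exact (this hB).2

theorem ringIn_subset_ringA (h : F.IsSubgraph E) : ringIn F E ⊆ E.cover.ringA := by
  rw [ringA_cover_eq]
  refine supClosure_mono ?_
  rintro B (⟨p, hp, D, hD, hf, rfl⟩ | rfl)
  · exact Or.inl ⟨p, h.paths_subset hp, D, hD.trans (cover_out_mono h p), hf, rfl⟩
  · exact Or.inr rfl

theorem inter_paths_mem_ringA (h : F.IsSubgraph E) {B : Set (Arrow α β)} (hB : B ∈ ringIn F E) :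
    B ∩ F.paths ∈ F.cover.ringA := by
  rw [ringA_cover_eq]
  refine ringIn_induction (P := fun B => B ∩ F.paths ∈ ringIn F F) ?_ ?_ ?_ hB
  · simpa using (isSetRing_ringIn (.refl F)).empty_mem
  · intro p hp D hD hf
    rw [cover_cyl_inter_paths h hp hD]
    exact subset_supClosure (cyl_mem_cylindersIn hp hD hf)
  · intro A _ B _ hA hB
    rw [Set.union_inter_distrib_right]
    exact (isSetRing_ringIn (.refl F)).union_mem hA hB

theorem exists_inter_paths_eq (h : F.IsSubgraph E) {B : Set (Arrow α β)} (hB : B ∈ F.cover.ringA) :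
    ∃ C ∈ ringIn F E, B = C ∩ F.paths := by
  rw [ringA_cover_eq] at hB
  refine ringIn_induction (P := fun B => ∃ C ∈ ringIn F E, B = C ∩ F.paths) ?_ ?_ ?_ hB
  · exact ⟨∅, (isSetRing_ringIn h).empty_mem, by simp⟩
  · intro p hp D hD hf
    exact ⟨_, subset_supClosure (cyl_mem_cylindersIn hp hD hf), (cover_cyl_inter_paths h hp hD).symm⟩
  · rintro A _ B _ ⟨A', hA', rfl⟩ ⟨B', hB', rfl⟩
    exact ⟨A' ∪ B', (isSetRing_ringIn h).union_mem hA' hB', (Set.union_inter_distrib_right _ _ _).symm⟩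

theorem eq_empty_of_inter_paths {B : Set (Arrow α β)} (hB : B ∈ ringIn F E)
    (h0 : B ∩ F.paths = ∅) : B = ∅ := by
  revert h0
  refine ringIn_induction (P := fun B => B ∩ F.paths = ∅ → B = ∅) ?_ ?_ ?_ hB
  · exact fun _ => rfl
  · intro p hp D _ _ h0
    have : p ∈ E.cover.cyl p D ∩ F.paths := ⟨self_mem_cyl p D, hp⟩
    simp [h0] at this
  · intro A _ B _ hA hB h0
    rw [Set.union_inter_distrib_right, Set.union_empty_iff] at h0
    rw [hA h0.1, hB h0.2, Set.union_empty]

/-- The map `C ↦ C ∩ F.paths` from `ringIn F E` to `𝓐(F̃)` reflects inclusions, as every nonempty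
member of `ringIn F E` contains a vertex of `F̃`. -/
theorem subset_of_inter_paths_subset (h : F.IsSubgraph E) {B C : Set (Arrow α β)}
    (hB : B ∈ ringIn F E) (hC : C ∈ ringIn F E) (hs : B ∩ F.paths ⊆ C) : B ⊆ C := by
  rw [← Set.sdiff_eq_empty]
  refine eq_empty_of_inter_paths ((isSetRing_ringIn h).sdiff_mem hB hC) ?_
  ext m
  simp only [Set.mem_inter_iff, Set.mem_sdiff, Set.mem_empty_iff_false, iff_false]
  rintro ⟨⟨h1, h2⟩, h3⟩
  exact h2 (hs ⟨h1, h3⟩)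

end DirGraph

/-! ### The spectrum and the boundary of the universal cover -/

namespace DirGraph

open FreeGroup MeasureTheory Topology

variable {α β : Type*} {E F : DirGraph α β}

namespace Spec

theorem inter_mem (x : Spec E.cover) {B C : Set (Arrow α β)} (hB : B ∈ x.sets) (hC : C ∈ x.sets) :
    B ∩ C ∈ x.sets := by
  obtain ⟨D, hD, h⟩ := x.directed B hB C hC
  exact x.superset D hD _ (isSetRing_ringA.inter_mem (x.subset_ringA hB) (x.subset_ringA hC)) h

theorem sdiff_mem (x : Spec E.cover) {B C : Set (Arrow α β)} (hB : B ∈ x.sets)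
    (hC : C ∈ E.cover.ringA) (hCx : C ∉ x.sets) : B \ C ∈ x.sets := by
  obtain ⟨D, hD, hd⟩ := exists_disjoint hC hCx
  refine x.superset _ (x.inter_mem hB hD) _ (isSetRing_ringA.sdiff_mem (x.subset_ringA hB) hC) ?_
  exact fun m hm => ⟨hm.1, fun h => Set.disjoint_left.1 hd h hm.2⟩

theorem mem_or_mem_of_union (x : Spec E.cover) {A B : Set (Arrow α β)} (hA : A ∈ E.cover.ringA)
    (hB : B ∈ E.cover.ringA) (h : A ∪ B ∈ x.sets) : A ∈ x.sets ∨ B ∈ x.sets := by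
  by_contra! hc
  refine x.empty_notMem ?_
  have := x.sdiff_mem (x.sdiff_mem h hA hc.1) hB hc.2
  rwa [sdiff_sdiff, Set.sdiff_eq_empty.2 (show A ∪ B ⊆ A ⊔ B from subset_rfl)] at this

theorem exists_cyl_mem (h : F.IsSubgraph E) (x : Spec E.cover) {B : Set (Arrow α β)}
    (hB : B ∈ ringIn F E) (hx : B ∈ x.sets) : ∃ p ∈ F.paths, ∃ D ⊆ F.cover.out p, D.Finite ∧
      E.cover.cyl p D ⊆ B ∧ E.cover.cyl p D ∈ x.sets := by
  revert hx
  refine ringIn_induction (P := fun B => B ∈ x.sets → ∃ p ∈ F.paths, ∃ D ⊆ F.cover.out p, D.Finite ∧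
      E.cover.cyl p D ⊆ B ∧ E.cover.cyl p D ∈ x.sets) ?_ ?_ ?_ hB
  · exact fun hx => absurd hx x.empty_notMem
  · exact fun p hp D hD hf hx => ⟨p, hp, D, hD, hf, subset_rfl, hx⟩
  · intro A hA B hB iA iB hx
    rcases x.mem_or_mem_of_union (ringIn_subset_ringA h hA) (ringIn_subset_ringA h hB) hx with hx | hx
    · obtain ⟨p, hp, D, hD, hf, hs, hx⟩ := iA hx
      exact ⟨p, hp, D, hD, hf, hs.trans Set.subset_union_left, hx⟩
    · obtain ⟨p, hp, D, hD, hf, hs, hx⟩ := iB hx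
      exact ⟨p, hp, D, hD, hf, hs.trans Set.subset_union_right, hx⟩

theorem isClosed_mem {B : Set (Arrow α β)} (hB : B ∈ E.cover.ringA) :
    IsClosed {x : Spec E.cover | B ∈ x.sets} := by
  refine ⟨isOpen_iff_forall_mem_open.2 fun x hx => ?_⟩
  obtain ⟨C, hC, hd⟩ := exists_disjoint hB hx
  exact ⟨_, fun z hz hz' => z.not_disjoint hz' hz hd, isOpen_mem (x.subset_ringA hC), hC⟩

/-- The support `{x | B ∈ x}` of a member `B` of the Boolean ring is compact: an ultrafilter on it
converges to the point that consists of the sets `C` whose support belongs to the ultrafilter. -/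
theorem isCompact_mem {B : Set (Arrow α β)} (hB : B ∈ E.cover.ringA) :
    IsCompact {x : Spec E.cover | B ∈ x.sets} := by
  refine isCompact_iff_ultrafilter_le_nhds.2 fun f hf => ?_
  have hBf : {x : Spec E.cover | B ∈ x.sets} ∈ f := Filter.le_principal_iff.1 hf
  let y : Spec E.cover :=
    { sets := {C | C ∈ E.cover.ringA ∧ {x : Spec E.cover | C ∈ x.sets} ∈ f}
      subset_ringA := fun C hC => hC.1
      nonempty := ⟨B, hB, hBf⟩
      empty_notMem := by
        rintro ⟨_, h⟩
        obtain ⟨x, hx⟩ := f.nonempty_of_mem h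
        exact x.empty_notMem hx
      directed := by
        rintro C ⟨hC, hC'⟩ D ⟨hD, hD'⟩
        refine ⟨C ∩ D, ⟨isSetRing_ringA.inter_mem hC hD, ?_⟩, subset_rfl⟩
        filter_upwards [hC', hD'] with x h1 h2 using x.inter_mem h1 h2
      superset := by
        rintro C ⟨hC, hC'⟩ D hD hCD
        refine ⟨hD, ?_⟩
        filter_upwards [hC'] with x hx using x.superset C hx D hD hCD
      maximal := by
        intro C hC h
        refine ⟨hC, ?_⟩
        by_contra hc
        obtain ⟨m, hm, hm'⟩ := h (B \ C) ⟨isSetRing_ringA.sdiff_mem hB hC, by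
          filter_upwards [hBf, Ultrafilter.compl_mem_iff_notMem.2 hc] with x h1 h2 using
            x.sdiff_mem h1 hC h2⟩
        exact hm'.2 hm }
  refine ⟨y, ⟨hB, hBf⟩, ?_⟩
  rw [TopologicalSpace.nhds_generateFrom]
  refine le_iInf₂ fun U hU => ?_
  obtain ⟨hyU, C, hC, rfl⟩ := hU
  exact Filter.le_principal_iff.2 hyU.2

/-- The fixed ultrafilter of a vertex `p` of the universal cover. -/
def principal (p : Arrow α β) (hp : p ∈ E.paths) : Spec E.cover where
  sets := {B | B ∈ E.cover.ringA ∧ p ∈ B}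
  subset_ringA := fun _ hB => hB.1
  nonempty := ⟨_, TG.ringA_of_reach hp, self_mem_reach p⟩
  empty_notMem := fun h => h.2
  directed := fun B hB C hC => ⟨B ∩ C, ⟨isSetRing_ringA.inter_mem hB.1 hC.1, hB.2, hC.2⟩, subset_rfl⟩
  superset := fun B hB C hC h => ⟨hC, h hB.2⟩
  maximal := by
    refine fun B hB h => ⟨hB, ?_⟩
    by_contra hpB
    obtain ⟨m, hm, hm'⟩ := h (E.cover.reach p \ B)
      ⟨isSetRing_ringA.sdiff_mem (TG.ringA_of_reach hp) hB, self_mem_reach p, hpB⟩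
    exact hm'.2 hm

theorem isPrincipalAt_principal (p : Arrow α β) (hp : p ∈ E.paths) :
    (principal p hp).IsPrincipalAt p := fun _ hB => ⟨fun h => h.2, fun h => ⟨hB, h⟩⟩

theorem isPrincipalAt_of_singleton_mem {x : Spec E.cover} {p : Arrow α β} (h : {p} ∈ x.sets) :
    x.IsPrincipalAt p := by
  refine fun B hB => ⟨fun hx => ?_, fun hp => x.superset _ h B hB (by simpa using hp)⟩
  by_contra hp
  exact x.not_disjoint hx h (by simpa using hp)

theorem IsPrincipalAt.eq {x : Spec E.cover} {p q : Arrow α β} (hp : p ∈ E.paths) (hq : q ∈ E.paths)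
    (h : x.IsPrincipalAt p) (h' : x.IsPrincipalAt q) : q = p := by
  refine cover_reach_antisymm hp ?_ ?_
  · rw [← h' _ (TG.ringA_of_reach hp), h _ (TG.ringA_of_reach hp)]
    exact self_mem_reach p
  · rw [← h _ (TG.ringA_of_reach hq), h' _ (TG.ringA_of_reach hq)]
    exact self_mem_reach q

end Spec

theorem cyl_mem_ringA {p : Arrow α β} (hp : p ∈ E.paths) {D : Set (Arrow α β × Arrow α β)}
    (hD : D ⊆ E.cover.out p) (hf : D.Finite) : E.cover.cyl p D ∈ E.cover.ringA :=
  ringA_cover_eq (E := E) ▸ mem_ringIn_of_mem_cylindersIn (cyl_mem_cylindersIn hp hD hf)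

theorem cover_cyl_out (p : Arrow α β) : E.cover.cyl p (E.cover.out p) = {p} := by
  simp [cyl]

theorem cover_out_eq_image (p : Arrow α β) (hp : p ∈ E.paths) : E.cover.out p =
    (fun e => (p, (⟨p.r, p.w * of e, E.t e⟩ : Arrow α β))) '' E.out p.s := by
  ext ⟨a, q⟩
  rw [mem_cover_out, cover_step_iff]
  constructor
  · rintro ⟨rfl, _, e, he, ho, h⟩
    exact ⟨e, ⟨he, ho⟩, Prod.ext rfl h.symm⟩
  · rintro ⟨e, ⟨he, ho⟩, h⟩
    exact ⟨(congrArg Prod.fst h).symm, hp, e, he, ho, (congrArg Prod.snd h).symm⟩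

theorem finite_cover_out {S : Set α} (hS : S ⊆ E.regular) {p : Arrow α β} (hp : p ∈ E.paths)
    (hpS : p.s ∈ S) : (E.cover.out p).Finite := by
  rw [cover_out_eq_image p hp]
  exact (hS hpS).2.2.image _

theorem singleton_mem_ringA {S : Set α} (hS : S ⊆ E.regular) {p : Arrow α β} (hp : p ∈ E.paths)
    (hpS : p.s ∈ S) : {p} ∈ E.cover.ringA := by
  rw [← cover_cyl_out]
  exact cyl_mem_ringA hp subset_rfl (finite_cover_out hS hp hpS)

theorem exists_singleton_mem {S : Set α} (hS : S ⊆ E.regular) {x : Spec E.cover}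
    (hx : x ∉ E.boundary S) : ∃ p ∈ E.paths, p.s ∈ S ∧ {p} ∈ x.sets := by
  obtain ⟨p, hp, hpS, h⟩ := not_not.1 hx
  exact ⟨p, hp, hpS, (h _ (singleton_mem_ringA hS hp hpS)).2 rfl⟩

theorem isClosed_boundary {S : Set α} (hS : S ⊆ E.regular) : IsClosed (E.boundary S) := by
  refine ⟨isOpen_iff_forall_mem_open.2 fun x hx => ?_⟩
  obtain ⟨p, hp, hpS, h⟩ := exists_singleton_mem hS hx
  refine ⟨_, fun y hy => ?_, Spec.isOpen_mem (singleton_mem_ringA hS hp hpS), h⟩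
  exact fun hy' => hy' ⟨p, hp, hpS, Spec.isPrincipalAt_of_singleton_mem hy⟩

theorem principal_mem_boundary {S : Set α} {p : Arrow α β} (hp : p ∈ E.paths) (hpS : p.s ∉ S) :
    Spec.principal p hp ∈ E.boundary S := by
  rintro ⟨q, hq, hqS, h⟩
  exact hpS (Spec.IsPrincipalAt.eq hp hq (Spec.isPrincipalAt_principal p hp) h ▸ hqS)

/-- The exponent sum of the label of an arrow. -/
def _root_.Arrow.degree (a : Arrow α β) : ℤ :=
  (FreeGroup.lift fun _ : β => Multiplicative.ofAdd (1 : ℤ)) a.w |>.toAdd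

theorem degree_of_step {p q : Arrow α β} (h : E.cover.Step p q) :
    Arrow.degree q = Arrow.degree p + 1 := by
  obtain ⟨_, e, _, _, rfl⟩ := cover_step_iff.1 h
  simp [Arrow.degree]

/-- Every set `V(q)` has a boundary point in its support.  Otherwise it consists of points that are
isolated, hence it is finite by compactness; but its vertices all emit edges, while there are no
directed cycles. -/
theorem exists_mem_boundary {S : Set α} (hS : S ⊆ E.regular) {q : Arrow α β} (hq : q ∈ E.paths) :
    ∃ x ∈ E.boundary S, E.cover.reach q ∈ x.sets := by
  by_cases hm : ∃ m ∈ E.cover.reach q, m.s ∉ S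
  · obtain ⟨m, hm, hmS⟩ := hm
    have hmp := cover_reach_mem hq hm
    exact ⟨_, principal_mem_boundary hmp hmS, TG.ringA_of_reach hq, hm⟩
  · push Not at hm
    by_contra! hc
    have hcov : {x : Spec E.cover | E.cover.reach q ∈ x.sets} ⊆
        ⋃ p : E.cover.reach q, {x : Spec E.cover | {(p : Arrow α β)} ∈ x.sets} := by
      intro x hx
      obtain ⟨p, hp, hpS, h⟩ := exists_singleton_mem hS (fun h => hc x h hx)
      have : p ∈ E.cover.reach q :=
        (Spec.isPrincipalAt_of_singleton_mem h _ (TG.ringA_of_reach hq)).1 hx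
      exact Set.mem_iUnion.2 ⟨⟨p, this⟩, h⟩
    obtain ⟨t, ht⟩ := (Spec.isCompact_mem (TG.ringA_of_reach hq)).elim_finite_subcover _
      (fun p => Spec.isOpen_mem (singleton_mem_ringA hS (cover_reach_mem hq p.2) (hm _ p.2))) hcov
    -- The singletons are disjoint, so the finite subcover contains every vertex of `V(q)`.
    have hall : ∀ m : E.cover.reach q, m ∈ t := by
      intro m
      have := @ht (Spec.principal m.1 (cover_reach_mem hq m.2)) ⟨TG.ringA_of_reach hq, m.2⟩
      simp only [Set.mem_iUnion] at this
      obtain ⟨p, hp, h⟩ := this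
      have h' : m.1 = p.1 := h.2
      rwa [Subtype.ext h']
    -- The degree grows by one along each edge, so a vertex of maximal degree cannot emit edges.
    obtain ⟨m, _, hmax⟩ := t.exists_max_image (fun m => Arrow.degree m.1)
      ⟨⟨q, self_mem_reach q⟩, hall _⟩
    obtain ⟨e, he, ho⟩ := (hS (hm _ m.2)).2.1
    have hs : E.cover.Step m.1 ⟨m.1.r, m.1.w * of e, E.t e⟩ :=
      cover_step_iff.2 ⟨cover_reach_mem hq m.2, e, he, ho, rfl⟩
    have := hmax ⟨_, cover_reach_trans m.2 (cover_step_reach hs)⟩ (hall _)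
    have h' := degree_of_step hs
    simp only at this
    omega

/-! ### Restriction of ultrafilters to a subgraph -/

/-- The restriction to the cover of the subgraph `F` of an ultrafilter that contains a member of the
ring `ringIn F E`. -/
def Spec.restrict (h : F.IsSubgraph E) (x : Spec E.cover) (hx : ∃ B ∈ ringIn F E, B ∈ x.sets) :
    Spec F.cover where
  sets := {B | ∃ C ∈ ringIn F E, C ∈ x.sets ∧ B = C ∩ F.paths}
  subset_ringA := by
    rintro _ ⟨C, hC, _, rfl⟩
    exact inter_paths_mem_ringA h hC
  nonempty := by
    obtain ⟨B, hB, hx⟩ := hx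
    exact ⟨_, B, hB, hx, rfl⟩
  empty_notMem := by
    rintro ⟨C, hC, hCx, h0⟩
    exact x.empty_notMem (eq_empty_of_inter_paths hC h0.symm ▸ hCx)
  directed := by
    rintro _ ⟨B, hB, hBx, rfl⟩ _ ⟨C, hC, hCx, rfl⟩
    exact ⟨_, ⟨B ∩ C, (isSetRing_ringIn h).inter_mem hB hC, x.inter_mem hBx hCx, rfl⟩,
      fun m hm => ⟨⟨hm.1.1, hm.2⟩, hm.1.2, hm.2⟩⟩
  superset := by
    rintro _ ⟨B, hB, hBx, rfl⟩ C hC hBC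
    obtain ⟨C, hC', rfl⟩ := exists_inter_paths_eq h hC
    exact ⟨C, hC', x.superset B hBx C (ringIn_subset_ringA h hC')
      (subset_of_inter_paths_subset h hB hC' fun m hm => (hBC hm).1), rfl⟩
  maximal := by
    intro B hB hm
    obtain ⟨C, hC, rfl⟩ := exists_inter_paths_eq h hB
    obtain ⟨A, hA, hAx⟩ := hx
    refine ⟨C, hC, ?_, rfl⟩
    by_contra hCx
    obtain ⟨m, h1, h2⟩ := hm _ ⟨A \ C, (isSetRing_ringIn h).sdiff_mem hA hC,
      x.sdiff_mem hAx (ringIn_subset_ringA h hC) hCx, rfl⟩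
    exact h2.1.2 h1.1

theorem Restricts.mem_iff (h : F.IsSubgraph E) {x : Spec E.cover} {y : Spec F.cover}
    (hxy : Restricts x y) {C : Set (Arrow α β)} (hC : C ∈ ringIn F E) :
    C ∩ F.paths ∈ y.sets ↔ C ∈ x.sets := by
  refine ringIn_induction (P := fun C => C ∩ F.paths ∈ y.sets ↔ C ∈ x.sets) ?_ ?_ ?_ hC
  · simp [x.empty_notMem, y.empty_notMem]
  · intro p hp D hD hf
    rw [cover_cyl_inter_paths h hp hD]
    exact hxy p hp D hD hf
  · intro A hA B hB iA iB
    have hA' := inter_paths_mem_ringA h hA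
    have hB' := inter_paths_mem_ringA h hB
    have hAE := ringIn_subset_ringA h hA
    have hBE := ringIn_subset_ringA h hB
    rw [Set.union_inter_distrib_right]
    constructor
    · intro hy
      rcases y.mem_or_mem_of_union hA' hB' hy with hy | hy
      · exact x.superset _ (iA.1 hy) _ (isSetRing_ringA.union_mem hAE hBE) Set.subset_union_left
      · exact x.superset _ (iB.1 hy) _ (isSetRing_ringA.union_mem hAE hBE) Set.subset_union_right
    · intro hx
      rcases x.mem_or_mem_of_union hAE hBE hx with hx | hx
      · exact y.superset _ (iA.2 hx) _ (isSetRing_ringA.union_mem hA' hB') Set.subset_union_left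
      · exact y.superset _ (iB.2 hx) _ (isSetRing_ringA.union_mem hA' hB') Set.subset_union_right

theorem restricts_restrict (h : F.IsSubgraph E) (x : Spec E.cover)
    (hx : ∃ B ∈ ringIn F E, B ∈ x.sets) : Restricts x (x.restrict h hx) := by
  intro p hp D hD hf
  have hc : E.cover.cyl p D ∈ ringIn F E :=
    mem_ringIn_of_mem_cylindersIn (cyl_mem_cylindersIn hp hD hf)
  rw [← cover_cyl_inter_paths h hp hD]
  constructor
  · rintro ⟨C, hC, hCx, he⟩
    refine x.superset C hCx _ (ringIn_subset_ringA h hc) (subset_of_inter_paths_subset h hC hc ?_)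
    rw [← he]
    exact Set.inter_subset_left
  · exact fun hx => ⟨_, hc, hx, rfl⟩

theorem Restricts.unique (h : F.IsSubgraph E) {x : Spec E.cover} {y z : Spec F.cover}
    (hy : Restricts x y) (hz : Restricts x z) : y = z := by
  refine Spec.ext_of_ringA fun B hB => ?_
  obtain ⟨C, hC, rfl⟩ := exists_inter_paths_eq h hB
  rw [hy.mem_iff h hC, hz.mem_iff h hC]

theorem Restricts.trans {G : DirGraph α β} (hFG : F.IsSubgraph G)
    {x : Spec E.cover} {y : Spec G.cover} {z : Spec F.cover} (hxy : Restricts x y)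
    (hyz : Restricts y z) : Restricts x z := fun p hp D hD hf =>
  (hyz p hp D hD hf).trans
    (hxy p (hFG.paths_subset hp) D (hD.trans (cover_out_mono hFG p)) hf)

theorem restricts_refl (x : Spec E.cover) : Restricts x x := fun _ _ _ _ _ => Iff.rfl

theorem Restricts.reach_mem_iff {x : Spec E.cover} {y : Spec F.cover}
    (hxy : Restricts x y) {p : Arrow α β} (hp : p ∈ F.paths) :
    F.cover.reach p ∈ y.sets ↔ E.cover.reach p ∈ x.sets := by
  rw [← cover_cyl_empty, ← cover_cyl_empty]
  exact hxy p hp ∅ (Set.empty_subset _) Set.finite_empty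

theorem Restricts.over (h : F.IsSubgraph E) {x : Spec E.cover} {y : Spec F.cover}
    (hxy : Restricts x y) {v : α} (hy : y.Over v) : x.Over v := by
  obtain ⟨B, hB, hv⟩ := hy
  obtain ⟨C, hC, rfl⟩ := exists_inter_paths_eq h (y.subset_ringA hB)
  obtain ⟨p, hp, D, hD, hf, hs, hm⟩ := x.exists_cyl_mem h hC ((hxy.mem_iff h hC).1 hB)
  exact ⟨_, hm, fun q hq => (cover_cyl_r hq).trans (hv p ⟨hs (self_mem_cyl p D), hp⟩)⟩

theorem transl_cyl {a p : Arrow α β} (ha : a ∈ E.paths) (hp : p ∈ E.paths) (hr : p.r = a.r)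
    {D : Set (Arrow α β × Arrow α β)} (hD : D ⊆ E.cover.out p) :
    E.transl a (E.cover.cyl p D) = E.cover.cyl (a.inv.comp p) (edgeComp a.inv '' D) := by
  have ha' := inv_mem ha
  have hr' : p.r = a.inv.s := hr
  have hD' : edgeComp a.inv '' D ⊆ E.cover.out (a.inv.comp p) := by
    rintro _ ⟨d, hd, rfl⟩
    exact edgeComp_mem_out ha' hr' (hD hd)
  have hDD : edgeComp a '' (edgeComp a.inv '' D) = D := by
    rw [Set.image_image]
    refine (Set.image_congr fun d hd => ?_).trans (Set.image_id _)
    have := edgeComp_inv hr' (hD hd)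
    rwa [Arrow.inv_inv] at this
  ext q
  constructor
  · rintro ⟨hq, hqr, hq'⟩
    have := cover_cyl_comp ha' hr' hD hq'
    rwa [Arrow.inv_comp_cancel _ _ hqr] at this
  · intro hq
    have hqr : q.r = a.s := cover_cyl_r hq
    refine ⟨cover_cyl_mem (comp_mem ha' hp hr'.symm) hq, hqr, ?_⟩
    have := cover_cyl_comp ha rfl hD' hq
    rwa [hDD, Arrow.comp_inv_cancel _ _ hr] at this

theorem transl_empty (a : Arrow α β) : E.transl a ∅ = ∅ := by ext q; simp [transl]

theorem transl_union (a : Arrow α β) (A B : Set (Arrow α β)) :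
    E.transl a (A ∪ B) = E.transl a A ∪ E.transl a B := by
  ext q
  simp only [transl, Set.mem_ofPred_eq, Set.mem_union]
  tauto

theorem transl_ringIn (h : F.IsSubgraph E) {a : Arrow α β} (ha : a ∈ F.paths) {C : Set (Arrow α β)}
    (hC : C ∈ ringIn F E) : E.transl a C ∈ ringIn F E := by
  refine ringIn_induction (P := fun C => E.transl a C ∈ ringIn F E) ?_ ?_ ?_ hC
  · rw [transl_empty]; exact (isSetRing_ringIn h).empty_mem
  · intro p hp D hD hf
    by_cases hr : p.r = a.r
    · rw [transl_cyl (h.paths_subset ha) (h.paths_subset hp) hr (hD.trans (cover_out_mono h p))]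
      refine mem_ringIn_of_mem_cylindersIn (cyl_mem_cylindersIn
        (comp_mem (inv_mem ha) hp hr.symm) ?_ (hf.image _))
      rintro _ ⟨d, hd, rfl⟩
      exact edgeComp_mem_out (inv_mem ha) hr (hD hd)
    · have : E.transl a (E.cover.cyl p D) = ∅ := by
        ext q
        simp only [Set.mem_empty_iff_false, iff_false]
        rintro ⟨_, _, hq'⟩
        exact hr (cover_cyl_r hq').symm
      rw [this]
      exact (isSetRing_ringIn h).empty_mem
  · intro A _ B _ hA hB
    rw [transl_union]
    exact (isSetRing_ringIn h).union_mem hA hB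

theorem transl_inter_paths (h : F.IsSubgraph E) {a : Arrow α β} (ha : a ∈ F.paths)
    (C : Set (Arrow α β)) : F.transl a (C ∩ F.paths) = E.transl a C ∩ F.paths := by
  ext q
  constructor
  · rintro ⟨h1, h2, h3, _⟩
    exact ⟨⟨h.paths_subset h1, h2, h3⟩, h1⟩
  · rintro ⟨⟨_, h2, h3⟩, h1⟩
    exact ⟨h1, h2, h3, comp_mem ha h1 h2.symm⟩

theorem Restricts.acts (h : F.IsSubgraph E) {a : Arrow α β} (ha : a ∈ F.paths)
    {x x' : Spec E.cover} {y y' : Spec F.cover} (hxy : Restricts x y) (hxy' : Restricts x' y')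
    (hx : Spec.Acts a x x') (hy : y.Over a.s) : Spec.Acts a y y' where
  mem := ha
  isOver := hy
  iff := fun B hB => by
    obtain ⟨C, hC, rfl⟩ := exists_inter_paths_eq h hB
    rw [hxy'.mem_iff h hC, transl_inter_paths h ha, hxy.mem_iff h (transl_ringIn h ha hC),
      hx.iff _ (ringIn_subset_ringA h hC)]

end DirGraph

/-! ### Restriction of the Toeplitz graph groupoid to a subgraph -/

namespace DirGraph

open FreeGroup MeasureTheory Topology

variable {α β : Type*} {E F G : DirGraph α β} {R S : Set α}

/-- The pair `(F, R)` is the restriction to a subgraph `F` of the pair `(E, S)`: `S` consists of regular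
vertices of `E`, and `R = S_F`. -/
structure IsRestriction (F : DirGraph α β) (R : Set α) (E : DirGraph α β) (S : Set α) : Prop where
  sub : F.IsSubgraph E
  regular : S ⊆ E.regular
  eq : R = F.restrictSet E S

theorem IsSubgraph.out_subset (h : F.IsSubgraph E) (v : α) : F.out v ⊆ E.out v :=
  fun e he => ⟨h.edges_subset he.1, (h.o_eq e he.1) ▸ he.2⟩

theorem out_eq_of_mem_restrictSet (h : F.IsSubgraph E) {v : α} (hv : v ∈ F.restrictSet E S) :
    F.out v = E.out v :=
  (h.out_subset v).antisymm fun e he => ⟨hv.2.2 he, (h.o_eq e (hv.2.2 he)).trans he.2⟩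

theorem restrictSet_subset_regular (h : F.IsSubgraph E) (hS : S ⊆ E.regular) :
    F.restrictSet E S ⊆ F.regular := by
  intro v hv
  refine ⟨hv.1, ?_⟩
  rw [out_eq_of_mem_restrictSet h hv]
  exact (hS hv.2.1).2

theorem restrictSet_restrictSet (hFG : F.IsSubgraph G) (hGE : G.IsSubgraph E) :
    F.restrictSet E S = F.restrictSet G (G.restrictSet E S) := by
  ext v
  constructor
  · rintro ⟨h1, h2, h3⟩
    exact ⟨h1, ⟨hFG.verts_subset h1, h2, h3.trans hFG.edges_subset⟩, (hGE.out_subset v).trans h3⟩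
  · rintro ⟨h1, h2, h3⟩
    refine ⟨h1, h2.2.1, ?_⟩
    rwa [← out_eq_of_mem_restrictSet hGE h2]

theorem isRestriction_restrictSet (h : F.IsSubgraph E) (hS : S ⊆ E.regular) :
    IsRestriction F (F.restrictSet E S) E S := ⟨h, hS, rfl⟩

theorem isRestriction_restrictSet_restrictSet (hFG : F.IsSubgraph G) (hGE : G.IsSubgraph E)
    (hS : S ⊆ E.regular) : IsRestriction F (F.restrictSet E S) G (G.restrictSet E S) :=
  ⟨hFG, restrictSet_subset_regular hGE hS, restrictSet_restrictSet hFG hGE⟩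

theorem IsRestriction.regular_left (hr : IsRestriction F R E S) : R ⊆ F.regular :=
  hr.eq ▸ restrictSet_subset_regular hr.sub hr.regular

theorem cover_out_eq_of_mem_restrictSet (h : F.IsSubgraph E) {p : Arrow α β} (hp : p ∈ F.paths)
    (hv : p.s ∈ F.restrictSet E S) : F.cover.out p = E.cover.out p := by
  rw [cover_out_eq_image p hp, cover_out_eq_image p (h.paths_subset hp),
    ← out_eq_of_mem_restrictSet h hv]
  exact Set.image_congr fun e he => by rw [h.t_eq e he.1]

theorem Restricts.mem_transversal (hr : IsRestriction F R E S) {x : Spec E.cover} {y : Spec F.cover}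
    (hxy : Restricts x y) (hx : x ∈ E.transversal S) {u : α} (hu : u ∈ F.verts) (hxu : x.Over u) :
    y ∈ F.transversal R := by
  refine ⟨?_, u, hu, (hxy.reach_mem_iff (unit_mem hu)).2 (TG.reach_mem x hx hxu)⟩
  rintro ⟨p, hp, hpR, h⟩
  have hpE := hr.sub.paths_subset hp
  have hpR' := hr.eq ▸ hpR
  refine hx.1 ⟨p, hpE, hpR'.2.1, Spec.isPrincipalAt_of_singleton_mem ?_⟩
  -- All edges at `t(p)` belong to `F` and there are finitely many, so `{p}` is `V(p; D)` in both covers,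
  -- with `D` the set of all edges at `p`.
  have hf := finite_cover_out hr.regular_left hp hpR
  have h1 := (h _ (singleton_mem_ringA hr.regular_left hp hpR)).2 rfl
  rw [← cover_cyl_out] at h1 ⊢
  rw [← cover_out_eq_of_mem_restrictSet hr.sub hp hpR']
  exact (hxy p hp _ subset_rfl hf).1 h1

theorem exists_restricts (hr : IsRestriction F R E S) {x : Spec E.cover} (hx : x ∈ E.transversal S)
    {u : α} (hu : u ∈ F.verts) (hxu : x.Over u) :
    ∃ y ∈ F.transversal R, Restricts x y ∧ y.Over u := by
  have h := restricts_restrict hr.sub x ⟨_, mem_ringIn_of_mem_cylindersIn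
    (reach_mem_cylindersIn (unit_mem hu)), TG.reach_mem x hx hxu⟩
  exact ⟨_, h.mem_transversal hr hx hu hxu, h, _,
    (h.reach_mem_iff (unit_mem hu)).2 (TG.reach_mem x hx hxu), fun q hq => cover_reach_r hq⟩

/-- If `V(p; D)`, computed in `F`, belongs to a boundary point of `F`, then the support of
`V(p; D)`, computed in `E`, contains a boundary point of `E`.  If `t(p)` belongs to `S`, this
uses an edge from `t(p)` outside of `D`: it is an edge of `F` if `t(p)` belongs to `S_F`, as
otherwise the given boundary point would be `p`, and it is an edge outside of `F` if not. -/
theorem exists_mem_boundary_of_cyl_mem (hr : IsRestriction F R E S) {y : Spec F.cover}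
    (hy : y ∈ F.boundary R) {p : Arrow α β} (hp : p ∈ F.paths) {D : Set (Arrow α β × Arrow α β)}
    (hD : D ⊆ F.cover.out p) (hf : D.Finite) (hpy : F.cover.cyl p D ∈ y.sets) :
    ∃ x ∈ E.boundary S, E.cover.cyl p D ∈ x.sets := by
  have hpE := hr.sub.paths_subset hp
  have hDE := hD.trans (cover_out_mono hr.sub p)
  have hc := cyl_mem_ringA hpE hDE hf
  by_cases hpS : p.s ∈ S
  · suffices ∃ d ∈ E.cover.out p, d ∉ D by
      obtain ⟨d, hd, hdD⟩ := this
      obtain ⟨x, hx, hxd⟩ := exists_mem_boundary hr.regular (mem_paths_of_mem_cover_out hd)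
      refine ⟨x, hx, x.superset _ hxd _ hc fun m hm => Or.inr ?_⟩
      simp only [Set.mem_iUnion]
      exact ⟨d, ⟨hd, hdD⟩, hm⟩
    by_cases hpR : p.s ∈ R
    · by_contra! hcon
      have : D = F.cover.out p := hD.antisymm ((cover_out_mono hr.sub p).trans hcon)
      rw [this, cover_cyl_out] at hpy
      exact hy ⟨p, hp, hpR, Spec.isPrincipalAt_of_singleton_mem hpy⟩
    · have : ¬ E.out p.s ⊆ F.edges := fun h => hpR (hr.eq ▸ ⟨s_mem hp, hpS, h⟩)
      obtain ⟨e, he, heF⟩ := Set.not_subset.1 this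
      refine ⟨(p, ⟨p.r, p.w * of e, E.t e⟩), ?_, fun hd => heF ?_⟩
      · exact mem_cover_out.2 ⟨rfl, cover_step_iff.2 ⟨hpE, e, he.1, he.2, rfl⟩⟩
      · obtain ⟨_, e', he', _, h⟩ := cover_step_iff.1 (step_of_mem_cover_out (hD hd))
        have := FreeGroup.of_injective (mul_left_cancel (congrArg Arrow.w h))
        exact this ▸ he'
  · exact ⟨_, principal_mem_boundary hpE hpS, hc, self_mem_cyl p D⟩

/-- Every point of the transversal of a subgraph is the restriction of a point of the
transversal of the graph, by compactness. -/
theorem exists_lift (hr : IsRestriction F R E S) {y : Spec F.cover} (hy : y ∈ F.transversal R) :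
    ∃ x ∈ E.transversal S, Restricts x y := by
  obtain ⟨hyb, u, hu, hyu⟩ := hy
  have huE := hr.sub.verts_subset hu
  have hV := mem_ringIn_of_mem_cylindersIn (reach_mem_cylindersIn (E := E) (unit_mem hu))
  have hVE := TG.ringA_of_reach (unit_mem huE)
  have hK : IsCompact ({x : Spec E.cover | E.cover.reach (Arrow.unit u) ∈ x.sets} ∩ E.boundary S) :=
    (Spec.isCompact_mem hVE).inter_right (isClosed_boundary hr.regular)
  -- The lifts of `y` are the common points of the supports of the sets `C` in `ringIn F E` whose trace
  -- belongs to `y`; finitely many of these contain a single `V(p; D)` whose trace belongs to `y`.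
  let ι := {C : Set (Arrow α β) // C ∈ ringIn F E ∧ C ∩ F.paths ∈ y.sets}
  have hring := isSetRing_ringIn hr.sub
  obtain ⟨x, ⟨hxu, hxb⟩, hx⟩ := hK.inter_iInter_nonempty (fun C : ι => {x | C.1 ∈ x.sets})
    (fun C => Spec.isClosed_mem (ringIn_subset_ringA hr.sub C.2.1)) fun t => by
      classical
      have : ∃ C : ι, C.1 ⊆ E.cover.reach (Arrow.unit u) ∧ ∀ B ∈ t, C.1 ⊆ B.1 := by
        induction t using Finset.induction_on with
        | empty =>
          refine ⟨⟨_, hV, ?_⟩, subset_rfl, by simp⟩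
          rwa [cover_reach_inter_paths hr.sub (unit_mem hu)]
        | insert A t _ ih =>
          obtain ⟨C, hC, hCt⟩ := ih
          refine ⟨⟨A.1 ∩ C.1, hring.inter_mem A.2.1 C.2.1, ?_⟩, Set.inter_subset_right.trans hC, ?_⟩
          · rw [Set.inter_inter_distrib_right]
            exact y.inter_mem A.2.2 C.2.2
          · intro B hB
            rcases Finset.mem_insert.1 hB with rfl | hB
            · exact Set.inter_subset_left
            · exact Set.inter_subset_right.trans (hCt B hB)
      obtain ⟨⟨C, hC, hCy⟩, hCu, hCt⟩ := this
      have hCF := inter_paths_mem_ringA hr.sub hC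
      rw [ringA_cover_eq] at hCF
      obtain ⟨p, hp, D, hD, hf, hs, hpy⟩ := y.exists_cyl_mem (.refl F) hCF hCy
      have hsE : E.cover.cyl p D ⊆ C := by
        refine subset_of_inter_paths_subset hr.sub
          (mem_ringIn_of_mem_cylindersIn (cyl_mem_cylindersIn hp hD hf)) hC ?_
        rw [cover_cyl_inter_paths hr.sub hp hD]
        exact hs.trans Set.inter_subset_left
      obtain ⟨x, hxb, hxp⟩ := exists_mem_boundary_of_cyl_mem hr hyb hp hD hf hpy
      refine ⟨x, ⟨x.superset _ hxp _ hVE (hsE.trans hCu), hxb⟩, ?_⟩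
      simp only [Set.mem_iInter]
      exact fun B hB => x.superset _ hxp _ (ringIn_subset_ringA hr.sub B.2.1) (hsE.trans (hCt B hB))
  refine ⟨x, ⟨hxb, u, huE, hxu⟩, ?_⟩
  have hres := restricts_restrict hr.sub x ⟨_, hV, hxu⟩
  have : x.restrict hr.sub ⟨_, hV, hxu⟩ = y := by
    have hle : ∀ B ∈ y.sets, B ∈ (x.restrict hr.sub ⟨_, hV, hxu⟩).sets := by
      intro B hB
      obtain ⟨C, hC, rfl⟩ := exists_inter_paths_eq hr.sub (y.subset_ringA hB)
      exact ⟨C, hC, Set.mem_iInter.1 hx ⟨C, hC, hB⟩, rfl⟩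
    refine Spec.ext_of_ringA fun B hB => ⟨fun hBx => ?_, hle B⟩
    by_contra hBy
    obtain ⟨C, hC, hd⟩ := Spec.exists_disjoint hB hBy
    exact Spec.not_disjoint _ hBx (hle C hC) hd
  exact this ▸ hres

namespace TG

theorem exists_restrict (hr : IsRestriction F R E S) (γ : TG E S) (hγ : γ.arrow ∈ F.paths) :
    ∃ η : TG F R, η.arrow = γ.arrow ∧ Restricts γ.src η.src ∧ Restricts γ.rng η.rng := by
  obtain ⟨y, hy, hxy, hyo⟩ := exists_restricts hr γ.src_mem (s_mem hγ) γ.acts.isOver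
  obtain ⟨z, hz, hxz, _⟩ := exists_restricts hr γ.rng_mem (r_mem hγ) γ.acts.over_r
  exact ⟨⟨γ.arrow, y, z, hy, hz, hxy.acts hr.sub hγ hxz γ.acts hyo⟩, rfl, hxy, hxz⟩

/-- The element `(a, x|_F)` of the groupoid of the subgraph `F`, for an element `(a, x)` of the groupoid
of `E` such that `a` is a path of `F`. -/
noncomputable def restrict (hr : IsRestriction F R E S) (γ : TG E S) (hγ : γ.arrow ∈ F.paths) :
    TG F R := (exists_restrict hr γ hγ).choose

variable (hr : IsRestriction F R E S)

theorem restrict_arrow (γ : TG E S) (hγ : γ.arrow ∈ F.paths) :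
    (restrict hr γ hγ).arrow = γ.arrow := (exists_restrict hr γ hγ).choose_spec.1

theorem restricts_src (γ : TG E S) (hγ : γ.arrow ∈ F.paths) :
    Restricts γ.src (restrict hr γ hγ).src := (exists_restrict hr γ hγ).choose_spec.2.1

theorem restricts_rng (γ : TG E S) (hγ : γ.arrow ∈ F.paths) :
    Restricts γ.rng (restrict hr γ hγ).rng := (exists_restrict hr γ hγ).choose_spec.2.2

theorem eq_restrict {γ : TG E S} (hγ : γ.arrow ∈ F.paths) {η : TG F R} (h : η.arrow = γ.arrow)
    (h' : Restricts γ.src η.src) : η = restrict hr γ hγ :=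
  eq_of (h.trans (restrict_arrow hr γ hγ).symm) (h'.unique hr.sub (restricts_src hr γ hγ))

theorem restrict_inv (γ : TG E S) (hγ : γ.arrow ∈ F.paths) :
    restrict hr γ.inv (inv_mem hγ) = (restrict hr γ hγ).inv :=
  (eq_restrict hr (γ := γ.inv) (η := (restrict hr γ hγ).inv) (inv_mem hγ)
    (congrArg Arrow.inv (restrict_arrow hr γ hγ))
    (restricts_rng hr γ hγ)).symm

theorem restrict_src_eq {γ δ : TG E S} (hγ : γ.arrow ∈ F.paths) (hδ : δ.arrow ∈ F.paths)
    (h : δ.src = γ.src) : (restrict hr δ hδ).src = (restrict hr γ hγ).src :=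
  (restricts_src hr δ hδ).unique hr.sub (h ▸ restricts_src hr γ hγ)

theorem div_arrow_mem {γ δ : TG E S} (hγ : γ.arrow ∈ F.paths) (hδ : δ.arrow ∈ F.paths)
    (h : δ.src = γ.src) : (γ.div δ h).arrow ∈ F.paths :=
  comp_mem hγ (inv_mem hδ) (arrow_s_eq (δ := δ.inv) h.symm)

theorem restrict_div {γ δ : TG E S} (hγ : γ.arrow ∈ F.paths) (hδ : δ.arrow ∈ F.paths)
    (h : δ.src = γ.src) : restrict hr (γ.div δ h) (div_arrow_mem hγ hδ h) =
      (restrict hr γ hγ).div (restrict hr δ hδ) (restrict_src_eq hr hγ hδ h) := by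
  refine (eq_restrict hr _ ?_ ?_).symm
  · simp only [div, comp, inv, restrict_arrow]
  · exact restricts_rng hr δ hδ

theorem exists_restrict_eq {x : Spec E.cover} (hx : x ∈ E.transversal S) (η : TG F R)
    (h : Restricts x η.src) : ∃ (γ : TG E S) (hγ : γ.arrow ∈ F.paths), γ.src = x ∧
      restrict hr γ hγ = η := by
  have hη := η.acts.mem
  obtain ⟨z, hz⟩ := Spec.exists_acts (hr.sub.paths_subset hη) (h.over hr.sub η.acts.isOver)
  have hrF := unit_mem (r_mem hη)
  have hV := mem_ringIn_of_mem_cylindersIn (reach_mem_cylindersIn (E := E) hrF)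
  have hV' := transl_ringIn hr.sub hη hV
  have h1 : E.cover.reach (Arrow.unit η.arrow.r) ∈ z.sets := by
    rw [hz.iff _ (ringIn_subset_ringA hr.sub hV), ← h.mem_iff hr.sub hV',
      ← transl_inter_paths hr.sub hη, cover_reach_inter_paths hr.sub hrF,
      ← η.acts.iff _ (ringA_of_reach hrF)]
    exact reach_mem _ η.rng_mem η.acts.over_r
  exact ⟨⟨η.arrow, x, z, hx, rng_mem_transversal hz hx h1, hz⟩, hη, rfl,
    (eq_restrict hr _ rfl h).symm⟩

theorem continuous_restrict : Continuous
    fun γ : {γ : TG E S // γ.arrow ∈ F.paths} => restrict hr γ.1 γ.2 := by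
  refine continuous_of ?_ (continuous_generateFrom_iff.2 ?_)
  · simp only [restrict_arrow]
    exact continuous_arrow.comp continuous_subtype_val
  · rintro _ ⟨B, hB, rfl⟩
    obtain ⟨C, hC, rfl⟩ := exists_inter_paths_eq hr.sub hB
    have : (fun γ : {γ : TG E S // γ.arrow ∈ F.paths} => (restrict hr γ.1 γ.2).src) ⁻¹'
        {x | C ∩ F.paths ∈ x.sets} = (fun γ => γ.1.src) ⁻¹' {x | C ∈ x.sets} := by
      ext γ
      exact (restricts_src hr γ.1 γ.2).mem_iff hr.sub hC
    rw [this]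
    exact (Spec.isOpen_mem (ringIn_subset_ringA hr.sub hC)).preimage
      (continuous_src.comp continuous_subtype_val)

/-- Sums over a fibre of the source map of `F` can be computed upstairs. -/
theorem tsum_restrict {M : Type*} [AddCommMonoid M] [TopologicalSpace M] {x : Spec E.cover}
    (hx : x ∈ E.transversal S) {y : Spec F.cover} (hxy : Restricts x y) {g : TG E S → M}
    {g' : TG F R → M} (h1 : ∀ δ, g δ ≠ 0 → δ.src = x ∧ δ.arrow ∈ F.paths)
    (h2 : ∀ η, g' η ≠ 0 → η.src = y)
    (h3 : ∀ δ, δ.src = x → ∀ hδ : δ.arrow ∈ F.paths, g δ = g' (restrict hr δ hδ)) :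
    ∑' δ, g δ = ∑' η, g' η := by
  let s : Set (TG E S) := {δ | δ.src = x ∧ δ.arrow ∈ F.paths}
  let t : Set (TG F R) := {η | η.src = y}
  rw [← tsum_subtype_eq_of_support_subset (s := s) (f := g) h1,
    ← tsum_subtype_eq_of_support_subset (s := t) (f := g') h2]
  have hsrc : ∀ δ : s, (restrict hr δ.1 δ.2.2).src = y := fun δ =>
    (restricts_src hr δ.1 δ.2.2).unique hr.sub (δ.2.1.symm ▸ hxy)
  let i : s → t := fun δ => ⟨restrict hr δ.1 δ.2.2, hsrc δ⟩
  have hi : Function.Bijective i := by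
    constructor
    · intro δ ε h
      refine Subtype.ext (eq_of ?_ (δ.2.1.trans ε.2.1.symm))
      have := congrArg arrow (congrArg Subtype.val h)
      rwa [restrict_arrow, restrict_arrow] at this
    · rintro ⟨η, hη⟩
      obtain ⟨γ, hγ, hs, rfl⟩ := exists_restrict_eq hr hx η (by rw [show η.src = y from hη]; exact hxy)
      exact ⟨⟨γ, hs, hγ⟩, rfl⟩
  rw [← (Equiv.ofBijective i hi).tsum_eq]
  exact tsum_congr fun δ => h3 δ.1 δ.2.1 δ.2.2

/-- The elements `(a, x)` of the groupoid with a given first component `a` form a compact set. -/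
theorem isCompact_arrow (hS : S ⊆ E.regular) (a : Arrow α β) :
    IsCompact {γ : TG E S | γ.arrow = a} := by
  by_cases ha : a ∈ E.paths
  · have hV := ringA_of_reach (unit_mem (s_mem ha))
    have hV' := ringA_of_reach (unit_mem (r_mem ha))
    have hi : IsInducing fun γ : TG E S => (γ.arrow, γ.src) := ⟨rfl⟩
    rw [hi.isCompact_iff]
    have : (fun γ : TG E S => (γ.arrow, γ.src)) '' {γ | γ.arrow = a} = {a} ×ˢ
        (({x | E.cover.reach (Arrow.unit a.s) ∈ x.sets} ∩ E.boundary S) ∩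
          {x | E.transl a (E.cover.reach (Arrow.unit a.r)) ∈ x.sets}) := by
      ext ⟨b, x⟩
      constructor
      · rintro ⟨γ, rfl, h⟩
        obtain ⟨rfl, rfl⟩ := Prod.mk.inj h
        exact ⟨rfl, ⟨reach_mem _ γ.src_mem γ.acts.isOver, γ.src_mem.1⟩,
          (γ.acts.iff _ hV').1 (reach_mem _ γ.rng_mem γ.acts.over_r)⟩
      · rintro ⟨rfl, ⟨h1, h2⟩, h3⟩
        obtain ⟨z, hz⟩ := Spec.exists_acts ha (x := x) ⟨_, h1, fun q hq => cover_reach_r hq⟩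
        have hx : x ∈ E.transversal S := ⟨h2, _, s_mem ha, h1⟩
        exact ⟨⟨b, x, z, hx, rng_mem_transversal hz hx ((hz.iff _ hV').2 h3), hz⟩, rfl, rfl⟩
    rw [this]
    exact isCompact_singleton.prod (((Spec.isCompact_mem hV).inter_right
      (isClosed_boundary hS)).inter_right (Spec.isClosed_mem (transl_ringA ha hV')))
  · have : {γ : TG E S | γ.arrow = a} = ∅ := by
      ext γ
      simp only [Set.mem_ofPred_eq, Set.mem_empty_iff_false, iff_false]
      rintro rfl
      exact ha γ.acts.mem
    rw [this]
    exact isCompact_empty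

theorem isCompact_arrow_mem (hS : S ⊆ E.regular) {T : Set (Arrow α β)} (hT : T.Finite) :
    IsCompact {γ : TG E S | γ.arrow ∈ T} := by
  have : {γ : TG E S | γ.arrow ∈ T} = ⋃ a ∈ T, {γ : TG E S | γ.arrow = a} := by ext; simp
  rw [this]
  exact hT.isCompact_biUnion fun a _ => isCompact_arrow hS a

end TG

end DirGraph

/-! ### The `I`-norm -/

namespace DirGraph

open Topology
open scoped ENNReal NNReal

variable {α β : Type*} {E F G : DirGraph α β} {R S : Set α}

namespace Conv

/-- The sum of `|f(γ)|` over the elements `γ` of the groupoid with source `x`. -/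
noncomputable def srcSum (f : Conv E S) (x : Spec E.cover) : ℝ≥0∞ :=
  ∑' γ : {γ : TG E S // γ.src = x}, ‖f γ‖ₑ

/-- The supremum of the sums of `|f|` over the fibres of the source map, one half of the `I`-norm; the
other half is the same supremum for `star f`. -/
noncomputable def srcNorm (f : Conv E S) : ℝ≥0∞ := ⨆ x, srcSum f x

theorem srcSum_le_srcNorm (f : Conv E S) (x : Spec E.cover) : srcSum f x ≤ srcNorm f :=
  le_iSup (srcSum f) x

theorem srcSum_eq_tsum_indicator (f : Conv E S) (x : Spec E.cover) :
    srcSum f x = ∑' γ, Set.indicator {γ : TG E S | γ.src = x} (fun γ => ‖f γ‖ₑ) γ :=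
  tsum_subtype {γ : TG E S | γ.src = x} fun γ => ‖f γ‖ₑ

theorem srcSum_le_of_bound {f : Conv E S} {T : Finset (Arrow α β)}
    (hT : ∀ γ, f γ ≠ 0 → γ.arrow ∈ T) {C : ℝ≥0∞} (hC : ∀ γ, ‖f γ‖ₑ ≤ C) (x : Spec E.cover) :
    srcSum f x ≤ T.card * C := by
  have hinj : Function.Injective fun γ : {γ : TG E S // γ.src = x} => γ.1.arrow :=
    fun γ δ h => Subtype.ext (TG.eq_of h (γ.2.trans δ.2.symm))
  calc srcSum f x ≤ ∑' γ : {γ : TG E S // γ.src = x},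
        Set.indicator (T : Set (Arrow α β)) (fun _ => C) γ.1.arrow := by
        refine ENNReal.tsum_le_tsum fun γ => ?_
        by_cases h : γ.1.arrow ∈ T
        · rw [Set.indicator_of_mem (by simpa using h)]
          exact hC γ
        · have : f γ = 0 := by
            by_contra h0
            exact h (hT _ h0)
          simp [this]
    _ ≤ ∑' a, Set.indicator (T : Set (Arrow α β)) (fun _ => C) a :=
        ENNReal.tsum_comp_le_tsum_of_injective hinj _
    _ = T.card * C := by
        rw [← tsum_subtype, Finset.tsum_subtype' T fun _ => C]
        simp

theorem exists_finset_arrows (f : Conv E S) : ∃ T : Finset (Arrow α β), ∀ γ, f γ ≠ 0 → γ.arrow ∈ T :=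
  ⟨f.finite_arrows.toFinset, fun γ hγ => by
    simpa using ⟨γ, subset_tsupport _ hγ, rfl⟩⟩

theorem exists_bound (f : Conv E S) : ∃ C : ℝ≥0, ∀ γ, ‖f γ‖ₑ ≤ C := by
  obtain ⟨C, hC⟩ := f.hasCompactSupport.exists_bound_of_continuous f.continuous
  refine ⟨C.toNNReal, fun γ => ?_⟩
  rw [enorm_le_coe]
  exact NNReal.coe_le_coe.1 (by simpa using Or.inl (hC γ))

theorem srcNorm_ne_top (f : Conv E S) : srcNorm f ≠ ⊤ := by
  obtain ⟨T, hT⟩ := f.exists_finset_arrows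
  obtain ⟨C, hC⟩ := f.exists_bound
  refine ne_top_of_le_ne_top (ENNReal.mul_ne_top (ENNReal.natCast_ne_top T.card)
    (ENNReal.coe_ne_top (r := C))) (iSup_le fun x => srcSum_le_of_bound hT hC x)

theorem srcSum_ne_top (f : Conv E S) (x : Spec E.cover) : srcSum f x ≠ ⊤ :=
  ne_top_of_le_ne_top f.srcNorm_ne_top (f.srcSum_le_srcNorm x)

theorem finsum_src_eq (f : Conv E S) (x : Spec E.cover) :
    ∑ᶠ (γ : TG E S) (_ : γ.src = x), ‖f γ‖ = (srcSum f x).toReal := by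
  have h1 : ∑ᶠ (γ : TG E S) (_ : γ.src = x), ‖f γ‖ =
      ∑ᶠ γ, Set.indicator {γ : TG E S | γ.src = x} (fun γ => ‖f γ‖) γ :=
    finsum_mem_def {γ : TG E S | γ.src = x} fun γ => ‖f γ‖
  rw [h1, srcSum, ENNReal.tsum_toReal_eq fun _ => enorm_ne_top, ← tsum_eq_finsum (L := .unconditional _)]
  · rw [← tsum_subtype]
    exact tsum_congr fun γ => (toReal_enorm _).symm
  · refine (f.finite_fiber x).subset fun γ hγ => ?_
    by_cases h : γ.src = x
    · exact ⟨h, fun h0 => hγ (by simp [h0, Set.indicator])⟩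
    · exact absurd (Set.indicator_of_notMem (by simpa using h) _) hγ

theorem finsum_rng_eq (f : Conv E S) (x : Spec E.cover) :
    ∑ᶠ (γ : TG E S) (_ : γ.rng = x), ‖f γ‖ = ∑ᶠ (γ : TG E S) (_ : γ.src = x), ‖(star f) γ‖ := by
  refine finsum_mem_eq_of_bijOn (s := {γ : TG E S | γ.rng = x}) (t := {γ : TG E S | γ.src = x})
    TG.inv ⟨fun γ hγ => hγ, fun γ _ δ _ h => ?_, fun γ hγ => ⟨γ.inv, hγ, TG.inv_inv γ⟩⟩ fun γ _ => ?_
  · rw [← TG.inv_inv γ, h, TG.inv_inv]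
  · rw [star_apply, TG.inv_inv, norm_star]

theorem iNorm_eq (f : Conv E S) : iNorm f = max (srcNorm f).toReal (srcNorm (star f)).toReal := by
  rw [iNorm, srcNorm, srcNorm, ENNReal.toReal_iSup f.srcSum_ne_top,
    ENNReal.toReal_iSup (star f).srcSum_ne_top]
  simp only [finsum_rng_eq, finsum_src_eq]

theorem iNorm_nonneg (f : Conv E S) : 0 ≤ iNorm f := by
  rw [iNorm_eq]
  exact le_max_of_le_left ENNReal.toReal_nonneg

theorem iNorm_star (f : Conv E S) : iNorm (star f) = iNorm f := by
  rw [iNorm_eq, iNorm_eq, star_star, max_comm]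

theorem srcNorm_add_le (f g : Conv E S) : srcNorm (f + g) ≤ srcNorm f + srcNorm g := by
  refine iSup_le fun x => ?_
  refine le_trans ?_ (add_le_add (f.srcSum_le_srcNorm x) (g.srcSum_le_srcNorm x))
  rw [srcSum, srcSum, srcSum, ← ENNReal.tsum_add]
  exact ENNReal.tsum_le_tsum fun γ => enorm_add_le _ _

theorem srcNorm_smul (c : ℂ) (f : Conv E S) : srcNorm (c • f) = ‖c‖ₑ * srcNorm f := by
  rw [srcNorm, srcNorm, ENNReal.mul_iSup]
  refine iSup_congr fun x => ?_
  rw [srcSum, srcSum, ← ENNReal.tsum_mul_left]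
  exact tsum_congr fun γ => enorm_mul _ _

theorem conv_apply_eq_tsum (f g : Conv E S) (γ : TG E S) :
    (f * g) γ = ∑' δ : {δ : TG E S // δ.src = γ.src}, f (γ.div δ.1 δ.2) * g δ.1 := by
  rw [mul_apply, ← tsum_eq_finsum (L := .unconditional _) (finite_term f g γ),
    ← tsum_subtype_eq_of_support_subset (s := {δ : TG E S | δ.src = γ.src})]
  · exact tsum_congr fun δ => term_of_eq δ.2
  · intro δ hδ
    by_contra h
    exact hδ (term_of_ne h)

theorem enorm_conv_apply_le (f g : Conv E S) (γ : TG E S) : ‖(f * g) γ‖ₑ ≤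
    ∑' δ : {δ : TG E S // δ.src = γ.src}, ‖f (γ.div δ.1 δ.2)‖ₑ * ‖g δ.1‖ₑ := by
  rw [conv_apply_eq_tsum]
  have hf : (Function.support fun δ : {δ : TG E S // δ.src = γ.src} =>
      f (γ.div δ.1 δ.2) * g δ.1).Finite := by
    refine ((g.finite_fiber γ.src).preimage Subtype.val_injective.injOn).subset fun δ hδ => ?_
    exact ⟨δ.2, fun h0 => hδ (by simp [h0])⟩
  rw [tsum_eq_sum (s := hf.toFinset) fun δ hδ => by
    simpa [or_iff_not_imp_left] using hδ]
  refine (enorm_sum_le _ _).trans ?_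
  simp only [enorm_mul]
  exact ENNReal.sum_le_tsum _

theorem srcSum_mul_le (f g : Conv E S) (x : Spec E.cover) :
    srcSum (f * g) x ≤ srcNorm f * srcSum g x := by
  let X := {γ : TG E S // γ.src = x}
  have hX : ∀ γ δ : X, δ.1.src = γ.1.src := fun γ δ => δ.2.trans γ.2.symm
  calc srcSum (f * g) x ≤ ∑' γ : X, ∑' δ : X, ‖f (γ.1.div δ.1 (hX γ δ))‖ₑ * ‖g δ.1‖ₑ := by
        refine ENNReal.tsum_le_tsum ?_
        rintro ⟨γ, rfl⟩
        exact enorm_conv_apply_le f g γ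
    _ = ∑' δ : X, (∑' γ : X, ‖f (γ.1.div δ.1 (hX γ δ))‖ₑ) * ‖g δ.1‖ₑ := by
        rw [ENNReal.tsum_comm]
        simp only [ENNReal.tsum_mul_right]
    _ ≤ ∑' δ : X, srcNorm f * ‖g δ.1‖ₑ := by
        refine ENNReal.tsum_le_tsum fun δ => mul_le_mul_left ?_ _
        refine le_trans ?_ (f.srcSum_le_srcNorm δ.1.rng)
        let i : X → {γ : TG E S // γ.src = δ.1.rng} := fun γ => ⟨γ.1.div δ.1 (hX γ δ), rfl⟩
        have hi : Function.Injective i := by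
          intro γ ε h
          have h' : γ.1.div δ.1 (hX γ δ) = ε.1.div δ.1 (hX ε δ) := congrArg Subtype.val h
          have h2 : (γ.1.div δ.1 (hX γ δ)).comp δ.1 rfl = (ε.1.div δ.1 (hX ε δ)).comp δ.1 rfl := by
            simp only [h']
          rw [TG.div_comp, TG.div_comp] at h2
          exact Subtype.ext h2
        exact ENNReal.tsum_comp_le_tsum_of_injective hi fun γ => ‖f γ.1‖ₑ
    _ = srcNorm f * srcSum g x := ENNReal.tsum_mul_left

theorem srcNorm_mul_le (f g : Conv E S) : srcNorm (f * g) ≤ srcNorm f * srcNorm g :=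
  iSup_le fun x => (srcSum_mul_le f g x).trans (mul_le_mul_right (g.srcSum_le_srcNorm x) _)

theorem iNorm_mul_le (f g : Conv E S) : iNorm (f * g) ≤ iNorm f * iNorm g := by
  have key : ∀ f g : Conv E S,
      (srcNorm (f * g)).toReal ≤ (srcNorm f).toReal * (srcNorm g).toReal := fun f g => by
    rw [← ENNReal.toReal_mul]
    exact ENNReal.toReal_mono (ENNReal.mul_ne_top f.srcNorm_ne_top g.srcNorm_ne_top)
      (srcNorm_mul_le f g)
  rw [iNorm_eq f, iNorm_eq g, iNorm_eq (f * g), star_mul]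
  refine max_le ((key f g).trans ?_) ((key _ _).trans ?_)
  · exact mul_le_mul (le_max_left _ _) (le_max_left _ _) ENNReal.toReal_nonneg
      (le_max_of_le_left ENNReal.toReal_nonneg)
  · rw [mul_comm]
    exact mul_le_mul (le_max_right _ _) (le_max_right _ _) ENNReal.toReal_nonneg
      (le_max_of_le_left ENNReal.toReal_nonneg)

theorem iNorm_add_le (f g : Conv E S) : iNorm (f + g) ≤ iNorm f + iNorm g := by
  have key : ∀ f g : Conv E S,
      (srcNorm (f + g)).toReal ≤ (srcNorm f).toReal + (srcNorm g).toReal := fun f g => by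
    rw [← ENNReal.toReal_add f.srcNorm_ne_top g.srcNorm_ne_top]
    exact ENNReal.toReal_mono (ENNReal.add_ne_top.2 ⟨f.srcNorm_ne_top, g.srcNorm_ne_top⟩)
      (srcNorm_add_le f g)
  rw [iNorm_eq f, iNorm_eq g, iNorm_eq (f + g), star_add]
  exact max_le ((key f g).trans (add_le_add (le_max_left _ _) (le_max_left _ _)))
    ((key _ _).trans (add_le_add (le_max_right _ _) (le_max_right _ _)))

theorem iNorm_smul (c : ℂ) (f : Conv E S) : iNorm (c • f) = ‖c‖ * iNorm f := by
  rw [iNorm_eq, iNorm_eq, star_smul, srcNorm_smul, srcNorm_smul, ENNReal.toReal_mul,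
    ENNReal.toReal_mul, mul_max_of_nonneg _ _ (norm_nonneg c)]
  simp

/-- The `I`-norm of a function that vanishes off finitely many sets `{(a, x) | a = a₀}` is controlled by
its supremum norm. -/
theorem iNorm_le_of_bound {f : Conv E S} {T : Finset (Arrow α β)}
    (hT : ∀ γ, f γ ≠ 0 → γ.arrow ∈ T) {C : ℝ} (hC0 : 0 ≤ C) (hC : ∀ γ, ‖f γ‖ ≤ C) :
    iNorm f ≤ T.card * C := by
  classical
  have key : ∀ (f : Conv E S) (T' : Finset (Arrow α β)) (_ : T'.card ≤ T.card)
      (_ : ∀ γ, f γ ≠ 0 → γ.arrow ∈ T') (_ : ∀ γ, ‖f γ‖ ≤ C), (srcNorm f).toReal ≤ T.card * C := by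
    intro f T' hc hT' hC
    refine ENNReal.toReal_le_of_le_ofReal (by positivity) (iSup_le fun x => ?_)
    refine (srcSum_le_of_bound hT' (C := ENNReal.ofReal C) (fun γ => ?_) x).trans ?_
    · rw [← ofReal_norm]
      exact ENNReal.ofReal_le_ofReal (hC γ)
    · rw [ENNReal.ofReal_mul (by positivity), ENNReal.ofReal_natCast]
      gcongr
  rw [iNorm_eq]
  refine max_le (key f T le_rfl hT hC)
    (key (star f) (T.image Arrow.inv) Finset.card_image_le (fun γ hγ => ?_) fun γ => ?_)
  · rw [star_apply, star_ne_zero] at hγ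
    exact Finset.mem_image.2 ⟨_, hT _ hγ, Arrow.inv_inv _⟩
  · rw [star_apply, norm_star]
    exact hC _

/-- A continuous function on the groupoid that vanishes off finitely many of the compact sets
`{(a, x) | a = a₀}` has compact support. -/
def ofContinuous (hS : S ⊆ E.regular) (f : TG E S → ℂ) (hf : Continuous f) (T : Set (Arrow α β))
    (hT : T.Finite) (h : ∀ γ, f γ ≠ 0 → γ.arrow ∈ T) : Conv E S :=
  (⟨⟨f, hf⟩, HasCompactSupport.intro (TG.isCompact_arrow_mem hS hT) fun γ hγ => by
    by_contra h0
    exact hγ (h γ h0)⟩ : C_c(TG E S, ℂ))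

/-! ### The pull-back of functions along the restriction to a subgraph -/

variable (hr : IsRestriction F R E S)

/-- The function `(a, x) ↦ f(a, x|_F)`, extended by zero. -/
noncomputable def pullFun (f : TG F R → ℂ) (γ : TG E S) : ℂ :=
  open Classical in if hγ : γ.arrow ∈ F.paths then f (TG.restrict hr γ hγ) else 0

theorem pullFun_of_mem (f : TG F R → ℂ) {γ : TG E S} (hγ : γ.arrow ∈ F.paths) :
    pullFun hr f γ = f (TG.restrict hr γ hγ) := dif_pos hγ

theorem pullFun_of_notMem (f : TG F R → ℂ) {γ : TG E S} (hγ : γ.arrow ∉ F.paths) :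
    pullFun hr f γ = 0 := dif_neg hγ

theorem continuous_pullFun {f : TG F R → ℂ} (hf : Continuous f) : Continuous (pullFun hr f) := by
  have hU : IsClopen {γ : TG E S | γ.arrow ∈ F.paths} :=
    (isClopen_discrete F.paths).preimage TG.continuous_arrow
  refine continuous_iff_continuousAt.2 fun γ => ?_
  by_cases hγ : γ.arrow ∈ F.paths
  · refine ContinuousOn.continuousAt (s := {γ : TG E S | γ.arrow ∈ F.paths}) ?_
      (hU.isOpen.mem_nhds hγ)
    rw [continuousOn_iff_continuous_domRestrict]
    have : Set.domRestrict {γ : TG E S | γ.arrow ∈ F.paths} (pullFun hr f) =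
        fun γ : {γ : TG E S // γ.arrow ∈ F.paths} => f (TG.restrict hr γ.1 γ.2) := by
      funext γ
      exact pullFun_of_mem hr f γ.2
    rw [this]
    exact hf.comp (TG.continuous_restrict hr)
  · refine continuousAt_const (y := (0 : ℂ)) |>.congr ?_
    filter_upwards [hU.compl.isOpen.mem_nhds hγ] with δ hδ
    exact (pullFun_of_notMem hr f hδ).symm

theorem ne_zero_of_pullFun_ne_zero {f : TG F R → ℂ} {γ : TG E S} (h : pullFun hr f γ ≠ 0) :
    ∃ hγ : γ.arrow ∈ F.paths, f (TG.restrict hr γ hγ) ≠ 0 := by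
  by_cases hγ : γ.arrow ∈ F.paths
  · exact ⟨hγ, by rwa [pullFun_of_mem hr f hγ] at h⟩
  · exact absurd (pullFun_of_notMem hr f hγ) h

theorem arrow_mem_of_pullFun_ne_zero {f : TG F R → ℂ} {T : Set (Arrow α β)}
    (hT : ∀ η, f η ≠ 0 → η.arrow ∈ T) (γ : TG E S) (h : pullFun hr f γ ≠ 0) : γ.arrow ∈ T := by
  obtain ⟨hγ, h⟩ := ne_zero_of_pullFun_ne_zero hr h
  exact TG.restrict_arrow hr γ hγ ▸ hT _ h

/-- The pull-back of a compactly supported function. -/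
noncomputable def pullConv (f : Conv F R) : Conv E S :=
  ofContinuous hr.regular (pullFun hr f) (continuous_pullFun hr f.continuous) _ f.finite_arrows
    (arrow_mem_of_pullFun_ne_zero hr fun η h => ⟨η, subset_tsupport _ h, rfl⟩)

theorem pullConv_apply (f : Conv F R) (γ : TG E S) : pullConv hr f γ = pullFun hr f γ := rfl

theorem pullConv_mul (f g : Conv F R) : pullConv hr (f * g) = pullConv hr f * pullConv hr g := by
  ext γ
  rw [mul_apply, pullConv_apply, ← tsum_eq_finsum (L := .unconditional _) (finite_term _ _ _)]
  have hsupp : ∀ δ, term (pullConv hr f) (pullConv hr g) γ δ ≠ 0 →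
      δ.src = γ.src ∧ δ.arrow ∈ F.paths ∧ γ.arrow ∈ F.paths := by
    intro δ hδ
    have hs : δ.src = γ.src := by
      by_contra h
      exact hδ (term_of_ne h)
    rw [term_of_eq hs] at hδ
    obtain ⟨h1, _⟩ := ne_zero_of_pullFun_ne_zero hr (left_ne_zero_of_mul hδ)
    obtain ⟨h2, _⟩ := ne_zero_of_pullFun_ne_zero hr (right_ne_zero_of_mul hδ)
    refine ⟨hs, h2, ?_⟩
    rw [← TG.div_comp γ δ hs]
    exact comp_mem h1 h2 (TG.arrow_s_eq rfl)
  by_cases hγ : γ.arrow ∈ F.paths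
  · rw [pullFun_of_mem hr _ hγ, mul_apply, ← tsum_eq_finsum (L := .unconditional _) (finite_term _ _ _)]
    refine (TG.tsum_restrict hr γ.src_mem (TG.restricts_src hr γ hγ)
      (fun δ hδ => ⟨(hsupp δ hδ).1, (hsupp δ hδ).2.1⟩) (fun η hη => ?_) fun δ hs hδ => ?_).symm
    · by_contra h
      exact hη (term_of_ne h)
    · rw [term_of_eq hs, term_of_eq (TG.restrict_src_eq hr hγ hδ hs), pullConv_apply, pullConv_apply,
        pullFun_of_mem hr _ hδ, pullFun_of_mem hr _ (TG.div_arrow_mem hγ hδ hs), TG.restrict_div]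
  · rw [pullFun_of_notMem hr _ hγ]
    refine Eq.symm ?_
    convert tsum_zero with δ
    by_contra h
    exact hγ (hsupp δ h).2.2

theorem pullConv_star (f : Conv F R) : pullConv hr (star f) = star (pullConv hr f) := by
  ext γ
  rw [star_apply, pullConv_apply, pullConv_apply]
  by_cases hγ : γ.arrow ∈ F.paths
  · rw [pullFun_of_mem hr _ hγ, pullFun_of_mem hr _ (γ := γ.inv) (inv_mem hγ), TG.restrict_inv,
      star_apply]
  · have : γ.inv.arrow ∉ F.paths := fun h => hγ (Arrow.inv_inv γ.arrow ▸ inv_mem h)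
    rw [pullFun_of_notMem hr _ hγ, pullFun_of_notMem hr _ this, star_zero]

/-- The *-homomorphism of convolution algebras induced by the inclusion of a subgraph. -/
noncomputable def pull : Conv F R →⋆ₙₐ[ℂ] Conv E S where
  toFun := pullConv hr
  map_smul' c f := by
    ext γ
    by_cases hγ : γ.arrow ∈ F.paths <;> simp [pullConv_apply, pullFun, hγ]
  map_zero' := by
    ext γ
    by_cases hγ : γ.arrow ∈ F.paths <;> simp [pullConv_apply, pullFun, hγ]
  map_add' f g := by
    ext γ
    by_cases hγ : γ.arrow ∈ F.paths <;> simp [pullConv_apply, pullFun, hγ]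
  map_mul' := pullConv_mul hr
  map_star' := pullConv_star hr

theorem pull_apply (f : Conv F R) (γ : TG E S) : pull hr f γ = pullFun hr f γ := rfl

theorem isPullback_pull (f : Conv F R) : IsPullback f (pull hr f) := by
  intro γ
  constructor
  · intro η h h'
    have hγ : γ.arrow ∈ F.paths := h ▸ η.acts.mem
    rw [pull_apply, pullFun_of_mem hr _ hγ, TG.eq_restrict hr hγ h h']
  · intro h
    by_contra h0
    obtain ⟨hγ, _⟩ := ne_zero_of_pullFun_ne_zero hr h0
    exact h _ (TG.restrict_arrow hr γ hγ) (TG.restricts_src hr γ hγ)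

theorem srcSum_pull (f : Conv F R) {x : Spec E.cover} (hx : x ∈ E.transversal S) {y : Spec F.cover}
    (hxy : Restricts x y) : srcSum (pull hr f) x = srcSum f y := by
  rw [srcSum_eq_tsum_indicator, srcSum_eq_tsum_indicator]
  refine TG.tsum_restrict hr hx hxy (fun δ hδ => ?_) (fun η hη =>
    Set.mem_of_indicator_ne_zero (s := {η : TG F R | η.src = y}) hη)
    fun δ hs hδ => ?_
  · have hs := Set.mem_of_indicator_ne_zero (s := {γ : TG E S | γ.src = x}) hδ
    rw [Set.indicator_of_mem hs, enorm_ne_zero] at hδ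
    exact ⟨hs, (ne_zero_of_pullFun_ne_zero hr hδ).1⟩
  · have hs' : (TG.restrict hr δ hδ).src = y :=
      (TG.restricts_src hr δ hδ).unique hr.sub (hs.symm ▸ hxy)
    rw [Set.indicator_of_mem (by exact hs), Set.indicator_of_mem (by exact hs'), pull_apply,
      pullFun_of_mem hr _ hδ]

/-- The pull-back preserves the sums over fibres, and it misses no fibre because every point of the
transversal of `F` is a restriction. -/
theorem srcNorm_pull (f : Conv F R) : srcNorm (pull hr f) = srcNorm f := by
  apply le_antisymm
  · refine iSup_le fun x => ?_
    by_cases hx : ∃ γ : TG E S, γ.src = x ∧ pull hr f γ ≠ 0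
    · obtain ⟨γ, rfl, h⟩ := hx
      obtain ⟨hγ, _⟩ := ne_zero_of_pullFun_ne_zero hr h
      rw [srcSum_pull hr f γ.src_mem (TG.restricts_src hr γ hγ)]
      exact f.srcSum_le_srcNorm _
    · push Not at hx
      have : srcSum (pull hr f) x = 0 := by
        rw [srcSum, ENNReal.tsum_eq_zero]
        exact fun γ => by simp [hx γ.1 γ.2]
      rw [this]
      exact zero_le
  · refine iSup_le fun y => ?_
    by_cases hy : y ∈ F.transversal R
    · obtain ⟨x, hx, hxy⟩ := exists_lift hr hy
      rw [← srcSum_pull hr f hx hxy]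
      exact srcSum_le_srcNorm _ _
    · have : srcSum f y = 0 := by
        rw [srcSum, ENNReal.tsum_eq_zero]
        exact fun γ => absurd (γ.2 ▸ γ.1.src_mem) hy
      rw [this]
      exact zero_le

theorem iNorm_pull (f : Conv F R) : iNorm (pull hr f) = iNorm f := by
  rw [iNorm_eq, iNorm_eq, ← map_star, srcNorm_pull, srcNorm_pull]

theorem pullFun_pullFun {Q : Set α} (hFG : IsRestriction F R G Q) (hGE : IsRestriction G Q E S)
    (hFE : IsRestriction F R E S) (f : TG F R → ℂ) :
    pullFun hGE (pullFun hFG f) = pullFun hFE f := by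
  funext γ
  by_cases hγ : γ.arrow ∈ F.paths
  · have hγ' := hFG.sub.paths_subset hγ
    have hγ'' : (TG.restrict hGE γ hγ').arrow ∈ F.paths := (TG.restrict_arrow hGE γ hγ').symm ▸ hγ
    rw [pullFun_of_mem hFE _ hγ, pullFun_of_mem hGE _ hγ', pullFun_of_mem hFG _ hγ'']
    congr 1
    refine TG.eq_restrict hFE hγ ?_ ?_
    · rw [TG.restrict_arrow, TG.restrict_arrow]
    · exact (TG.restricts_src hGE γ hγ').trans hFG.sub (TG.restricts_src hFG _ hγ'')
  · rw [pullFun_of_notMem hFE _ hγ]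
    by_contra h
    obtain ⟨hγ', h⟩ := ne_zero_of_pullFun_ne_zero hGE h
    obtain ⟨hγ'', _⟩ := ne_zero_of_pullFun_ne_zero hFG h
    exact hγ (TG.restrict_arrow hGE γ hγ' ▸ hγ'')

theorem pull_pull {Q : Set α} (hFG : IsRestriction F R G Q) (hGE : IsRestriction G Q E S)
    (hFE : IsRestriction F R E S) (f : Conv F R) : pull hGE (pull hFG f) = pull hFE f :=
  ext fun γ => congrFun (pullFun_pullFun hFG hGE hFE f) γ

theorem pull_self (hF : IsRestriction F R F R) (f : Conv F R) : pull hF f = f := by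
  ext γ
  rw [pull_apply, pullFun_of_mem hF _ γ.acts.mem,
    ← TG.eq_restrict hF γ.acts.mem rfl (restricts_refl _)]

end Conv

end DirGraph

/-! ### Approximation by functions that come from a member of the directed family -/

namespace DirGraph

open Topology

variable {α β : Type*} {E : DirGraph α β} {S : Set α} {W : Set (DirGraph α β)}

/-- `W` is a nonempty family of subgraphs of `E` that is directed by inclusion and exhausts `E`. -/
structure Exhausts (W : Set (DirGraph α β)) (E : DirGraph α β) : Prop where
  nonempty : W.Nonempty
  sub : ∀ F ∈ W, F.IsSubgraph E
  directed : DirectedOn DirGraph.IsSubgraph W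
  verts : ⋃ F ∈ W, F.verts = E.verts
  edges : ⋃ F ∈ W, F.edges = E.edges

namespace Exhausts

theorem exists_walk (hW : Exhausts W E) {L : List (β × Bool)} {v : α} :
    ∀ {u : α}, E.Walk u L v → ∃ F ∈ W, F.Walk u L v := by
  have hedge : ∀ e ∈ E.edges, ∃ F ∈ W, e ∈ F.edges := by
    intro e he
    rw [← hW.edges] at he
    simpa using he
  induction L with
  | nil =>
    rintro u ⟨rfl, hu⟩
    rw [← hW.verts] at hu
    obtain ⟨F, hF, hu⟩ : ∃ F ∈ W, u ∈ F.verts := by simpa using hu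
    exact ⟨F, hF, rfl, hu⟩
  | cons x L ih =>
    obtain ⟨e, b⟩ := x
    cases b
    all_goals
      rintro u ⟨he, hu, hw⟩
      obtain ⟨F, hF, heF⟩ := hedge e he
      obtain ⟨F', hF', hw'⟩ := ih hw
      obtain ⟨G, hG, h, h'⟩ := hW.directed F hF F' hF'
      have heG := h.edges_subset heF
      have ho := (hW.sub G hG).o_eq e heG
      have ht := (hW.sub G hG).t_eq e heG
      refine ⟨G, hG, heG, ?_, ?_⟩
    · rw [ht, hu]
    · rw [ho]; exact hw'.mono h'
    · rw [ho, hu]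
    · rw [ht]; exact hw'.mono h'

theorem exists_subset_paths (hW : Exhausts W E) {A : Set (Arrow α β)} (hA : A.Finite)
    (h : A ⊆ E.paths) : ∃ F ∈ W, A ⊆ F.paths := by
  induction A, hA using Set.Finite.induction_on with
  | empty =>
    obtain ⟨F, hF⟩ := hW.nonempty
    exact ⟨F, hF, Set.empty_subset _⟩
  | @insert a A _ _ ih =>
    obtain ⟨F, hF, hAF⟩ := ih fun b hb => h (Or.inr hb)
    obtain ⟨L, hL, hL', hw⟩ := h (Or.inl rfl : a ∈ insert a A)
    obtain ⟨F', hF', hw'⟩ := hW.exists_walk hw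
    obtain ⟨G, hG, h1, h2⟩ := hW.directed F hF F' hF'
    exact ⟨G, hG, Set.insert_subset ⟨L, hL, hL', hw'.mono h2⟩ (hAF.trans h1.paths_subset)⟩

end Exhausts

theorem continuous_indicator_const {X : Type*} [TopologicalSpace X] {s : Set X} (hs : IsClopen s)
    {f : X → ℂ} (hf : Continuous f) : Continuous (s.indicator f) :=
  hf.indicator fun a ha => by simp [hs.frontier_eq] at ha

namespace Conv

/-- The continuous functions on the compact set `{(a, x) | a ∈ T}` that depend on the restriction of `x`
to some member of `W` only. -/
noncomputable def pulledBack (hW : Exhausts W E) (hS : S ⊆ E.regular) (T : Finset (Arrow α β))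
    (hT : ↑T ⊆ E.paths) :
    StarSubalgebra ℂ C({γ : TG E S // γ.arrow ∈ (T : Set (Arrow α β))}, ℂ) :=
  let P (F : DirGraph α β) (hF : F ∈ W) (f : TG F (F.restrictSet E S) → ℂ) (γ : TG E S) : ℂ :=
    pullFun (isRestriction_restrictSet (hW.sub F hF) hS) f γ
  have lift : ∀ (F : DirGraph α β) (hF : F ∈ W) (G : DirGraph α β) (hG : G ∈ W) (_ : F.IsSubgraph G)
      (f : TG F (F.restrictSet E S) → ℂ) (_ : Continuous f),
      ∃ f' : TG G (G.restrictSet E S) → ℂ, Continuous f' ∧ P G hG f' = P F hF f :=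
    fun F hF G hG h f hf =>
      have hr := isRestriction_restrictSet_restrictSet h (hW.sub G hG) hS
      ⟨pullFun hr f, continuous_pullFun hr hf, pullFun_pullFun hr _ _ f⟩
  have two : ∀ (F : DirGraph α β) (hF : F ∈ W) (f : TG F (F.restrictSet E S) → ℂ) (_ : Continuous f)
      (F' : DirGraph α β) (hF' : F' ∈ W) (f' : TG F' (F'.restrictSet E S) → ℂ) (_ : Continuous f')
      (_ : ↑T ⊆ F.paths), ∃ (G : DirGraph α β) (hG : G ∈ W) (g g' : TG G (G.restrictSet E S) → ℂ),
        Continuous g ∧ Continuous g' ∧ ↑T ⊆ G.paths ∧ P G hG g = P F hF f ∧ P G hG g' = P F' hF' f' := by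
    intro F hF f hf F' hF' f' hf' hTF
    obtain ⟨G, hG, h, h'⟩ := hW.directed F hF F' hF'
    obtain ⟨g, hg, hgf⟩ := lift F hF G hG h f hf
    obtain ⟨g', hg', hgf'⟩ := lift F' hF' G hG h' f' hf'
    exact ⟨G, hG, g, g', hg, hg', hTF.trans h.paths_subset, hgf, hgf'⟩
  { carrier := {k | ∃ (F : DirGraph α β) (hF : F ∈ W) (f : TG F (F.restrictSet E S) → ℂ),
      Continuous f ∧ ↑T ⊆ F.paths ∧ ∀ γ, k γ = P F hF f γ.1}
    mul_mem' := by
      rintro k k' ⟨F, hF, f, hf, hTF, hk⟩ ⟨F', hF', f', hf', _, hk'⟩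
      obtain ⟨G, hG, g, g', hg, hg', hTG, hgf, hgf'⟩ := two F hF f hf F' hF' f' hf' hTF
      refine ⟨G, hG, fun η => g η * g' η, hg.mul hg', hTG, fun γ => ?_⟩
      rw [ContinuousMap.mul_apply, hk, hk', ← hgf, ← hgf']
      simp only [P, pullFun_of_mem _ _ (hTG γ.2)]
    add_mem' := by
      rintro k k' ⟨F, hF, f, hf, hTF, hk⟩ ⟨F', hF', f', hf', _, hk'⟩
      obtain ⟨G, hG, g, g', hg, hg', hTG, hgf, hgf'⟩ := two F hF f hf F' hF' f' hf' hTF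
      refine ⟨G, hG, fun η => g η + g' η, hg.add hg', hTG, fun γ => ?_⟩
      rw [ContinuousMap.add_apply, hk, hk', ← hgf, ← hgf']
      simp only [P, pullFun_of_mem _ _ (hTG γ.2)]
    algebraMap_mem' := by
      intro c
      obtain ⟨F, hF, hTF⟩ := hW.exists_subset_paths T.finite_toSet hT
      refine ⟨F, hF, fun _ => c, continuous_const, hTF, fun γ => ?_⟩
      simp only [P, pullFun_of_mem _ _ (hTF γ.2)]
      simp [Algebra.algebraMap_eq_smul_one]
    star_mem' := by
      rintro k ⟨F, hF, f, hf, hTF, hk⟩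
      refine ⟨F, hF, fun η => star (f η), hf.star, hTF, fun γ => ?_⟩
      rw [ContinuousMap.star_apply, hk]
      simp only [P, pullFun_of_mem _ _ (hTF γ.2)] }

theorem mem_pulledBack (hW : Exhausts W E) (hS : S ⊆ E.regular) {T : Finset (Arrow α β)}
    (hT : ↑T ⊆ E.paths) {k : C({γ : TG E S // γ.arrow ∈ (T : Set (Arrow α β))}, ℂ)} :
    k ∈ pulledBack hW hS T hT ↔ ∃ (F : DirGraph α β) (hF : F ∈ W)
      (f : TG F (F.restrictSet E S) → ℂ), Continuous f ∧ ↑T ⊆ F.paths ∧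
        ∀ γ, k γ = pullFun (isRestriction_restrictSet (hW.sub F hF) hS) f γ.1 := Iff.rfl

theorem exists_cyl_separating {x y : Spec E.cover} (h : x ≠ y) : ∃ p ∈ E.paths,
    ∃ D ⊆ E.cover.out p, D.Finite ∧ ¬ (E.cover.cyl p D ∈ x.sets ↔ E.cover.cyl p D ∈ y.sets) := by
  by_contra! hc
  exact h (Restricts.unique (.refl E) (restricts_refl x) fun p hp D hD hf => (hc p hp D hD hf).symm)

theorem separatesPoints_pulledBack (hW : Exhausts W E) (hS : S ⊆ E.regular) {T : Finset (Arrow α β)}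
    (hT : ↑T ⊆ E.paths) : (pulledBack hW hS T hT).SeparatesPoints := by
  classical
  rintro ⟨γ, hγ⟩ ⟨δ, hδ⟩ hne
  suffices ∃ (F : DirGraph α β) (hF : F ∈ W) (s : Set (TG F (F.restrictSet E S))), IsClopen s ∧
      ∃ hTF : ↑T ⊆ F.paths, ¬ (TG.restrict (isRestriction_restrictSet (hW.sub F hF) hS) γ (hTF hγ) ∈ s ↔
        TG.restrict (isRestriction_restrictSet (hW.sub F hF) hS) δ (hTF hδ) ∈ s) by
    obtain ⟨F, hF, s, hs, hTF, hsep⟩ := this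
    have hc := continuous_indicator_const hs (f := fun _ => 1) continuous_const
    have hr := isRestriction_restrictSet (hW.sub F hF) hS
    refine ⟨_, ⟨⟨fun γ => pullFun hr (s.indicator fun _ => 1) γ.1,
      (continuous_pullFun hr hc).comp continuous_subtype_val⟩, ⟨F, hF, _, hc, hTF, fun γ => rfl⟩, rfl⟩,
      ?_⟩
    simp only [ContinuousMap.coe_mk, pullFun_of_mem hr _ (hTF hγ), pullFun_of_mem hr _ (hTF hδ)]
    intro h
    by_cases h1 : TG.restrict hr γ (hTF hγ) ∈ s <;> by_cases h2 : TG.restrict hr δ (hTF hδ) ∈ s <;>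
      simp_all
  by_cases ha : γ.arrow = δ.arrow
  · have hs : γ.src ≠ δ.src := fun h => hne (Subtype.ext (TG.eq_of ha h))
    obtain ⟨p, hp, D, hD, hf, hsep⟩ := exists_cyl_separating hs
    obtain ⟨F, hF, hA⟩ := hW.exists_subset_paths
      (A := T ∪ insert p (Prod.snd '' D)) (T.finite_toSet.union ((hf.image _).insert _)) (by
        refine Set.union_subset hT (Set.insert_subset hp ?_)
        rintro _ ⟨d, hd, rfl⟩
        exact mem_paths_of_mem_cover_out (hD hd))
    have hTF : ↑T ⊆ F.paths := Set.subset_union_left.trans hA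
    have hpF : p ∈ F.paths := hA (Or.inr (Or.inl rfl))
    have hDF : D ⊆ F.cover.out p := fun d hd => mem_cover_out.2 ⟨(mem_cover_out.1 (hD hd)).1,
      cover_step_of_mem (hW.sub F hF) (step_of_mem_cover_out (hD hd)) hpF
        (hA (Or.inr (Or.inr ⟨d, hd, rfl⟩)))⟩
    have hring := cyl_mem_ringA hpF hDF hf
    refine ⟨F, hF, TG.src ⁻¹' {x | F.cover.cyl p D ∈ x.sets}, IsClopen.preimage
      ⟨Spec.isClosed_mem hring, Spec.isOpen_mem hring⟩ TG.continuous_src, hTF, ?_⟩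
    simp only [Set.mem_preimage, Set.mem_ofPred_eq]
    rwa [TG.restricts_src _ γ (hTF hγ) p hpF D hDF hf, TG.restricts_src _ δ (hTF hδ) p hpF D hDF hf]
  · obtain ⟨F, hF, hTF⟩ := hW.exists_subset_paths T.finite_toSet hT
    refine ⟨F, hF, {η | η.arrow = γ.arrow}, ⟨TG.isClosed_arrow _, TG.isOpen_arrow _⟩, hTF, ?_⟩
    simp only [Set.mem_ofPred_eq, TG.restrict_arrow]
    tauto

/-- The functions that come from a member of `W` are dense for the `I`-norm. -/
theorem exists_iNorm_sub_pull_lt (hW : Exhausts W E) (hS : S ⊆ E.regular) (g : Conv E S) {ε : ℝ}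
    (hε : 0 < ε) : ∃ (F : DirGraph α β) (hF : F ∈ W) (f : Conv F (F.restrictSet E S)),
      iNorm (g - pull (isRestriction_restrictSet (hW.sub F hF) hS) f) < ε := by
  classical
  obtain ⟨T₀, hT₀⟩ := g.exists_finset_arrows
  let T := T₀.filter (· ∈ E.paths)
  have hT : ↑T ⊆ E.paths := fun a ha => (Finset.mem_filter.1 ha).2
  have hgT : ∀ γ, g γ ≠ 0 → γ.arrow ∈ (T : Set (Arrow α β)) := fun γ hγ =>
    Finset.mem_filter.2 ⟨hT₀ γ hγ, γ.acts.mem⟩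
  set U := {γ : TG E S // γ.arrow ∈ (T : Set (Arrow α β))}
  have : CompactSpace U := isCompact_iff_compactSpace.1 (TG.isCompact_arrow_mem hS T.finite_toSet)
  let g' : C(U, ℂ) := ⟨fun γ => g γ.1, g.continuous.comp continuous_subtype_val⟩
  have hg' : g' ∈ (pulledBack hW hS T hT).topologicalClosure := by
    rw [ContinuousMap.starSubalgebra_topologicalClosure_eq_top_of_separatesPoints _
      (separatesPoints_pulledBack hW hS hT)]
    trivial
  have hδ : 0 < ε / (T.card + 1) := by positivity
  obtain ⟨k, hk, hgk⟩ := Metric.mem_closure_iff.1 hg' _ hδ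
  obtain ⟨F, hF, f, hf, hTF, hkf⟩ := (mem_pulledBack hW hS hT).1 hk
  have hr := isRestriction_restrictSet (hW.sub F hF) hS
  have hclopen : IsClopen {η : TG F (F.restrictSet E S) | η.arrow ∈ (T : Set (Arrow α β))} :=
    (isClopen_discrete _).preimage TG.continuous_arrow
  let f' : Conv F (F.restrictSet E S) := ofContinuous hr.regular_left
    (Set.indicator {η | η.arrow ∈ (T : Set (Arrow α β))} f) (continuous_indicator_const hclopen hf)
    T T.finite_toSet fun η h => Set.mem_of_indicator_ne_zero
      (s := {η : TG F (F.restrictSet E S) | η.arrow ∈ (T : Set (Arrow α β))}) h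
  have hf' : ∀ η, f' η ≠ 0 → η.arrow ∈ (T : Set (Arrow α β)) := fun η hη =>
    Set.mem_of_indicator_ne_zero
      (s := {η : TG F (F.restrictSet E S) | η.arrow ∈ (T : Set (Arrow α β))}) hη
  refine ⟨F, hF, f', ?_⟩
  have hval : ∀ γ, (g - pull hr f') γ = g γ - pull hr f' γ := fun γ => rfl
  have hbound : iNorm (g - pull hr f') ≤ T.card * (ε / (T.card + 1)) := by
    refine iNorm_le_of_bound (fun γ hγ => ?_) hδ.le fun γ => ?_
    · by_contra h
      refine hγ ?_
      have h1 : g γ = 0 := by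
        by_contra h0
        exact h (hgT γ h0)
      have h2 : pull hr f' γ = 0 := by
        by_contra h0
        exact h (arrow_mem_of_pullFun_ne_zero hr hf' γ h0)
      rw [hval, h1, h2, sub_zero]
    · by_cases h : γ.arrow ∈ (T : Set (Arrow α β))
      · have h1 : pull hr f' γ = k ⟨γ, h⟩ := by
          rw [hkf, pull_apply, pullFun_of_mem hr _ (hTF h), pullFun_of_mem hr _ (hTF h)]
          exact Set.indicator_of_mem (by simpa only [Set.mem_ofPred_eq, TG.restrict_arrow] using h) f
        rw [hval, h1, ← dist_eq_norm]
        exact (ContinuousMap.dist_apply_le_dist (f := g') (g := k) (⟨γ, h⟩ : U)).trans hgk.le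
      · have h1 : g γ = 0 := by
          by_contra h0
          exact h (hgT γ h0)
        have h2 : pull hr f' γ = 0 := by
          by_contra h0
          exact h (arrow_mem_of_pullFun_ne_zero hr (T := T)
            hf' γ h0)
        rw [hval, h1, h2, sub_zero, norm_zero]
        exact hδ.le
  refine hbound.trans_lt ?_
  rw [← mul_div_assoc, div_lt_iff₀ (by positivity)]
  nlinarith

end Conv

end DirGraph

/-! ### Extension of homomorphisms to the enveloping C*-algebra -/

namespace Enveloping

open UniformSpace

variable {A : Type*} [NonUnitalRing A] [StarRing A] [Module ℂ A] [IsScalarTower ℂ A A]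
  [SMulCommClass ℂ A A] [StarModule ℂ A] {N : A → ℝ} {B : Type*} [NonUnitalCStarAlgebra B]

theorem continuous_hom {C : Type*} [NonUnitalCStarAlgebra C] (ψ : C →⋆ₙₐ[ℂ] B) : Continuous ψ :=
  AddMonoidHomClass.continuous_of_bound ψ 1 fun a => by
    simpa using NonUnitalStarAlgHom.norm_apply_le ψ a

theorem norm_le_maxNorm (π : A →⋆ₙₐ[ℂ] B) (hπ : ∀ a, ‖π a‖ ≤ N a) (a : A) : ‖π a‖ ≤ maxNorm N a := by
  let p : Seminorm ℂ A := Seminorm.of (fun a => ‖π a‖)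
    (fun a b => by simpa only [map_add] using norm_add_le (π a) (π b))
    (fun c a => by rw [map_smul, norm_smul])
  have hp : IsCStarSeminorm N p :=
    { mul_le := fun a b => by
        change ‖π (a * b)‖ ≤ ‖π a‖ * ‖π b‖
        rw [map_mul]
        exact norm_mul_le _ _
      star_mul_self := fun a => by
        change ‖π (star a * a)‖ = ‖π a‖ ^ 2
        rw [map_mul, map_star, CStarRing.norm_star_mul_self, sq]
      le := hπ }
  exact le_maxNorm hp a

theorem norm_of_le (hN : ∀ a, 0 ≤ N a) (a : A) : ‖of N a‖ ≤ N a := by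
  rw [norm_of]
  exact maxNorm_le (hN a) fun p hp => hp.le a

/-- Homomorphisms on the enveloping C*-algebra are determined by their values on a dense set. -/
theorem hom_ext_of_dense {ι : Type*} {f : ι → Enveloping N} (hf : DenseRange f)
    {ψ ψ' : Enveloping N →⋆ₙₐ[ℂ] B} (h : ∀ i, ψ (f i) = ψ' (f i)) : ψ = ψ' :=
  DFunLike.coe_injective (hf.equalizer (continuous_hom ψ) (continuous_hom ψ') (funext h))

theorem hom_ext {ψ ψ' : Enveloping N →⋆ₙₐ[ℂ] B} (h : ∀ a, ψ (of N a) = ψ' (of N a)) : ψ = ψ' :=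
  hom_ext_of_dense (denseRange_of N) h

theorem exists_extension (π : A →⋆ₙₐ[ℂ] B) (hπ : ∀ a, ‖π a‖ ≤ N a) :
    ∃ ψ : Enveloping N →⋆ₙₐ[ℂ] B, ∀ a, ψ (of N a) = π a := by
  let π₀ : PreEnveloping N →+ B :=
    { toFun := fun a => π (show A from a), map_zero' := map_zero π, map_add' := map_add π }
  have hc : UniformContinuous π₀ :=
    AddMonoidHomClass.uniformContinuous_of_bound π₀ 1 fun a => by
      rw [one_mul, PreEnveloping.norm_def]
      exact norm_le_maxNorm π hπ a
  have hcont : Continuous (Completion.extension π₀) := Completion.continuous_extension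
  have hcoe : ∀ a : PreEnveloping N, Completion.extension π₀ a = π (show A from a) :=
    fun a => Completion.extension_coe hc a
  refine ⟨{ toFun := Completion.extension π₀, map_smul' := ?_, map_zero' := ?_, map_add' := ?_,
            map_mul' := ?_, map_star' := ?_ }, hcoe⟩
  · intro c a
    refine Completion.induction_on a (isClosed_eq (hcont.comp (continuous_smul' c))
      (hcont.const_smul c)) fun a => ?_
    change Completion.extension π₀ (c • (a : Enveloping N)) = c • Completion.extension π₀ a
    rw [← coe_smul', hcoe, hcoe]
    exact map_smul π c _
  · change Completion.extension π₀ (0 : Enveloping N) = 0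
    rw [← Completion.coe_zero, hcoe]
    exact map_zero π
  · intro a b
    refine Completion.induction_on₂ a b (isClosed_eq (by fun_prop) (by fun_prop)) fun a b => ?_
    change Completion.extension π₀ ((a : Enveloping N) + b) =
      Completion.extension π₀ a + Completion.extension π₀ b
    rw [← Completion.coe_add, hcoe, hcoe, hcoe]
    exact map_add π _ _
  · intro a b
    refine Completion.induction_on₂ a b (isClosed_eq (by fun_prop) (by fun_prop)) fun a b => ?_
    change Completion.extension π₀ ((a : Enveloping N) * b) =
      Completion.extension π₀ a * Completion.extension π₀ b
    rw [← coe_mul, hcoe, hcoe, hcoe]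
    exact map_mul π _ _
  · intro a
    refine Completion.induction_on a (isClosed_eq (by fun_prop) (by fun_prop)) fun a => ?_
    change Completion.extension π₀ (star (a : Enveloping N)) = star (Completion.extension π₀ a)
    rw [← coe_star, hcoe, hcoe]
    exact map_star π _

end Enveloping

/-- Compatible homomorphisms `φ i` on a directed family of algebras `A i` with maps `p i` to `C`
extend to `C` if the ranges of the `p i` have dense union and `φ i` is contractive for the seminorm
pulled back from `C`. -/
theorem exists_starAlgHom_extension {I : Type*} [Nonempty I] {A : I → Type*}
    [∀ i, NonUnitalRing (A i)] [∀ i, StarRing (A i)] [∀ i, Module ℂ (A i)]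
    {C : Type*} [NonUnitalSeminormedRing C] [StarRing C] [NormedSpace ℂ C] [NormedStarGroup C]
    {B : Type*} [NonUnitalCStarAlgebra B] (p : ∀ i, A i →⋆ₙₐ[ℂ] C) (φ : ∀ i, A i →⋆ₙₐ[ℂ] B)
    (hφ : ∀ i a, ‖φ i a‖ ≤ ‖p i a‖)
    (hdir : ∀ i j (a : A i) (b : A j), ∃ (k : I) (a' b' : A k), p k a' = p i a ∧ p k b' = p j b ∧
      φ k a' = φ i a ∧ φ k b' = φ j b)
    (hdense : ∀ c : C, ∀ ε > 0, ∃ i a, ‖c - p i a‖ < ε) :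
    ∃ ψ : C →⋆ₙₐ[ℂ] B, (∀ c, ‖ψ c‖ ≤ ‖c‖) ∧ ∀ i a, ψ (p i a) = φ i a := by
  classical
  let e : DirectSum I A →ₗ[ℂ] C := DirectSum.toModule ℂ I C fun i =>
    { toFun := p i, map_add' := map_add (p i), map_smul' := map_smul (p i) }
  let k : DirectSum I A →ₗ[ℂ] B := DirectSum.toModule ℂ I B fun i =>
    { toFun := φ i, map_add' := map_add (φ i), map_smul' := map_smul (φ i) }
  have he : ∀ i a, e (DirectSum.lof ℂ I A i a) = p i a := fun i a => DirectSum.toModule_lof ℂ i a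
  have hk : ∀ i a, k (DirectSum.lof ℂ I A i a) = φ i a := fun i a => DirectSum.toModule_lof ℂ i a
  -- By directedness, every element of the direct sum acts like an element of a single summand.
  have hone : ∀ z, ∃ i a, e z = p i a ∧ k z = φ i a := by
    intro z
    induction z using DirectSum.induction_on with
    | zero =>
      obtain ⟨i⟩ := ‹Nonempty I›
      exact ⟨i, 0, by simp, by simp⟩
    | of i a => exact ⟨i, a, he i a, hk i a⟩
    | add z z' ih ih' =>
      obtain ⟨i, a, h1, h2⟩ := ih
      obtain ⟨j, b, h1', h2'⟩ := ih'
      obtain ⟨l, a', b', ha, hb, ha', hb'⟩ := hdir i j a b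
      refine ⟨l, a' + b', ?_, ?_⟩
      · rw [map_add, map_add, ha, hb, h1, h1']
      · rw [map_add, map_add, ha', hb', h2, h2']
  have hrange : DenseRange e := Metric.denseRange_iff.2 fun c ε hε => by
    obtain ⟨i, a, h⟩ := hdense c ε hε
    exact ⟨DirectSum.lof ℂ I A i a, by rwa [he, dist_eq_norm]⟩
  have hnorm : ∀ z, ‖k z‖ ≤ 1 * ‖e z‖ := fun z => by
    obtain ⟨i, a, h1, h2⟩ := hone z
    rw [h1, h2, one_mul]
    exact hφ i a
  let ψ := k.extendOfNorm e
  have hψc : Continuous ψ := ψ.continuous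
  have hψ : ∀ i a, ψ (p i a) = φ i a := fun i a => by
    rw [← he, ← hk]
    exact LinearMap.extendOfNorm_eq hrange ⟨1, hnorm⟩ _
  refine ⟨{ toFun := ψ, map_smul' := fun c f => map_smul ψ c f, map_zero' := map_zero ψ,
            map_add' := map_add ψ, map_mul' := ?_, map_star' := ?_ }, fun c => ?_, hψ⟩
  · intro c d
    refine hrange.induction_on₂ (p := fun c d => ψ (c * d) = ψ c * ψ d)
      (isClosed_eq (by fun_prop) (by fun_prop)) (fun z z' => ?_) c d
    obtain ⟨i, a, h1, -⟩ := hone z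
    obtain ⟨j, b, h1', -⟩ := hone z'
    obtain ⟨l, a', b', ha, hb, -, -⟩ := hdir i j a b
    rw [h1, h1', ← ha, ← hb, ← map_mul, hψ, hψ, hψ, map_mul]
  · intro c
    refine hrange.induction_on (p := fun c => ψ (star c) = star (ψ c)) c
      (isClosed_eq (by fun_prop) (by fun_prop)) fun z => ?_
    obtain ⟨i, a, h1, -⟩ := hone z
    rw [h1, ← map_star, hψ, hψ, map_star]
  · have := LinearMap.norm_extendOfNorm_apply_le hrange 1 hnorm c
    rwa [one_mul] at this

/-! ### The inductive limit -/

namespace DirGraph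

variable {α β : Type*} {E F G : DirGraph α β} {R S : Set α} {W : Set (DirGraph α β)}

namespace Conv

/-- The `I`-norm as a seminorm. -/
noncomputable def iSeminorm (E : DirGraph α β) (S : Set α) : Seminorm ℂ (Conv E S) :=
  Seminorm.of iNorm iNorm_add_le iNorm_smul

noncomputable instance : SeminormedAddCommGroup (Conv E S) :=
  AddGroupSeminorm.toSeminormedAddCommGroup (iSeminorm E S).toAddGroupSeminorm

theorem norm_eq_iNorm (f : Conv E S) : ‖f‖ = iNorm f := rfl

noncomputable instance : NonUnitalSeminormedRing (Conv E S) :=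
  { (inferInstance : SeminormedAddCommGroup (Conv E S)),
    (inferInstance : NonUnitalRing (Conv E S)) with
    norm_mul_le := iNorm_mul_le }

noncomputable instance : NormedSpace ℂ (Conv E S) where
  norm_smul_le c f := (iNorm_smul c f).le

instance : NormedStarGroup (Conv E S) where
  norm_star_le f := (iNorm_star f).le

/-- A compatible family of `I`-norm contractive representations of the convolution algebras of the
members of `W` extends to the convolution algebra of `E`. As the pull-back maps preserve the
`I`-norm, it gives a contraction on the dense union of their ranges. -/
theorem exists_extension (hW : Exhausts W E) (hS : S ⊆ E.regular) {B : Type*}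
    [NonUnitalCStarAlgebra B] (φ : ∀ F : W, Conv F.1 (F.1.restrictSet E S) →⋆ₙₐ[ℂ] B)
    (hφ : ∀ F f, ‖φ F f‖ ≤ iNorm f)
    (hcomp : ∀ (F G : W) (h : F.1.IsSubgraph G.1) (f : Conv F.1 (F.1.restrictSet E S)),
      φ G (pull (isRestriction_restrictSet_restrictSet h (hW.sub G.1 G.2) hS) f) = φ F f) :
    ∃ ψ : Conv E S →⋆ₙₐ[ℂ] B, (∀ g, ‖ψ g‖ ≤ iNorm g) ∧
      ∀ (F : W) (f : Conv F.1 (F.1.restrictSet E S)),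
        ψ (pull (isRestriction_restrictSet (hW.sub F.1 F.2) hS) f) = φ F f := by
  have hr (F : W) := isRestriction_restrictSet (hW.sub F.1 F.2) hS
  have : Nonempty W := hW.nonempty.to_subtype
  refine exists_starAlgHom_extension (fun F : W => pull (hr F)) φ ?_ ?_ ?_
  · intro F f
    rw [norm_eq_iNorm, iNorm_pull]
    exact hφ F f
  · intro F F' f f'
    obtain ⟨G, hG, h, h'⟩ := hW.directed F.1 F.2 F'.1 F'.2
    have hFG := isRestriction_restrictSet_restrictSet h (hW.sub G hG) hS
    have hFG' := isRestriction_restrictSet_restrictSet h' (hW.sub G hG) hS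
    exact ⟨⟨G, hG⟩, pull hFG f, pull hFG' f', pull_pull _ _ _ f, pull_pull _ _ _ f',
      hcomp F ⟨G, hG⟩ h f, hcomp F' ⟨G, hG⟩ h' f'⟩
  · intro g ε hε
    obtain ⟨F, hF, f, hf⟩ := exists_iNorm_sub_pull_lt hW hS g hε
    exact ⟨⟨F, hF⟩, f, hf⟩

end Conv

namespace TO

theorem exists_inclusionMap (hr : IsRestriction F R E S) : ∃ ι : TO F R →⋆ₙₐ[ℂ] TO E S,
    ∀ f, ι (TO.of f) = TO.of (Conv.pull hr f) :=
  Enveloping.exists_extension ((TO.of (E := E) (S := S)).comp (Conv.pull hr)) fun f => by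
    rw [← Conv.iNorm_pull hr]
    exact Enveloping.norm_of_le Conv.iNorm_nonneg _

/-- The *-homomorphism of Toeplitz graph algebras induced by the inclusion of a subgraph. -/
noncomputable def incl (hr : IsRestriction F R E S) : TO F R →⋆ₙₐ[ℂ] TO E S :=
  (exists_inclusionMap hr).choose

theorem incl_of (hr : IsRestriction F R E S) (f : Conv F R) :
    incl hr (TO.of f) = TO.of (Conv.pull hr f) := (exists_inclusionMap hr).choose_spec f

theorem isInclusionMap_incl (hr : IsRestriction F R E S) : IsInclusionMap (incl hr) :=
  fun f => ⟨Conv.pull hr f, Conv.isPullback_pull hr f, incl_of hr f⟩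

theorem incl_self (hr : IsRestriction F R F R) (a : TO F R) : incl hr a = a :=
  DFunLike.congr_fun (Enveloping.hom_ext (ψ := incl hr) (ψ' := NonUnitalStarAlgHom.id ℂ (TO F R))
    fun f => (incl_of hr f).trans (by rw [Conv.pull_self]; rfl)) a

theorem incl_incl {Q : Set α} (hFG : IsRestriction F R G Q) (hGE : IsRestriction G Q E S)
    (hFE : IsRestriction F R E S) (a : TO F R) : incl hGE (incl hFG a) = incl hFE a :=
  DFunLike.congr_fun (Enveloping.hom_ext (ψ := (incl hGE).comp (incl hFG)) (ψ' := incl hFE)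
    fun f => by
      change incl hGE (incl hFG (TO.of f)) = incl hFE (TO.of f)
      rw [incl_of, incl_of, incl_of, Conv.pull_pull]) a

theorem continuous_of : Continuous (TO.of : Conv E S → TO E S) :=
  AddMonoidHomClass.continuous_of_bound TO.of 1 fun f => by
    rw [one_mul]
    exact Enveloping.norm_of_le Conv.iNorm_nonneg f

theorem denseRange_incl (hW : Exhausts W E) (hS : S ⊆ E.regular) :
    DenseRange fun z : Σ F : W, TO F.1 (F.1.restrictSet E S) =>
      incl (isRestriction_restrictSet (hW.sub z.1.1 z.1.2) hS) z.2 := by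
  let pull' : (Σ F : W, Conv F.1 (F.1.restrictSet E S)) → Conv E S := fun z =>
    Conv.pull (isRestriction_restrictSet (hW.sub z.1.1 z.1.2) hS) z.2
  have hpull : DenseRange pull' := by
    refine Metric.denseRange_iff.2 fun g ε hε => ?_
    obtain ⟨F, hF, f, hf⟩ := Conv.exists_iNorm_sub_pull_lt hW hS g hε
    refine ⟨⟨⟨F, hF⟩, f⟩, ?_⟩
    rw [dist_eq_norm]
    exact hf
  refine ((Enveloping.denseRange_of _).comp hpull continuous_of).mono ?_
  rintro _ ⟨z, rfl⟩
  exact ⟨⟨z.1, TO.of z.2⟩, incl_of _ _⟩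

end TO

theorem isEmpty_TG (hE : E.verts = ∅) : IsEmpty (TG E S) :=
  ⟨fun γ => by simpa [hE] using s_mem γ.acts.mem⟩

theorem exists_isInductiveLimit (hW : ∀ F ∈ W, F.IsSubgraph E)
    (hdir : DirectedOn DirGraph.IsSubgraph W) (hverts : ⋃ F ∈ W, F.verts = E.verts)
    (hedges : ⋃ F ∈ W, F.edges = E.edges) (hS : S ⊆ E.regular) :
    ∃ (κ : ∀ F G : W, F.1.IsSubgraph G.1 →
        (F.1.TO (F.1.restrictSet E S) →⋆ₙₐ[ℂ] G.1.TO (G.1.restrictSet E S)))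
      (ι : ∀ F : W, F.1.TO (F.1.restrictSet E S) →⋆ₙₐ[ℂ] E.TO S),
      (∀ F G h, IsInclusionMap (κ F G h)) ∧ (∀ F, IsInclusionMap (ι F)) ∧
      IsInductiveLimit.{w} (fun F G : W => F.1.IsSubgraph G.1)
        (fun F => F.1.TO (F.1.restrictSet E S)) κ (E.TO S) ι := by
  have hr (F : W) := isRestriction_restrictSet (hW F.1 F.2) hS
  have hr' (F G : W) (h : F.1.IsSubgraph G.1) :=
    isRestriction_restrictSet_restrictSet h (hW G.1 G.2) hS
  refine ⟨fun F G h => TO.incl (hr' F G h), fun F => TO.incl (hr F),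
    fun F G h => TO.isInclusionMap_incl _, fun F => TO.isInclusionMap_incl _, ?_⟩
  refine ⟨fun F h a => TO.incl_self _ a, fun F G H hFG hGH hFH a => TO.incl_incl _ _ _ a,
    fun F G h a => TO.incl_incl _ _ _ a, ?_⟩
  intro B _ φ hφ
  rcases W.eq_empty_or_nonempty with rfl | hne
  -- The empty family is directed and covers the empty graph, whose algebra is zero.
  · have hE : E.verts = ∅ := by simpa using hverts.symm
    have := isEmpty_TG (S := S) hE
    refine ⟨0, fun F => absurd F.2 (Set.notMem_empty _), fun ψ _ => Enveloping.hom_ext fun f => ?_⟩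
    have : f = 0 := Conv.ext fun γ => isEmptyElim γ
    rw [this, map_zero, map_zero, map_zero]
  · have hex : Exhausts W E := ⟨hne, hW, hdir, hverts, hedges⟩
    obtain ⟨ψ₀, hψ₀, hψF⟩ := Conv.exists_extension hex hS (fun F => (φ F).comp TO.of)
      (fun F f => (NonUnitalStarAlgHom.norm_apply_le (φ F) _).trans
        (Enveloping.norm_of_le Conv.iNorm_nonneg f))
      fun F G h f => by
        change φ G (TO.of _) = φ F (TO.of f)
        rw [← hφ F G h, TO.incl_of]
    obtain ⟨ψ, hψ⟩ := Enveloping.exists_extension ψ₀ hψ₀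
    have hψφ : ∀ F a, ψ (TO.incl (hr F) a) = φ F a := fun F a =>
      DFunLike.congr_fun (Enveloping.hom_ext (ψ := ψ.comp (TO.incl (hr F))) (ψ' := φ F) fun f => by
        change ψ (TO.incl (hr F) (TO.of f)) = φ F (TO.of f)
        rw [TO.incl_of]
        exact (hψ _).trans (hψF F f)) a
    refine ⟨ψ, hψφ, fun ψ' hψ' => ?_⟩
    refine Enveloping.hom_ext_of_dense (TO.denseRange_incl hex hS) fun z => ?_
    exact (hψ' z.1 z.2).trans (hψφ z.1 z.2).symm

end DirGraph

theorem theorem2p35 {α β : Type*} (E : DirGraph α β) (W : Set (DirGraph α β))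
    (hW : ∀ F ∈ W, F.IsSubgraph E) (hdir : DirectedOn DirGraph.IsSubgraph W)
    (hverts : ⋃ F ∈ W, F.verts = E.verts) (hedges : ⋃ F ∈ W, F.edges = E.edges) :
    (∀ S ⊆ E.regular,
      ∃ (κ : ∀ F G : W, F.1.IsSubgraph G.1 →
          (F.1.TO (F.1.restrictSet E S) →⋆ₙₐ[ℂ] G.1.TO (G.1.restrictSet E S)))
        (ι : ∀ F : W, F.1.TO (F.1.restrictSet E S) →⋆ₙₐ[ℂ] E.TO S),
        (∀ F G h, DirGraph.IsInclusionMap (κ F G h)) ∧ (∀ F, DirGraph.IsInclusionMap (ι F)) ∧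
        IsInductiveLimit.{w} (fun F G : W => F.1.IsSubgraph G.1)
          (fun F => F.1.TO (F.1.restrictSet E S)) κ (E.TO S) ι) ∧
    ∃ (κ : ∀ F G : W, F.1.IsSubgraph G.1 →
        (F.1.TO (F.1.restrictSet E E.regular) →⋆ₙₐ[ℂ] G.1.TO (G.1.restrictSet E E.regular)))
      (ι : ∀ F : W, F.1.TO (F.1.restrictSet E E.regular) →⋆ₙₐ[ℂ] E.graphAlgebra),
      (∀ F G h, DirGraph.IsInclusionMap (κ F G h)) ∧ (∀ F, DirGraph.IsInclusionMap (ι F)) ∧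
      IsInductiveLimit.{w} (fun F G : W => F.1.IsSubgraph G.1)
        (fun F => F.1.TO (F.1.restrictSet E E.regular)) κ E.graphAlgebra ι :=
  ⟨fun _ hS => DirGraph.exists_isInductiveLimit hW hdir hverts hedges hS,
    DirGraph.exists_isInductiveLimit hW hdir hverts hedges subset_rfl⟩
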